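/- Let $(\Omega,\mathcal F,(\mathcal F_t)_{t\in\mathbb R},\mathbb P)$ be a filtered probability space and let $W=(W_t)_{t\in\mathbb R}$ be a two-sided Brownian motion whose increments $W_t-W_s$, $s\le t$, are $\mathcal F_t$-measurable and independent of $\mathcal F_s$. Let $\sigma=(\sigma_t)_{t\in\mathbb R}$ be a positive, càdlàg, adapted process, and let $g\in L^2(\mathbb R)$ be a non-negative kernel with $g(x)=0$ for $x\le 0$. Let $Y$ be the driftless Brownian semistationary process $$Y_t=\int_{-\infty}^t g(t-s)\,\sigma_s\,dW_s,\qquad t\ge 0,$$ where $\int_{-\infty}^t g(t-s)^2\sigma_s^2\,ds<\infty$ almost surely for every $t\ge0$. Let $\Delta_n>0$ with $\Delta_n\to0$, put $\Delta_i^nY=Y_{i\Delta_n}-Y_{(i-1)\Delta_n}$ and $$\tau_n^Y=\sqrt{\mathbb E[(\Delta_1^nY)^2]},\qquad \tau_n^{Y,N}=\sqrt{\frac1N\sum_{i=1}^N(\Delta_i^nY)^2}.$$ Assume that the processes $\sigma$ and $W$ are independent and that, for real constants $A_1,\dots,A_7$, $c$, $K$ and $\tilde A_n$ with $A_4>0$,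 $c>1$, $K\ge0$ and $\tilde A_n>0$: $\sup_{s}\mathbb E[\sigma_s^4]<A_1$; $\mathbb E[\sigma_s^2]$ does not depend on $s$ and is smaller than $A_2$; $\mathrm{Cov}(\sigma_s^2,\sigma_r^2)\le A_3c^{-A_4|s-r|}$ for all $s,r\in\mathbb R$; $g(x)<A_5e^{-A_6x}$ for $x>K$; $A_6>\tfrac12A_4$; $\|g\|_{L^2}^2<A_7$; and $\mathbb E[(\Delta_1^nY)^2]\ge\tilde A_n$ for every $n$. Define $$D_n=\min\bigl(2,\;A_4\min(1,\log c)\bigr)\,\Delta_n,\qquad C(h)=4A_7e^{2h}\left(A_1\Bigl(\frac{A_5^2}{2A_6}+e^{2K}A_7\Bigr)+A_3\Bigl(\frac{A_5^2}{2A_6-A_4}+e^{2K}A_7\Bigr)\right),$$ $$C_n=C(\Delta_n),\qquad E_n=\frac{3\sqrt{C_n}}{\tilde A_n(1-e^{-D_n})}.$$ (For $c=e$ one has $D_n=\min(2,A_4)\Delta_n$.) Then: 1. For every fixed $n$, $\tau_n^{Y,N}\to\tau_n^Y$ in probability as $N\to\infty$. 2. For all $n$ and all $N\ge1$, $$\mathbb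 E\left[\left|\Bigl(\frac{\tau_n^{Y,N}}{\tau_n^Y}\Bigr)^2-1\right|\wedge1\right]\le\frac{E_n}{\sqrt N}.$$ 3. For every $\delta>0$, every $n\ge1$ and every $N\ge E_n^2n^{1+2\delta}$, the expectation in 2 is at most $n^{-(1/2+\delta)}$. 4. For every $n$, $E_n<\dfrac{C'}{\tilde A_n(1-e^{-D_n})}$ with $C'=3\sqrt{C\bigl(1+\sup_k\Delta_k\bigr)}$, which does not depend on $n$. -/

import Mathlib

open MeasureTheory ProbabilityTheory Filter Topology
open scoped NNReal ENNReal

/-- `W` is a two-sided Brownian motion relative to the filtration `F`: its two halves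
`(W t)` and `(W (-t))`, `t ≥ 0`, are independent standard Brownian motions, and for `s ≤ t` the
increment `W t - W s` is `F t`-measurable and independent of `F s`. -/
structure IsTwoSidedBrownianMotion {Ω : Type*} {mΩ : MeasurableSpace Ω} (F : Filtration ℝ mΩ)
    (P : Measure Ω) (W : ℝ → Ω → ℝ) : Prop where
  measurable : ∀ t, Measurable (W t)
  forward : IsBrownianReal (fun (t : ℝ≥0) ω => W t ω) P
  backward : IsBrownianReal (fun (t : ℝ≥0) ω => W (-(t : ℝ)) ω) P
  indep_halves : IndepFun (fun ω (t : ℝ≥0) => W t ω) (fun ω (t : ℝ≥0) => W (-(t : ℝ)) ω) P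
  increment_measurable : ∀ s t, s ≤ t → Measurable[F t] (fun ω => W t ω - W s ω)
  increment_indep : ∀ s t, s ≤ t →
    Indep (MeasurableSpace.comap (fun ω => W t ω - W s ω) inferInstance) (F s) P

/-- A simple predictable process: the bounded random variable `coef k`, which is
`F (time k)`-measurable, is its value on `(time k, time (k + 1)]`, for `k < n`. -/
structure SimplePredictable {Ω : Type*} {mΩ : MeasurableSpace Ω} (F : Filtration ℝ mΩ) where
  n : ℕ
  time : ℕ → ℝ
  mono : Monotone time
  coef : ℕ → Ω → ℝ
  measurable : ∀ k, Measurable[F (time k)] (coef k)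
  bounded : ∃ C : ℝ, ∀ k ω, |coef k ω| ≤ C

/-- The value at time `s` of a simple predictable process. -/
noncomputable def SimplePredictable.toFun {Ω : Type*} {mΩ : MeasurableSpace Ω}
    {F : Filtration ℝ mΩ} (H : SimplePredictable F) (s : ℝ) (ω : Ω) : ℝ :=
  ∑ k ∈ Finset.range H.n,
    (Set.Ioc (H.time k) (H.time (k + 1))).indicator (fun _ => H.coef k ω) s

/-- The elementary stochastic integral of a simple predictable process over the real line. -/
noncomputable def SimplePredictable.integral {Ω : Type*} {mΩ : MeasurableSpace Ω}
    {F : Filtration ℝ mΩ} (H : SimplePredictable F) (W : ℝ → Ω → ℝ) (ω : Ω) : ℝ :=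
  ∑ k ∈ Finset.range H.n, H.coef k ω * (W (H.time (k + 1)) ω - W (H.time k) ω)

/-- `I` is (a version of) the Itô integral over the real line of the square integrable
integrand `H` against `W`: some simple predictable processes converge to `H` in
`L²(Ω × ℝ, P ⊗ ds)` and their elementary integrals converge to `I` in `L²(P)`. -/
def IsItoIntegral {Ω : Type*} {mΩ : MeasurableSpace Ω} (F : Filtration ℝ mΩ) (P : Measure Ω)
    (W : ℝ → Ω → ℝ) (H : ℝ → Ω → ℝ) (I : Ω → ℝ) : Prop :=
  MemLp I 2 P ∧
  ∃ S : ℕ → SimplePredictable F,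
    Tendsto (fun m => ∫⁻ ω, (∫⁻ s, ENNReal.ofReal (((S m).toFun s ω - H s ω) ^ 2)) ∂P)
      atTop (𝓝 0) ∧
    Tendsto (fun m => eLpNorm (fun ω => (S m).integral W ω - I ω) 2 P) atTop (𝓝 0)

/-- Right-continuous with left limits. -/
def IsCadlagPath (f : ℝ → ℝ) : Prop :=
  ∀ t, ContinuousWithinAt f (Set.Ici t) t ∧ ∃ l, Tendsto f (𝓝[<] t) (𝓝 l)

/-- `Y` is the driftless Brownian semistationary process `Y t = ∫_{-∞}^t g (t - s) σ s dW s`,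
`t ≥ 0`. As `g` vanishes on `(-∞, 0]`, the integrand `s ↦ g (t - s) σ s` vanishes for
`s ≥ t`, so the integral over the whole line is the integral over `(-∞, t]`. -/
structure IsBSSProcess {Ω : Type*} {mΩ : MeasurableSpace Ω} (F : Filtration ℝ mΩ)
    (P : Measure Ω) (g : ℝ → ℝ) (σ W Y : ℝ → Ω → ℝ) : Prop where
  kernel_nonneg : ∀ x, 0 ≤ g x
  kernel_zero : ∀ x ≤ 0, g x = 0
  kernel_memLp : MemLp g 2 volume
  vol_pos : ∀ t ω, 0 < σ t ω
  vol_cadlag : ∀ ω, IsCadlagPath (fun t => σ t ω)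
  vol_adapted : Adapted F σ
  brownian : IsTwoSidedBrownianMotion F P W
  integrable : ∀ t, 0 ≤ t →
    ∀ᵐ ω ∂P, ∫⁻ s in Set.Iic t, ENNReal.ofReal (g (t - s) ^ 2 * σ s ω ^ 2) < ∞
  ito : ∀ t, 0 ≤ t → IsItoIntegral F P W (fun s ω => g (t - s) * σ s ω) (Y t)

/-- The `i`-th increment `Y (i h) - Y ((i - 1) h)` at mesh `h`. -/
def increment {Ω : Type*} (Y : ℝ → Ω → ℝ) (h : ℝ) (i : ℕ) (ω : Ω) : ℝ :=
  Y (i * h) ω - Y (((i : ℝ) - 1) * h) ω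

/-- The scale factor `√(E[(Y h - Y 0)²])`. -/
noncomputable def scaleFactor {Ω : Type*} {mΩ : MeasurableSpace Ω} (P : Measure Ω)
    (Y : ℝ → Ω → ℝ) (h : ℝ) : ℝ :=
  √(∫ ω, increment Y h 1 ω ^ 2 ∂P)

/-- The empirical scale factor based on `N` increments of mesh `h`. -/
noncomputable def empiricalScaleFactor {Ω : Type*} (Y : ℝ → Ω → ℝ) (h : ℝ) (N : ℕ)
    (ω : Ω) : ℝ :=
  √((1 / (N : ℝ)) * ∑ i ∈ Finset.Icc 1 N, increment Y h i ω ^ 2)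

/-- The exponent `D` at mesh `h`. For `c = e` it is `min 2 A₄ * h`. -/
noncomputable def rateD (A₄ c h : ℝ) : ℝ := min 2 (A₄ * min 1 (Real.log c)) * h

/-- The constant `C` at mesh `h`. -/
noncomputable def constC (A₁ A₃ A₄ A₅ A₆ A₇ K h : ℝ) : ℝ :=
  4 * A₇ * Real.exp (2 * h) *
    (A₁ * (A₅ ^ 2 / (2 * A₆) + Real.exp (2 * K) * A₇) +
      A₃ * (A₅ ^ 2 / (2 * A₆ - A₄) + Real.exp (2 * K) * A₇))

/-- The constant `E` at mesh `h`, where `a` is a lower bound of `E[(Y h - Y 0)²]`. -/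
noncomputable def constE (A₁ A₃ A₄ A₅ A₆ A₇ K c h a : ℝ) : ℝ :=
  3 * √(constC A₁ A₃ A₄ A₅ A₆ A₇ K h) / (a * (1 - Real.exp (-rateD A₄ c h)))

/-! Since σ and W are independent, an increment X = ∫ f σ dW is, given the path of σ, centred
Gaussian with variance ∫ f² σ². For two increments with kernels f and f' this gives Cov(X², X'²) =
Cov(∫ f² σ², ∫ f'² σ²) + 2 E[(∫ f f' σ²)²]. The first term is a double integral of f² f'² against
Cov(σ_s², σ_r²), which is at most exponentially small in |s - r|. The second is small because the
earlier kernel vanishes after its own time, where only the exponential tail of the later one is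
left. Both are bounded by a multiple of exp(-μ (t - u)) for times u ≤ t, with μ = min(2, A₄ min(1,
log c)). As E[σ_s²] is constant, all squared increments at a given mesh have the same mean, so
summing a geometric series bounds the variance of their average by a constant over N. Cauchy-Schwarz
turns this into an L¹ bound, and dividing by the mean, which is at least the given lower bound,
gives the estimate with E_n / √N; the other claims follow from it or from the formula for E_n.

Conditional Gaussianity is proved only for elementary integrands whose coefficients are functions of
σ: `ElementaryProcess.lintegral_integral_pow_four` freezes the coefficients by means of a product
law. The approximants in the definition of the Itô integral are merely adapted and converge merely
in L². Other approximants, functions of σ and convergent in L⁴(Ω; L²(ℝ)), come from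
`exists_elementaryProcess_mixedNorm_le`; the L² isometry shows in
`IsItoIntegral.isVolatilityIntegral` that their integrals have the same limit. Fatou's lemma then
carries the fourth moment to the limit (`IsVolatilityIntegral.eLpNorm_four`), and polarization gives
the mixed moment (`IsVolatilityIntegral.integral_sq_mul_sq`).

The decay of covariances is `HasExponentialTail.covariance_sq_le`, and the law of large numbers is
`integral_sq_average_sub_le`. -/

/-! ### Gaussian fourth moments -/

/-- The fourth moment of a centred Gaussian law, from the stability of that law under sums. -/
lemma integral_pow_four_gaussianReal (v : ℝ≥0) :
    ∫ x, x ^ 4 ∂(gaussianReal 0 v) = 3 * (v : ℝ) ^ 2 := by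
  set μ := gaussianReal 0 v with hμ
  have hint : ∀ k : ℕ, Integrable (fun x : ℝ => x ^ k) μ := fun k =>
    by
    have h := (memLp_id_gaussianReal (μ := 0) (v := v) k).integrable_norm_pow'
    refine (integrable_norm_iff (by fun_prop)).1 (h.congr (ae_of_all _ fun x => ?_))
    simp
  have h1 : ∫ x, x ∂μ = 0 := integral_id_gaussianReal
  have h2 : ∫ x, x ^ 2 ∂μ = v := by
    have := variance_fun_id_gaussianReal (μ := 0) (v := v)
    rwa [variance_of_integral_eq_zero (by fun_prop) (by simp)] at this
  -- The law N(0, 2v) is that of a sum of two independent copies and also that of √2 times one copy.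
  -- Comparing fourth moments gives 4 m = 2 m + 6 v², hence m = 3 v².
  have e1 : gaussianReal 0 (v + v) = (μ.prod μ).map (fun p : ℝ × ℝ => p.1 + p.2) := by
    have := gaussianReal_conv_gaussianReal (m₁ := 0) (m₂ := 0) (v₁ := v) (v₂ := v)
    rw [add_zero] at this
    rw [← this]; rfl
  have e2 : gaussianReal 0 (v + v) = μ.map (fun x => √2 * x) := by
    rw [hμ, gaussianReal_map_const_mul]
    congr 1
    · simp
    · ext; simp; ring
  have i1 : ∫ x, x ^ 4 ∂(gaussianReal 0 (v + v)) = 4 * ∫ x, x ^ 4 ∂μ := by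
    rw [e2, integral_map (by fun_prop) (by fun_prop), ← integral_const_mul]
    congr 1; ext x
    rw [mul_pow]
    congr 1
    rw [show (4 : ℕ) = 2 * 2 from rfl, pow_mul, Real.sq_sqrt (by norm_num)]; norm_num
  have i2 : ∫ x, x ^ 4 ∂(gaussianReal 0 (v + v)) = 2 * (∫ x, x ^ 4 ∂μ) + 6 * (v : ℝ) ^ 2 := by
    have hp : ∀ k l : ℕ, Integrable (fun p : ℝ × ℝ => p.1 ^ k * p.2 ^ l) (μ.prod μ) :=
      fun k l => (hint k).mul_prod (hint l)
    have hv : ∀ k l : ℕ, ∫ p : ℝ × ℝ, p.1 ^ k * p.2 ^ l ∂(μ.prod μ)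
        = (∫ x, x ^ k ∂μ) * ∫ x, x ^ l ∂μ := fun k l =>
      integral_prod_mul (fun x => x ^ k) (fun x => x ^ l)
    rw [e1, integral_map (by fun_prop) (by fun_prop)]
    have : ∀ p : ℝ × ℝ, (p.1 + p.2) ^ 4 = p.1 ^ 4 * p.2 ^ 0 + 4 * (p.1 ^ 3 * p.2 ^ 1)
        + 6 * (p.1 ^ 2 * p.2 ^ 2) + 4 * (p.1 ^ 1 * p.2 ^ 3) + p.1 ^ 0 * p.2 ^ 4 := by
      intro p; ring
    simp_rw [this]
    rw [integral_add, integral_add, integral_add, integral_add, integral_const_mul,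
      integral_const_mul, integral_const_mul]
    · have hv31 := hv 3 1
      have hv13 := hv 1 3
      simp only [pow_one, h1, mul_zero, zero_mul] at hv31 hv13
      simp only [hv, h2, pow_one, hv31, hv13]
      simp
      ring
    · exact hp 4 0
    · exact (hp 3 1).const_mul 4
    · exact (hp 4 0).add ((hp 3 1).const_mul 4)
    · exact (hp 2 2).const_mul 6
    · exact ((hp 4 0).add ((hp 3 1).const_mul 4)).add ((hp 2 2).const_mul 6)
    · exact (hp 1 3).const_mul 4
    · exact (((hp 4 0).add ((hp 3 1).const_mul 4)).add ((hp 2 2).const_mul 6)).add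
        ((hp 1 3).const_mul 4)
    · exact hp 0 4
  linarith

/-! ### Moments of Brownian increments and their orthogonality to the past -/

namespace IsTwoSidedBrownianMotion

variable {Ω : Type*} {mΩ : MeasurableSpace Ω} {F : Filtration ℝ mΩ} {P : Measure Ω}
  {W : ℝ → Ω → ℝ}

/-- Finite linear combinations of a centred Gaussian process are centred Gaussian. -/
lemma _root_.IsBrownianReal_linearCombination {B : ℝ≥0 → Ω → ℝ} (hB : IsBrownianReal B P)
    {ι : Type*} [Fintype ι] (u : ι → ℝ) (t : ι → ℝ≥0) :
    ∃ v : ℝ≥0, P.map (fun ω => ∑ j, u j * B (t j) ω) = gaussianReal 0 v := by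
  have hG := (hB.isGaussianProcess.comp_right t).smul u
  have h := (hG.hasGaussianLaw_fun_sum (I := Finset.univ)).map_eq_gaussianReal
  refine ⟨_, h.trans (congrArg₂ gaussianReal ?_ rfl)⟩
  simp only [Function.comp_apply, smul_eq_mul]
  rw [integral_finsetSum _ fun j _ => (hB.integrable_eval (t j)).const_mul (u j)]
  refine Finset.sum_eq_zero fun j _ => ?_
  rw [integral_const_mul, hB.integral_eval, mul_zero]

/-- Sorting the times by sign splits the combination into one of the forward half and one of the
backward half. These are independent centred Gaussians, so their sum is again one. -/
lemma linearCombination_law (hW : IsTwoSidedBrownianMotion F P W)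
    {ι : Type*} [Fintype ι] (u : ι → ℝ) (t : ι → ℝ) :
    ∃ v : ℝ≥0, P.map (fun ω => ∑ j, u j * W (t j) ω) = gaussianReal 0 v := by
  obtain ⟨v₁, h₁⟩ := IsBrownianReal_linearCombination hW.forward
    (fun j => if 0 ≤ t j then u j else 0) (fun j => (t j).toNNReal)
  obtain ⟨v₂, h₂⟩ := IsBrownianReal_linearCombination hW.backward
    (fun j => if 0 ≤ t j then 0 else u j) (fun j => (-t j).toNNReal)
  have hind := hW.indep_halves.comp
    (φ := fun w : ℝ≥0 → ℝ => ∑ j, (if 0 ≤ t j then u j else 0) * w (t j).toNNReal)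
    (ψ := fun w : ℝ≥0 → ℝ => ∑ j, (if 0 ≤ t j then 0 else u j) * w (-t j).toNNReal)
    (by fun_prop) (by fun_prop)
  have h := gaussianReal_add_gaussianReal_of_indepFun hind h₁ h₂
  refine ⟨v₁ + v₂, ?_⟩
  rw [add_zero] at h
  rw [← h]
  congr 1
  ext ω
  simp only [Pi.add_apply, Function.comp_apply, ← Finset.sum_add_distrib]
  refine Finset.sum_congr rfl fun j _ => ?_
  split_ifs with hj
  · simp [hj]
  · simp [(not_le.1 hj).le]

/-- The fourth moment of a linear combination is three times its squared second moment. -/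
lemma integral_pow_four (hW : IsTwoSidedBrownianMotion F P W)
    {ι : Type*} [Fintype ι] (u : ι → ℝ) (t : ι → ℝ) :
    ∫ ω, (∑ j, u j * W (t j) ω) ^ 4 ∂P = 3 * (∫ ω, (∑ j, u j * W (t j) ω) ^ 2 ∂P) ^ 2 := by
  obtain ⟨v, hv⟩ := hW.linearCombination_law u t
  have hm : Measurable (fun ω => ∑ j, u j * W (t j) ω) := by
    have := hW.measurable; fun_prop
  have e : ∀ k : ℕ, ∫ ω, (∑ j, u j * W (t j) ω) ^ k ∂P = ∫ x, x ^ k ∂(gaussianReal 0 v) := by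
    intro k
    rw [← hv, integral_map hm.aemeasurable (by fun_prop)]
  have h2 : ∫ x, x ^ 2 ∂(gaussianReal 0 v) = v := by
    have := variance_fun_id_gaussianReal (μ := 0) (v := v)
    rwa [variance_of_integral_eq_zero (by fun_prop) (by simp)] at this
  rw [e, e, h2, integral_pow_four_gaussianReal]

lemma memLp_linearCombination (hW : IsTwoSidedBrownianMotion F P W)
    {ι : Type*} [Fintype ι] (u : ι → ℝ) (t : ι → ℝ) {p : ℝ≥0∞} (hp : p ≠ ∞) :
    MemLp (fun ω => ∑ j, u j * W (t j) ω) p P := by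
  obtain ⟨v, hv⟩ := hW.linearCombination_law u t
  have hm : Measurable (fun ω => ∑ j, u j * W (t j) ω) := by
    have := hW.measurable; fun_prop
  have h := memLp_id_gaussianReal' (μ := 0) (v := v) p hp
  rw [← hv] at h
  exact (memLp_map_measure_iff (by fun_prop) hm.aemeasurable).1 h

lemma memLp (hW : IsTwoSidedBrownianMotion F P W) (t : ℝ) {p : ℝ≥0∞} (hp : p ≠ ∞) :
    MemLp (W t) p P := by
  simpa using hW.memLp_linearCombination (fun _ : Unit => 1) (fun _ => t) hp

lemma memLp_sub (hW : IsTwoSidedBrownianMotion F P W) (s t : ℝ) {p : ℝ≥0∞} (hp : p ≠ ∞) :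
    MemLp (fun ω => W t ω - W s ω) p P :=
  (hW.memLp t hp).sub (hW.memLp s hp)

lemma integrable (hW : IsTwoSidedBrownianMotion F P W) (t : ℝ) : Integrable (W t) P :=
  memLp_one_iff_integrable.1 (hW.memLp t (by norm_num))

lemma integral_eq_zero (hW : IsTwoSidedBrownianMotion F P W) (t : ℝ) : ∫ ω, W t ω ∂P = 0 := by
  obtain ⟨v, hv⟩ := hW.linearCombination_law (fun _ : Unit => 1) (fun _ => t)
  simp only [Finset.univ_unique, one_mul, Finset.sum_const, Finset.card_singleton, one_smul] at hv
  have := integral_map (μ := P) (φ := fun ω => W t ω) (hW.measurable t).aemeasurable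
    (f := fun x : ℝ => x) (by fun_prop)
  rw [← this, hv]
  exact integral_id_gaussianReal

lemma integral_sub_eq_zero (hW : IsTwoSidedBrownianMotion F P W) (s t : ℝ) :
    ∫ ω, (W t ω - W s ω) ∂P = 0 := by
  rw [integral_sub (hW.integrable t) (hW.integrable s), hW.integral_eq_zero, hW.integral_eq_zero, sub_zero]

lemma _root_.IsBrownianReal_integral_sub_sq {B : ℝ≥0 → Ω → ℝ} (hB : IsBrownianReal B P)
    (s t : ℝ≥0) : ∫ ω, (B s ω - B t ω) ^ 2 ∂P = |(s : ℝ) - t| := by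
  have h := hB.hasLaw_sub s t
  have h2 := h.variance_eq
  rw [variance_id_gaussianReal, variance_of_integral_eq_zero h.aemeasurable] at h2
  · simpa [Real.dist_eq] using h2
  · rw [h.integral_eq]; exact integral_id_gaussianReal

lemma integral_sub_sq (hW : IsTwoSidedBrownianMotion F P W) {s t : ℝ} (hst : s ≤ t) :
    ∫ ω, (W t ω - W s ω) ^ 2 ∂P = t - s := by
  rcases le_total 0 s with hs | hs
  · have := IsBrownianReal_integral_sub_sq hW.forward t.toNNReal s.toNNReal
    simpa [hs, hs.trans hst, abs_of_nonneg (sub_nonneg.2 hst)] using this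
  rcases le_total t 0 with ht | ht
  · have := IsBrownianReal_integral_sub_sq hW.backward (-t).toNNReal (-s).toNNReal
    rw [Real.coe_toNNReal _ (by linarith), Real.coe_toNNReal _ (by linarith), neg_neg,
      neg_neg] at this
    rw [this, abs_of_nonpos (by linarith)]; ring
  -- An interval that straddles 0: the two halves are independent and centred, so the cross term
  -- vanishes and the variances t and -s add up.
  · have hind : IndepFun (W t) (W s) P := by
      have hp : ∀ r : ℝ≥0, Measurable (fun w : ℝ≥0 → ℝ => w r) := fun r => measurable_pi_apply r
      have := hW.indep_halves.comp (hp t.toNNReal) (hp (-s).toNNReal)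
      simpa [Function.comp_def, ht, hs] using this
    have e1 : ∫ ω, W t ω ^ 2 ∂P = t := by
      have h := hW.forward.hasLaw_eval t.toNNReal
      have h2 := h.variance_eq
      rw [Real.coe_toNNReal _ ht] at h2
      rwa [variance_id_gaussianReal, variance_of_integral_eq_zero (hW.measurable t).aemeasurable
        (hW.integral_eq_zero t), Real.coe_toNNReal _ ht] at h2
    have e2 : ∫ ω, W s ω ^ 2 ∂P = -s := by
      have h := hW.backward.hasLaw_eval (-s).toNNReal
      have h2 := h.variance_eq
      have hs' : 0 ≤ -s := by linarith
      rw [Real.coe_toNNReal _ hs', neg_neg] at h2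
      rwa [variance_id_gaussianReal, variance_of_integral_eq_zero (hW.measurable s).aemeasurable
        (hW.integral_eq_zero s), Real.coe_toNNReal _ hs'] at h2
    have e3 : ∫ ω, W t ω * W s ω ∂P = 0 := by
      rw [hind.integral_fun_mul_eq_mul_integral (hW.measurable t).aestronglyMeasurable
        (hW.measurable s).aestronglyMeasurable, hW.integral_eq_zero, zero_mul]
    have it := (hW.memLp t (p := 2) (by norm_num)).integrable_sq
    have is := (hW.memLp s (p := 2) (by norm_num)).integrable_sq
    have its : Integrable (fun ω => W t ω * W s ω) P :=
      (hW.memLp t (p := 2) (by norm_num)).integrable_mul (hW.memLp s (p := 2) (by norm_num))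
    have : ∀ ω, (W t ω - W s ω) ^ 2 = W t ω ^ 2 + W s ω ^ 2 - 2 * (W t ω * W s ω) := by
      intro ω; ring
    simp_rw [this]
    rw [integral_sub (f := fun ω => W t ω ^ 2 + W s ω ^ 2) (it.add is) (its.const_mul 2),
      integral_add it is, integral_const_mul, e1, e2,
      e3]
    ring

/-- An increment is orthogonal to the past. -/
lemma integral_mul_sub (hW : IsTwoSidedBrownianMotion F P W) {s t : ℝ} (hst : s ≤ t)
    {Z : Ω → ℝ} (hZ : Measurable[F s] Z) :
    ∫ ω, Z ω * (W t ω - W s ω) ∂P = 0 := by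
  have hind : IndepFun Z (fun ω => W t ω - W s ω) P := by
    rw [IndepFun_iff_Indep]
    exact indep_of_indep_of_le_left (hW.increment_indep s t hst).symm hZ.comap_le
  rw [hind.integral_fun_mul_eq_mul_integral (hZ.mono (F.le s) le_rfl).aestronglyMeasurable
    ((hW.measurable t).sub (hW.measurable s)).aestronglyMeasurable, hW.integral_sub_eq_zero,
    mul_zero]

lemma integral_mul_sub_sq (hW : IsTwoSidedBrownianMotion F P W) {s t : ℝ} (hst : s ≤ t)
    {Z : Ω → ℝ} (hZ : Measurable[F s] Z) :
    ∫ ω, Z ω * (W t ω - W s ω) ^ 2 ∂P = (∫ ω, Z ω ∂P) * (t - s) := by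
  have hind : IndepFun Z (fun ω => W t ω - W s ω) P := by
    rw [IndepFun_iff_Indep]
    exact indep_of_indep_of_le_left (hW.increment_indep s t hst).symm hZ.comap_le
  have hind2 := hind.comp (φ := id) (ψ := fun x : ℝ => x ^ 2) measurable_id (by fun_prop)
  have := hind2.integral_fun_mul_eq_mul_integral
    ((hZ.mono (F.le s) le_rfl).aestronglyMeasurable)
    ((((hW.measurable t).sub (hW.measurable s)).pow_const 2).aestronglyMeasurable)
  simp only [Function.comp_apply, id_eq] at this
  rw [this]
  congr 1
  exact hW.integral_sub_sq hst

end IsTwoSidedBrownianMotion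

/-! ### The Itô isometry for two elementary integrands -/

namespace IsTwoSidedBrownianMotion

variable {Ω : Type*} {mΩ : MeasurableSpace Ω} {F : Filtration ℝ mΩ} {P : Measure Ω}
  {W : ℝ → Ω → ℝ}

lemma integrable_bdd_mul_sub_mul_sub (hW : IsTwoSidedBrownianMotion F P W)
    {Z : Ω → ℝ} (hZ : Measurable Z) {C : ℝ} (hC : ∀ ω, |Z ω| ≤ C) (a b c d : ℝ) :
    Integrable (fun ω => Z ω * ((W b ω - W a ω) * (W d ω - W c ω))) P :=
  ((hW.memLp_sub a b (p := 2) (by norm_num)).integrable_mul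
    (hW.memLp_sub c d (p := 2) (by norm_num))).bdd_mul hZ.aestronglyMeasurable
    (ae_of_all _ hC)

lemma measurable_filtration_sub (hW : IsTwoSidedBrownianMotion F P W) {a b c : ℝ}
    (hab : a ≤ b) (hbc : b ≤ c) : Measurable[F c] (fun ω => W b ω - W a ω) :=
  (hW.increment_measurable a b hab).mono (F.mono hbc) le_rfl

/-- Bilinear Itô isometry for two elementary integrands. -/
lemma integral_mul_sub_mul_sub (hW : IsTwoSidedBrownianMotion F P W) {a b c d : ℝ}
    (hab : a ≤ b) (hcd : c ≤ d) {α β : Ω → ℝ}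
    (hα : Measurable[F a] α) (hβ : Measurable[F c] β) {A B : ℝ}
    (hA : ∀ ω, |α ω| ≤ A) (hB : ∀ ω, |β ω| ≤ B) :
    ∫ ω, α ω * β ω * ((W b ω - W a ω) * (W d ω - W c ω)) ∂P =
      (∫ ω, α ω * β ω ∂P) * volume.real (Set.Ioc a b ∩ Set.Ioc c d) := by
  wlog hac : a ≤ c generalizing a b c d α β A B
  · have := this hcd hab hβ hα hB hA (le_of_not_ge hac)
    simp only [mul_comm (β _)] at this
    rw [Set.inter_comm, ← this]
    simp only [mul_comm (W d _ - W c _)]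
  have hZ : Measurable[F c] (fun ω => α ω * β ω) := (hα.mono (F.mono hac) le_rfl).mul hβ
  have hZm : Measurable (fun ω => α ω * β ω) := hZ.mono (F.le c) le_rfl
  have hZb : ∀ ω, |α ω * β ω| ≤ A * B := fun ω => by
    rw [abs_mul]
    exact mul_le_mul (hA ω) (hB ω) (abs_nonneg _) ((abs_nonneg _).trans (hA ω))
  -- Disjoint increments do not correlate: coefficients and earlier increment are known at time r,
  -- and the later increment is centred and independent of that past. The condition c ≤ r makes both
  -- coefficients known.
  have key : ∀ {p q r s : ℝ}, p ≤ q → q ≤ r → r ≤ s → c ≤ r →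
      ∫ ω, α ω * β ω * ((W q ω - W p ω) * (W s ω - W r ω)) ∂P = 0 := by
    intro p q r s hpq hqr hrs hcr
    have := hW.integral_mul_sub hrs
      (Z := fun ω => α ω * β ω * (W q ω - W p ω))
      ((hZ.mono (F.mono hcr) le_rfl).mul (hW.measurable_filtration_sub hpq hqr))
    simpa only [mul_assoc] using this
  rcases le_total b c with hbc | hcb
  · rw [key hab hbc hcd le_rfl]
    have : Set.Ioc a b ∩ Set.Ioc c d = ∅ := by
      ext x; simp only [Set.mem_inter_iff, Set.mem_Ioc, Set.mem_empty_iff_false, iff_false]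
      intro h; linarith [h.1.2, h.2.1]
    simp [this]
  have hint := hW.integrable_bdd_mul_sub_mul_sub hZm hZb
  have hinter : Set.Ioc a b ∩ Set.Ioc c d = Set.Ioc c (min b d) := by
    rw [Set.Ioc_inter_Ioc, max_eq_right hac]
  have hce : c ≤ min b d := le_min hcb hcd
  rw [hinter, Real.volume_real_Ioc_of_le hce]
  set e := min b d with he
  -- Cutting at c and at e, the end of the overlap (c, e], leaves one square, which carries the
  -- length of the overlap, and three products of increments over disjoint intervals. In the last
  -- product the increment from e to b is zero if b ≤ d and lies after d otherwise.
  have hsplit : ∀ ω, α ω * β ω * ((W b ω - W a ω) * (W d ω - W c ω)) =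
      α ω * β ω * ((W c ω - W a ω) * (W d ω - W c ω)) +
      α ω * β ω * ((W e ω - W c ω) * (W e ω - W c ω)) +
      α ω * β ω * ((W e ω - W c ω) * (W d ω - W e ω)) +
      α ω * β ω * ((W d ω - W c ω) * (W b ω - W e ω)) := by
    intro ω; ring
  simp_rw [hsplit]
  have h3 : ∫ ω, α ω * β ω * ((W d ω - W c ω) * (W b ω - W e ω)) ∂P = 0 := by
    rcases le_total b d with h | h
    · simp [he, min_eq_left h]
    · rw [he, min_eq_right h]; exact key hcd le_rfl h hcd
  rw [integral_add (((hint _ _ _ _).fun_add (hint _ _ _ _)).fun_add (hint _ _ _ _)) (hint _ _ _ _),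
    integral_add ((hint _ _ _ _).fun_add (hint _ _ _ _)) (hint _ _ _ _),
    integral_add (hint _ _ _ _) (hint _ _ _ _), key hac le_rfl hcd le_rfl,
    key hce le_rfl (min_le_right _ _) hce, h3]
  have := hW.integral_mul_sub_sq hce hZ
  simp only [pow_two] at this
  rw [this]; ring

end IsTwoSidedBrownianMotion

/-! ### Elementary processes: the isometry and the conditional fourth moment -/

/-- A finite sum of elementary integrands: the bounded random variable `coef k`, which is
`F (left k)`-measurable, is carried by the interval `(left k, right k]`. The intervals
may overlap. -/
structure ElementaryProcess {Ω : Type*} {mΩ : MeasurableSpace Ω} (F : Filtration ℝ mΩ) where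
  ι : Type
  fintype : Fintype ι
  left : ι → ℝ
  right : ι → ℝ
  left_le_right : ∀ k, left k ≤ right k
  coef : ι → Ω → ℝ
  measurable_coef : ∀ k, Measurable[F (left k)] (coef k)
  bounded : ∀ k, ∃ C : ℝ, ∀ ω, |coef k ω| ≤ C

attribute [instance] ElementaryProcess.fintype

namespace ElementaryProcess

variable {Ω : Type*} {mΩ : MeasurableSpace Ω} {F : Filtration ℝ mΩ} {P : Measure Ω}
  {W : ℝ → Ω → ℝ}

/-- The value at time `s`. -/
noncomputable def toFun (S : ElementaryProcess F) (s : ℝ) (ω : Ω) : ℝ :=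
  ∑ k, (Set.Ioc (S.left k) (S.right k)).indicator (fun _ => S.coef k ω) s

/-- The elementary stochastic integral. -/
noncomputable def integral (S : ElementaryProcess F) (W : ℝ → Ω → ℝ) (ω : Ω) : ℝ :=
  ∑ k, S.coef k ω * (W (S.right k) ω - W (S.left k) ω)

/-- The integral over time of the squared process. -/
noncomputable def energy (S : ElementaryProcess F) (ω : Ω) : ℝ :=
  ∑ k, ∑ l, S.coef k ω * S.coef l ω *
    volume.real (Set.Ioc (S.left k) (S.right k) ∩ Set.Ioc (S.left l) (S.right l))

/-- A simple predictable process is an elementary process. -/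
noncomputable def ofSimple (S : SimplePredictable F) : ElementaryProcess F where
  ι := Fin S.n
  fintype := inferInstance
  left k := S.time k
  right k := S.time (k + 1)
  left_le_right _ := S.mono (Nat.le_succ _)
  coef k := S.coef k
  measurable_coef k := S.measurable k
  bounded k := S.bounded.imp fun _ h => h k

lemma ofSimple_toFun (S : SimplePredictable F) : (ofSimple S).toFun = S.toFun := by
  ext s ω
  exact Fin.sum_univ_eq_sum_range
    (fun k => (Set.Ioc (S.time k) (S.time (k + 1))).indicator (fun _ => S.coef k ω) s) S.n

lemma ofSimple_integral (S : SimplePredictable F) :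
    (ofSimple S).integral W = S.integral W := by
  ext ω
  exact Fin.sum_univ_eq_sum_range
    (fun k => S.coef k ω * (W (S.time (k + 1)) ω - W (S.time k) ω)) S.n

/-- The linear combination `S + c • T`. -/
noncomputable def addSMul (S : ElementaryProcess F) (c : ℝ) (T : ElementaryProcess F) :
    ElementaryProcess F where
  ι := S.ι ⊕ T.ι
  fintype := inferInstance
  left := Sum.elim S.left T.left
  right := Sum.elim S.right T.right
  left_le_right := by rintro (k | k); exacts [S.left_le_right k, T.left_le_right k]
  coef := Sum.elim S.coef (fun k ω => c * T.coef k ω)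
  measurable_coef := by
    rintro (k | k)
    exacts [S.measurable_coef k, (T.measurable_coef k).const_mul c]
  bounded := by
    rintro (k | k)
    · exact S.bounded k
    · obtain ⟨C, hC⟩ := T.bounded k
      refine ⟨|c| * C, fun ω => ?_⟩
      simp only [Sum.elim_inr, abs_mul]
      exact mul_le_mul_of_nonneg_left (hC ω) (abs_nonneg c)

lemma addSMul_toFun (S T : ElementaryProcess F) (c : ℝ) (s : ℝ) (ω : Ω) :
    (S.addSMul c T).toFun s ω = S.toFun s ω + c * T.toFun s ω := by
  have := Fintype.sum_sum_type (fun k : S.ι ⊕ T.ι =>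
    (Set.Ioc ((S.addSMul c T).left k) ((S.addSMul c T).right k)).indicator
      (fun _ => (S.addSMul c T).coef k ω) s)
  refine this.trans ?_
  simp only [toFun, Finset.mul_sum, addSMul, Sum.elim_inl, Sum.elim_inr]
  congr 1
  refine Finset.sum_congr rfl fun k _ => ?_
  simp only [Set.indicator_apply]
  split_ifs <;> simp

lemma addSMul_integral (S T : ElementaryProcess F) (c : ℝ) (ω : Ω) :
    (S.addSMul c T).integral W ω = S.integral W ω + c * T.integral W ω := by
  have := Fintype.sum_sum_type (fun k : S.ι ⊕ T.ι =>
    (S.addSMul c T).coef k ω *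
      (W ((S.addSMul c T).right k) ω - W ((S.addSMul c T).left k) ω))
  refine this.trans ?_
  simp only [integral, Finset.mul_sum, addSMul, Sum.elim_inl, Sum.elim_inr, mul_assoc]

lemma measurable_coef' (S : ElementaryProcess F) (k : S.ι) : Measurable (S.coef k) :=
  (S.measurable_coef k).mono (F.le _) le_rfl

lemma measurable_toFun (S : ElementaryProcess F) :
    Measurable (fun p : Ω × ℝ => S.toFun p.2 p.1) := by
  refine Finset.measurable_sum _ fun k _ => ?_
  have : (fun p : Ω × ℝ => (Set.Ioc (S.left k) (S.right k)).indicator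
      (fun _ => S.coef k p.1) p.2) =
      (Prod.snd ⁻¹' Set.Ioc (S.left k) (S.right k)).indicator (fun p => S.coef k p.1) := rfl
  rw [this]
  exact ((S.measurable_coef' k).comp measurable_fst).indicator (measurable_snd measurableSet_Ioc)

lemma measurable_integral (S : ElementaryProcess F) (hW : ∀ t, Measurable (W t)) :
    Measurable (S.integral W) :=
  Finset.measurable_sum _ fun k _ => (S.measurable_coef' k).mul ((hW _).sub (hW _))

lemma measurable_energy (S : ElementaryProcess F) : Measurable S.energy :=
  Finset.measurable_sum _ fun k _ => Finset.measurable_sum _ fun l _ =>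
    ((S.measurable_coef' k).mul (S.measurable_coef' l)).mul_const _

lemma toFun_sq (S : ElementaryProcess F) (s : ℝ) (ω : Ω) :
    S.toFun s ω ^ 2 = ∑ k, ∑ l, (Set.Ioc (S.left k) (S.right k) ∩
      Set.Ioc (S.left l) (S.right l)).indicator (fun _ => S.coef k ω * S.coef l ω) s := by
  rw [toFun, pow_two, Finset.sum_mul_sum]
  refine Finset.sum_congr rfl fun k _ => Finset.sum_congr rfl fun l _ => ?_
  rw [Set.inter_indicator_mul]

lemma integrable_toFun_sq (S : ElementaryProcess F) (ω : Ω) :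
    Integrable (fun s => S.toFun s ω ^ 2) := by
  simp_rw [toFun_sq]
  refine integrable_finsetSum _ fun k _ => integrable_finsetSum _ fun l _ => ?_
  refine (integrable_indicator_iff (measurableSet_Ioc.inter measurableSet_Ioc)).2 ?_
  refine integrableOn_const ?_
  exact ((measure_mono Set.inter_subset_left).trans_lt measure_Ioc_lt_top).ne

lemma integral_toFun_sq (S : ElementaryProcess F) (ω : Ω) :
    ∫ s, S.toFun s ω ^ 2 = S.energy ω := by
  have hi : ∀ k l, Integrable (fun s => (Set.Ioc (S.left k) (S.right k) ∩
      Set.Ioc (S.left l) (S.right l)).indicator (fun _ => S.coef k ω * S.coef l ω) s) := by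
    intro k l
    refine (integrable_indicator_iff (measurableSet_Ioc.inter measurableSet_Ioc)).2 ?_
    refine integrableOn_const ?_
    exact ((measure_mono Set.inter_subset_left).trans_lt measure_Ioc_lt_top).ne
  simp_rw [toFun_sq]
  rw [integral_finsetSum _ fun k _ => integrable_finsetSum _ fun l _ => hi k l]
  refine Finset.sum_congr rfl fun k _ => ?_
  rw [integral_finsetSum _ fun l _ => hi k l]
  refine Finset.sum_congr rfl fun l _ => ?_
  rw [integral_indicator (measurableSet_Ioc.inter measurableSet_Ioc)]
  simp [mul_comm]

lemma energy_nonneg (S : ElementaryProcess F) (ω : Ω) : 0 ≤ S.energy ω := by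
  rw [← integral_toFun_sq]; positivity

lemma integral_sq (S : ElementaryProcess F) (ω : Ω) :
    S.integral W ω ^ 2 = ∑ k, ∑ l, S.coef k ω * S.coef l ω *
      ((W (S.right k) ω - W (S.left k) ω) * (W (S.right l) ω - W (S.left l) ω)) := by
  rw [integral, pow_two, Finset.sum_mul_sum]
  refine Finset.sum_congr rfl fun k _ => Finset.sum_congr rfl fun l _ => by ring

lemma exists_bound_coef_mul (S : ElementaryProcess F) (k l : S.ι) :
    ∃ C : ℝ, ∀ ω, |S.coef k ω * S.coef l ω| ≤ C := by
  obtain ⟨A, hA⟩ := S.bounded k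
  obtain ⟨B, hB⟩ := S.bounded l
  refine ⟨A * B, fun ω => ?_⟩
  rw [abs_mul]
  exact mul_le_mul (hA ω) (hB ω) (abs_nonneg _) ((abs_nonneg _).trans (hA ω))

lemma integrable_integral_sq (S : ElementaryProcess F) (hW : IsTwoSidedBrownianMotion F P W) :
    Integrable (fun ω => S.integral W ω ^ 2) P := by
  simp_rw [integral_sq]
  refine integrable_finsetSum _ fun k _ => integrable_finsetSum _ fun l _ => ?_
  obtain ⟨C, hC⟩ := S.exists_bound_coef_mul k l
  exact hW.integrable_bdd_mul_sub_mul_sub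
    ((S.measurable_coef' k).mul (S.measurable_coef' l)) hC _ _ _ _

/-- The Itô isometry for elementary processes. -/
lemma integral_integral_sq [IsProbabilityMeasure P] (S : ElementaryProcess F)
    (hW : IsTwoSidedBrownianMotion F P W) :
    ∫ ω, S.integral W ω ^ 2 ∂P = ∫ ω, S.energy ω ∂P := by
  have hi : ∀ k l, Integrable (fun ω => S.coef k ω * S.coef l ω *
      ((W (S.right k) ω - W (S.left k) ω) * (W (S.right l) ω - W (S.left l) ω))) P := by
    intro k l
    obtain ⟨C, hC⟩ := S.exists_bound_coef_mul k l
    exact hW.integrable_bdd_mul_sub_mul_sub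
      ((S.measurable_coef' k).mul (S.measurable_coef' l)) hC _ _ _ _
  have hj : ∀ k l, Integrable (fun ω => S.coef k ω * S.coef l ω *
      volume.real (Set.Ioc (S.left k) (S.right k) ∩ Set.Ioc (S.left l) (S.right l))) P := by
    intro k l
    obtain ⟨C, hC⟩ := S.exists_bound_coef_mul k l
    exact (Integrable.of_bound
      ((S.measurable_coef' k).mul (S.measurable_coef' l)).aestronglyMeasurable C
      (ae_of_all _ hC)).mul_const _
  simp_rw [integral_sq, energy]
  rw [integral_finsetSum _ fun k _ => integrable_finsetSum _ fun l _ => hi k l,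
    integral_finsetSum _ fun k _ => integrable_finsetSum _ fun l _ => hj k l]
  refine Finset.sum_congr rfl fun k _ => ?_
  rw [integral_finsetSum _ fun l _ => hi k l, integral_finsetSum _ fun l _ => hj k l]
  refine Finset.sum_congr rfl fun l _ => ?_
  obtain ⟨A, hA⟩ := S.bounded k
  obtain ⟨B, hB⟩ := S.bounded l
  rw [hW.integral_mul_sub_mul_sub (S.left_le_right k) (S.left_le_right l) (S.measurable_coef k)
    (S.measurable_coef l) hA hB, integral_mul_const]

/-- The process with the same intervals and the constant coefficients `x`. -/
noncomputable def withCoef (S : ElementaryProcess F) (x : S.ι → ℝ) : ElementaryProcess F where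
  ι := S.ι
  fintype := S.fintype
  left := S.left
  right := S.right
  left_le_right := S.left_le_right
  coef k _ := x k
  measurable_coef _ := measurable_const
  bounded k := ⟨|x k|, fun _ => le_rfl⟩

/-- With constant coefficients the integral is a linear combination of values of W, hence Gaussian,
and its fourth moment is three times the squared variance. The isometry identifies that variance as
the energy. -/
lemma integral_withCoef_pow_four [IsProbabilityMeasure P] (S : ElementaryProcess F)
    (hW : IsTwoSidedBrownianMotion F P W) (x : S.ι → ℝ) :
    ∫ ω, (∑ k, x k * (W (S.right k) ω - W (S.left k) ω)) ^ 4 ∂P =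
      3 * (∑ k, ∑ l, x k * x l * volume.real (Set.Ioc (S.left k) (S.right k) ∩
        Set.Ioc (S.left l) (S.right l))) ^ 2 ∧
    Integrable (fun ω => (∑ k, x k * (W (S.right k) ω - W (S.left k) ω)) ^ 4) P := by
  have e : ∀ ω, ∑ k, x k * (W (S.right k) ω - W (S.left k) ω) =
      ∑ j : S.ι ⊕ S.ι, Sum.elim x (fun k => -x k) j * W (Sum.elim S.right S.left j) ω := by
    intro ω
    simp only [Fintype.sum_sum_type, Sum.elim_inl, Sum.elim_inr, ← Finset.sum_add_distrib]
    refine Finset.sum_congr rfl fun k _ => by ring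
  have h2 := (S.withCoef x).integral_integral_sq hW
  have h2' : ∫ ω, (∑ k, x k * (W (S.right k) ω - W (S.left k) ω)) ^ 2 ∂P =
      ∑ k, ∑ l, x k * x l * volume.real (Set.Ioc (S.left k) (S.right k) ∩
        Set.Ioc (S.left l) (S.right l)) := by
    refine h2.trans ?_
    simp only [energy, withCoef, integral_const, probReal_univ, one_smul]
    rfl
  rw [← h2']
  simp_rw [e]
  refine ⟨hW.integral_pow_four _ _, ?_⟩
  have := (hW.memLp_linearCombination (Sum.elim x (fun k => -x k))
    (Sum.elim S.right S.left) (p := (4 : ℕ)) (by simp)).integrable_norm_pow'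
  refine this.congr (ae_of_all _ fun ω => ?_)
  simp only [Real.norm_eq_abs]
  exact (show Even 4 by decide).pow_abs _

/-- Fourth moment of the elementary integral when the coefficients are independent of `W`. -/
lemma lintegral_integral_pow_four [IsProbabilityMeasure P] (S : ElementaryProcess F)
    (hW : IsTwoSidedBrownianMotion F P W)
    (hind : IndepFun (fun ω k => S.coef k ω) (fun ω t => W t ω) P) :
    ∫⁻ ω, ENNReal.ofReal (S.integral W ω ^ 4) ∂P =
      ∫⁻ ω, ENNReal.ofReal (3 * S.energy ω ^ 2) ∂P := by
  set c : Ω → S.ι → ℝ := fun ω k => S.coef k ω with hc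
  set D : Ω → S.ι → ℝ := fun ω k => W (S.right k) ω - W (S.left k) ω with hD
  have hcm : Measurable c := measurable_pi_lambda _ S.measurable_coef'
  have hDm : Measurable D := measurable_pi_lambda _ fun k =>
    (hW.measurable _).sub (hW.measurable _)
  have hcD : IndepFun c D P := by
    have hψ : Measurable (fun (w : ℝ → ℝ) (k : S.ι) => w (S.right k) - w (S.left k)) :=
      measurable_pi_lambda _ fun k => (measurable_pi_apply _).sub (measurable_pi_apply _)
    exact hind.comp measurable_id hψ
  have hprod := (indepFun_iff_map_prod_eq_prod_map_map hcm.aemeasurable hDm.aemeasurable).1 hcD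
  have hf : Measurable (fun p : (S.ι → ℝ) × (S.ι → ℝ) =>
      ENNReal.ofReal ((∑ k, p.1 k * p.2 k) ^ 4)) := by fun_prop
  have hen : Measurable (fun x : S.ι → ℝ => ENNReal.ofReal (3 * (∑ k, ∑ l, x k * x l *
      volume.real (Set.Ioc (S.left k) (S.right k) ∩
        Set.Ioc (S.left l) (S.right l))) ^ 2)) := by fun_prop
  have : IsProbabilityMeasure (P.map D) := Measure.isProbabilityMeasure_map hDm.aemeasurable
  calc ∫⁻ ω, ENNReal.ofReal (S.integral W ω ^ 4) ∂P
      -- By independence the joint law of coefficients and increments is a product, so the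
      -- coefficients can be frozen and the inner integral is the Gaussian fourth moment for
      -- constant coefficients.
      = ∫⁻ p, ENNReal.ofReal ((∑ k, p.1 k * p.2 k) ^ 4) ∂(P.map (fun ω => (c ω, D ω))) := by
        rw [lintegral_map hf (hcm.prodMk hDm)]; rfl
    _ = ∫⁻ x, ∫⁻ y, ENNReal.ofReal ((∑ k, x k * y k) ^ 4) ∂(P.map D) ∂(P.map c) := by
        rw [hprod, lintegral_prod _ hf.aemeasurable]
    _ = ∫⁻ x, ENNReal.ofReal (3 * (∑ k, ∑ l, x k * x l *
          volume.real (Set.Ioc (S.left k) (S.right k) ∩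
            Set.Ioc (S.left l) (S.right l))) ^ 2) ∂(P.map c) := by
        refine lintegral_congr fun x => ?_
        rw [lintegral_map (by fun_prop) hDm, ← (S.integral_withCoef_pow_four hW x).1,
          ofReal_integral_eq_lintegral_ofReal (S.integral_withCoef_pow_four hW x).2
            (ae_of_all _ fun ω => by positivity)]
    _ = ∫⁻ ω, ENNReal.ofReal (3 * S.energy ω ^ 2) ∂P := by
        rw [lintegral_map hen hcm]; rfl

end ElementaryProcess

/-! ### The norms of L^p(Ω; L²(ℝ)) -/

section MixedNorm

variable {Ω : Type*} {mΩ : MeasurableSpace Ω} {P : Measure Ω}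

lemma eLpNorm_two_sq {α : Type*} {mα : MeasurableSpace α} (μ : Measure α) (f : α → ℝ) :
    eLpNorm f 2 μ ^ 2 = ∫⁻ x, ENNReal.ofReal (f x ^ 2) ∂μ := by
  have := eLpNorm_nnreal_pow_eq_lintegral (f := f) (μ := μ) (p := 2) (by norm_num)
  simp only [NNReal.coe_ofNat, ENNReal.rpow_ofNat, ENNReal.coe_ofNat] at this
  rw [this]
  refine lintegral_congr fun x => ?_
  rw [← ofReal_norm, ← ENNReal.ofReal_pow (norm_nonneg _), Real.norm_eq_abs, sq_abs]

lemma eLpNorm_four_pow {α : Type*} {mα : MeasurableSpace α} (μ : Measure α) (f : α → ℝ) :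
    eLpNorm f 4 μ ^ 4 = ∫⁻ x, ENNReal.ofReal (f x ^ 4) ∂μ := by
  have := eLpNorm_nnreal_pow_eq_lintegral (f := f) (μ := μ) (p := 4) (by norm_num)
  simp only [NNReal.coe_ofNat, ENNReal.rpow_ofNat, ENNReal.coe_ofNat] at this
  rw [this]
  refine lintegral_congr fun x => ?_
  rw [← ofReal_norm, ← ENNReal.ofReal_pow (norm_nonneg _), Real.norm_eq_abs,
    (show Even 4 by decide).pow_abs]

/-- The norm of a process in `L^p(Ω; L²(ℝ))`. -/
noncomputable def mixedNorm (P : Measure Ω) (p : ℝ≥0∞) (H : ℝ → Ω → ℝ) : ℝ≥0∞ :=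
  eLpNorm (fun ω => eLpNorm (fun s => H s ω) 2 volume) p P

/-- Joint measurability of a process. -/
def JointlyMeasurable {Ω : Type*} [MeasurableSpace Ω] (H : ℝ → Ω → ℝ) : Prop :=
  Measurable (fun q : Ω × ℝ => H q.2 q.1)

lemma JointlyMeasurable.slice {H : ℝ → Ω → ℝ} (hH : JointlyMeasurable H) (ω : Ω) :
    Measurable (fun s => H s ω) :=
  Measurable.comp hH measurable_prodMk_left

lemma JointlyMeasurable.measurable_at {H : ℝ → Ω → ℝ} (hH : JointlyMeasurable H) (s : ℝ) :
    Measurable (H s) := by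
  have h : Measurable (fun q : Ω × ℝ => H q.2 q.1) := hH
  exact h.comp (measurable_prodMk_right (y := s))

lemma JointlyMeasurable.sub {H G : ℝ → Ω → ℝ} (hH : JointlyMeasurable H)
    (hG : JointlyMeasurable G) : JointlyMeasurable (fun s ω => H s ω - G s ω) :=
  Measurable.sub hH hG

lemma JointlyMeasurable.measurable_eLpNorm {H : ℝ → Ω → ℝ} (hH : JointlyMeasurable H) :
    Measurable (fun ω => eLpNorm (fun s => H s ω) 2 volume) := by
  have : (fun ω => eLpNorm (fun s => H s ω) 2 volume) =
      fun ω => (∫⁻ s, ENNReal.ofReal (H s ω ^ 2)) ^ (1 / 2 : ℝ) := by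
    ext ω
    rw [← eLpNorm_two_sq, ← ENNReal.rpow_natCast, ← ENNReal.rpow_mul]
    norm_num
  rw [this]
  have h2 : Measurable (fun q : Ω × ℝ => ENNReal.ofReal (H q.2 q.1 ^ 2)) :=
    ENNReal.measurable_ofReal.comp (Measurable.pow_const hH 2)
  exact h2.lintegral_prod_right'.pow_const _

/-- Minkowski twice: in L²(ℝ) for each ω, then in L^p(Ω). -/
lemma mixedNorm_add_le {p : ℝ≥0∞} (hp : 1 ≤ p) {H G : ℝ → Ω → ℝ} (hH : JointlyMeasurable H)
    (hG : JointlyMeasurable G) :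
    mixedNorm P p (fun s ω => H s ω + G s ω) ≤ mixedNorm P p H + mixedNorm P p G := by
  refine le_trans (eLpNorm_mono_enorm fun ω => ?_) (eLpNorm_add_le
    hH.measurable_eLpNorm.aestronglyMeasurable hG.measurable_eLpNorm.aestronglyMeasurable hp)
  simp only [enorm_eq_self, Pi.add_apply]
  exact eLpNorm_add_le (hH.slice ω).aestronglyMeasurable (hG.slice ω).aestronglyMeasurable
    (by norm_num)

lemma mixedNorm_neg (p : ℝ≥0∞) (H : ℝ → Ω → ℝ) :
    mixedNorm P p (fun s ω => -H s ω) = mixedNorm P p H := by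
  unfold mixedNorm
  congr 1
  ext ω
  exact eLpNorm_neg (fun s => H s ω) 2 volume

lemma mixedNorm_sub_comm (p : ℝ≥0∞) (H G : ℝ → Ω → ℝ) :
    mixedNorm P p (fun s ω => H s ω - G s ω) = mixedNorm P p (fun s ω => G s ω - H s ω) := by
  rw [← mixedNorm_neg]
  simp only [neg_sub]

lemma mixedNorm_sub_le_add {p : ℝ≥0∞} (hp : 1 ≤ p) {H G K : ℝ → Ω → ℝ}
    (hH : JointlyMeasurable H) (hG : JointlyMeasurable G) (hK : JointlyMeasurable K) :
    mixedNorm P p (fun s ω => H s ω - K s ω) ≤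
      mixedNorm P p (fun s ω => H s ω - G s ω) + mixedNorm P p (fun s ω => G s ω - K s ω) := by
  have := mixedNorm_add_le (P := P) hp (hH.sub hG) (hG.sub hK)
  simpa using this

lemma mixedNorm_two_le_four [IsProbabilityMeasure P] {H : ℝ → Ω → ℝ}
    (hH : JointlyMeasurable H) : mixedNorm P 2 H ≤ mixedNorm P 4 H :=
  eLpNorm_le_eLpNorm_of_exponent_le (by norm_num) hH.measurable_eLpNorm.aestronglyMeasurable

lemma mixedNorm_two_sq (H : ℝ → Ω → ℝ) :
    mixedNorm P 2 H ^ 2 = ∫⁻ ω, (∫⁻ s, ENNReal.ofReal (H s ω ^ 2)) ∂P := by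
  have := eLpNorm_nnreal_pow_eq_lintegral (f := fun ω => eLpNorm (fun s => H s ω) 2 volume)
    (μ := P) (p := 2) (by norm_num)
  simp only [NNReal.coe_ofNat, ENNReal.rpow_ofNat, ENNReal.coe_ofNat, enorm_eq_self] at this
  rw [mixedNorm, this]
  exact lintegral_congr fun ω => eLpNorm_two_sq _ _

lemma mixedNorm_four_pow (H : ℝ → Ω → ℝ) :
    mixedNorm P 4 H ^ 4 = ∫⁻ ω, (∫⁻ s, ENNReal.ofReal (H s ω ^ 2)) ^ 2 ∂P := by
  have := eLpNorm_nnreal_pow_eq_lintegral (f := fun ω => eLpNorm (fun s => H s ω) 2 volume)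
    (μ := P) (p := 4) (by norm_num)
  simp only [NNReal.coe_ofNat, ENNReal.rpow_ofNat, ENNReal.coe_ofNat, enorm_eq_self] at this
  rw [mixedNorm, this]
  refine lintegral_congr fun ω => ?_
  rw [← eLpNorm_two_sq, ← pow_mul]

end MixedNorm

/-! ### Norms of elementary integrals -/

namespace ElementaryProcess

variable {Ω : Type*} {mΩ : MeasurableSpace Ω} {F : Filtration ℝ mΩ} {P : Measure Ω}
  {W : ℝ → Ω → ℝ}

lemma lintegral_toFun_sq (S : ElementaryProcess F) (ω : Ω) :
    ∫⁻ s, ENNReal.ofReal (S.toFun s ω ^ 2) = ENNReal.ofReal (S.energy ω) := by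
  rw [← integral_toFun_sq, ofReal_integral_eq_lintegral_ofReal (S.integrable_toFun_sq ω)
    (ae_of_all _ fun s => sq_nonneg _)]

lemma integrable_energy [IsProbabilityMeasure P] (S : ElementaryProcess F) :
    Integrable S.energy P := by
  refine integrable_finsetSum _ fun k _ => integrable_finsetSum _ fun l _ => ?_
  obtain ⟨C, hC⟩ := S.exists_bound_coef_mul k l
  exact (Integrable.of_bound
    ((S.measurable_coef' k).mul (S.measurable_coef' l)).aestronglyMeasurable C
    (ae_of_all _ hC)).mul_const _

/-- The Itô isometry for elementary processes. -/
lemma eLpNorm_two_integral [IsProbabilityMeasure P] (S : ElementaryProcess F)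
    (hW : IsTwoSidedBrownianMotion F P W) :
    eLpNorm (S.integral W) 2 P = mixedNorm P 2 S.toFun := by
  have : eLpNorm (S.integral W) 2 P ^ 2 = mixedNorm P 2 S.toFun ^ 2 := by
    rw [eLpNorm_two_sq, mixedNorm_two_sq]
    simp_rw [lintegral_toFun_sq]
    rw [← ofReal_integral_eq_lintegral_ofReal (S.integrable_integral_sq hW)
        (ae_of_all _ fun s => sq_nonneg _),
      ← ofReal_integral_eq_lintegral_ofReal S.integrable_energy
        (ae_of_all _ S.energy_nonneg), S.integral_integral_sq hW]
  exact (ENNReal.pow_right_strictMono two_ne_zero).injective this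

/-- The fourth moment of the elementary integral of a process which is independent of `W`. -/
lemma eLpNorm_four_integral_pow [IsProbabilityMeasure P] (S : ElementaryProcess F)
    (hW : IsTwoSidedBrownianMotion F P W)
    (hind : IndepFun (fun ω k => S.coef k ω) (fun ω t => W t ω) P) :
    eLpNorm (S.integral W) 4 P ^ 4 = 3 * mixedNorm P 4 S.toFun ^ 4 := by
  rw [eLpNorm_four_pow, mixedNorm_four_pow, S.lintegral_integral_pow_four hW hind]
  simp_rw [lintegral_toFun_sq]
  rw [← lintegral_const_mul _ (S.measurable_energy.ennreal_ofReal.pow_const 2)]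
  refine lintegral_congr fun ω => ?_
  rw [ENNReal.ofReal_mul (by norm_num), ENNReal.ofReal_pow (S.energy_nonneg ω)]
  norm_num

lemma eLpNorm_four_integral [IsProbabilityMeasure P] (S : ElementaryProcess F)
    (hW : IsTwoSidedBrownianMotion F P W)
    (hind : IndepFun (fun ω k => S.coef k ω) (fun ω t => W t ω) P) :
    eLpNorm (S.integral W) 4 P = 3 ^ (1 / 4 : ℝ) * mixedNorm P 4 S.toFun := by
  refine (ENNReal.pow_right_strictMono four_ne_zero).injective ?_
  rw [S.eLpNorm_four_integral_pow hW hind, mul_pow, ← ENNReal.rpow_natCast (3 ^ _),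
    ← ENNReal.rpow_mul]
  norm_num

end ElementaryProcess

/-! ### Regularity and joint measurability of càdlàg processes -/

section Cadlag

/-- A path with right and left limits has at most countably many jumps. -/
lemma IsCadlagPath.countable_jumps {f : ℝ → ℝ} (hf : IsCadlagPath f) :
    {t | ¬ Tendsto f (𝓝[<] t) (𝓝 (f t))}.Countable := by
  choose hr l hl using hf
  -- A jump at t admits a rational strictly between the left limit and the value. The sets `A q`
  -- collect upward crossings of q and `B q` the downward ones.
  set A : ℚ → Set ℝ := fun q => {t | (∀ᶠ s in 𝓝[<] t, f s < q) ∧ ∀ᶠ s in 𝓝[>] t, (q : ℝ) < f s}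
  set B : ℚ → Set ℝ := fun q => {t | (∀ᶠ s in 𝓝[<] t, (q : ℝ) < f s) ∧ ∀ᶠ s in 𝓝[>] t, f s < q}
  have hA : ∀ q, (A q).Countable := by
    intro q
    refine (countable_setOfPred_isolated_right_within (s := A q)).mono fun t ht => ?_
    refine ⟨ht, ?_⟩
    -- On some (t, u) the path exceeds q, whereas a point of `A q` has values below q just to its
    -- left. So t is isolated in `A q` from the right, and a set has only countably many such
    -- points.
    obtain ⟨u, hu, hsub⟩ := mem_nhdsGT_iff_exists_Ioo_subset.1 ht.2
    refine Filter.empty_mem_iff_bot.1 ?_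
    have : Set.Ioo t u ∈ 𝓝[A q ∩ Set.Ioi t] t :=
      nhdsWithin_mono t Set.inter_subset_right (Ioo_mem_nhdsGT hu)
    filter_upwards [this, self_mem_nhdsWithin] with x hx hx'
    obtain ⟨s, hs1, hs2⟩ := (hx'.1.1.and (Ioo_mem_nhdsLT hx.1)).exists
    exact absurd (hsub ⟨hs2.1, hs2.2.trans hx.2⟩) (not_lt.2 (show f s < q from hs1).le)
  have hB : ∀ q, (B q).Countable := by
    intro q
    refine (countable_setOfPred_isolated_right_within (s := B q)).mono fun t ht => ?_
    refine ⟨ht, ?_⟩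
    obtain ⟨u, hu, hsub⟩ := mem_nhdsGT_iff_exists_Ioo_subset.1 ht.2
    refine Filter.empty_mem_iff_bot.1 ?_
    have : Set.Ioo t u ∈ 𝓝[B q ∩ Set.Ioi t] t :=
      nhdsWithin_mono t Set.inter_subset_right (Ioo_mem_nhdsGT hu)
    filter_upwards [this, self_mem_nhdsWithin] with x hx hx'
    obtain ⟨s, hs1, hs2⟩ := (hx'.1.1.and (Ioo_mem_nhdsLT hx.1)).exists
    exact absurd (hsub ⟨hs2.1, hs2.2.trans hx.2⟩) (not_lt.2 (show (q : ℝ) < f s from hs1).le)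
  refine ((Set.countable_iUnion hA).union (Set.countable_iUnion hB)).mono fun t ht => ?_
  have hne : l t ≠ f t := fun h => ht (h ▸ hl t)
  have hr' : Tendsto f (𝓝[>] t) (𝓝 (f t)) :=
    ((hr t).mono Set.Ioi_subset_Ici_self)
  rcases hne.lt_or_gt with h | h
  · obtain ⟨q, h1, h2⟩ := exists_rat_btwn h
    exact Or.inl (Set.mem_iUnion.2 ⟨q, (hl t).eventually (gt_mem_nhds h1),
      hr'.eventually (lt_mem_nhds h2)⟩)
  · obtain ⟨q, h1, h2⟩ := exists_rat_btwn h
    exact Or.inr (Set.mem_iUnion.2 ⟨q, (hl t).eventually (lt_mem_nhds h2),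
      hr'.eventually (gt_mem_nhds h1)⟩)

lemma IsCadlagPath.ae_tendsto_left {f : ℝ → ℝ} (hf : IsCadlagPath f) :
    ∀ᵐ t, Tendsto f (𝓝[<] t) (𝓝 (f t)) := by
  have := hf.countable_jumps.measure_zero volume
  rwa [ae_iff]

/-- A process with right-continuous paths is jointly measurable. -/
lemma jointlyMeasurable_of_rightContinuous {Ω : Type*} {mΩ : MeasurableSpace Ω}
    {σ : ℝ → Ω → ℝ} (hm : ∀ t, Measurable (σ t))
    (hc : ∀ ω t, ContinuousWithinAt (fun s => σ s ω) (Set.Ici t) t) : JointlyMeasurable σ := by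
  -- The sampling times are grid points strictly to the right of the given time and converge to it,
  -- so right-continuity is enough. For fixed n the sampled process depends on time through an
  -- integer only, which makes its joint measurability elementary.
  have hlim : ∀ q : Ω × ℝ, Tendsto (fun n : ℕ => σ ((⌊q.2 * (n + 1)⌋ + 1 : ℝ) / (n + 1)) q.1)
      atTop (𝓝 (σ q.2 q.1)) := by
    intro q
    refine (hc q.1 q.2).tendsto.comp ?_
    refine tendsto_nhdsWithin_iff.2 ⟨?_, Eventually.of_forall fun n => ?_⟩
    · refine tendsto_of_tendsto_of_tendsto_of_le_of_le (g := fun _ => q.2)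
        (h := fun n : ℕ => q.2 + 1 / ((n : ℝ) + 1)) tendsto_const_nhds ?_ (fun n => ?_)
        (fun n => ?_)
      · simpa using tendsto_const_nhds.add (tendsto_one_div_add_atTop_nhds_zero_nat (𝕜 := ℝ))
      · have hn : (0 : ℝ) < n + 1 := by positivity
        simp only
        rw [le_div_iff₀ hn]
        exact (Int.lt_floor_add_one _).le
      · have hn : (0 : ℝ) < n + 1 := by positivity
        simp only
        rw [div_le_iff₀ hn, add_mul, one_div, inv_mul_cancel₀ hn.ne']
        linarith [Int.floor_le (q.2 * ((n : ℝ) + 1))]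
    · have hn : (0 : ℝ) < n + 1 := by positivity
      simp only [Set.mem_Ici]
      rw [le_div_iff₀ hn]
      exact (Int.lt_floor_add_one _).le
  refine measurable_of_tendsto_metrizable (fun n => ?_) (tendsto_pi_nhds.2 hlim)
  have h1 : Measurable (fun p : Ω × ℤ => σ ((p.2 + 1 : ℝ) / (n + 1)) p.1) :=
    measurable_from_prod_countable_left fun k => hm ((k + 1 : ℝ) / (n + 1))
  have h2 : Measurable (fun q : Ω × ℝ => (q.1, ⌊q.2 * ((n : ℝ) + 1)⌋)) :=
    measurable_fst.prodMk (measurable_snd.mul_const _).floor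
  exact h1.comp h2

end Cadlag

/-! ### Approximation in L⁴(Ω; L²(ℝ)) by elementary processes -/

/-- The Cauchy–Schwarz inequality for lower integrals. -/
lemma lintegral_mul_sq_le {α : Type*} {mα : MeasurableSpace α} {μ : Measure α} {u v : α → ℝ≥0∞}
    (hu : AEMeasurable u μ) (hv : AEMeasurable v μ) :
    (∫⁻ x, u x * v x ∂μ) ^ 2 ≤ (∫⁻ x, u x ^ 2 ∂μ) * ∫⁻ x, v x ^ 2 ∂μ := by
  have h := ENNReal.lintegral_mul_le_Lp_mul_Lq μ Real.HolderConjugate.two_two hu hv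
  have h2 := pow_le_pow_left' h 2
  rw [mul_pow, ← ENNReal.rpow_natCast (_ ^ _), ← ENNReal.rpow_natCast ((∫⁻ x, v x ^ _ ∂μ) ^ _),
    ← ENNReal.rpow_mul, ← ENNReal.rpow_mul] at h2
  simpa using h2

section Approximation

variable {Ω : Type*} {mΩ : MeasurableSpace Ω} {F : Filtration ℝ mΩ} {P : Measure Ω}

/-- The norm of `f σ` in `L⁴(Ω; L²(ℝ))` is controlled by the norm of `f` in `L²`. -/
lemma mixedNorm_four_mul_pow_le [SFinite P] {f : ℝ → ℝ} (hf : Measurable f) {σ : ℝ → Ω → ℝ}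
    (hσ : JointlyMeasurable σ) {A : ℝ≥0∞} (hA : ∀ s, ∫⁻ ω, ENNReal.ofReal (σ s ω ^ 4) ∂P ≤ A) :
    mixedNorm P 4 (fun s ω => f s * σ s ω) ^ 4 ≤ A * eLpNorm f 2 volume ^ 4 := by
  rw [mixedNorm_four_pow, show (4 : ℕ) = 2 * 2 from rfl, pow_mul (eLpNorm f 2 volume),
    eLpNorm_two_sq]
  have hfm : Measurable (fun s => ENNReal.ofReal (f s ^ 2)) := by fun_prop
  have hj : Measurable (fun q : Ω × ℝ => ENNReal.ofReal (f q.2 ^ 2) *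
      ENNReal.ofReal (σ q.2 q.1 ^ 4)) :=
    (hfm.comp measurable_snd).mul (Measurable.pow_const hσ 4).ennreal_ofReal
  calc ∫⁻ ω, (∫⁻ s, ENNReal.ofReal ((f s * σ s ω) ^ 2)) ^ 2 ∂P
      ≤ ∫⁻ ω, (∫⁻ s, ENNReal.ofReal (f s ^ 2)) *
          (∫⁻ s, ENNReal.ofReal (f s ^ 2) * ENNReal.ofReal (σ s ω ^ 4)) ∂P := by
        refine lintegral_mono fun ω => ?_
        -- Splitting f² σ² as |f| times |f| σ² puts the fourth power on σ alone, so only a uniform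
        -- bound of E[σ_s⁴] is needed.
        have := lintegral_mul_sq_le (μ := volume) (u := fun s => ENNReal.ofReal |f s|)
          (v := fun s => ENNReal.ofReal (|f s| * σ s ω ^ 2)) (by fun_prop)
          ((hf.abs.mul ((hσ.slice ω).pow_const 2)).ennreal_ofReal.aemeasurable)
        refine le_trans (le_of_eq ?_) (this.trans (le_of_eq ?_))
        · congr 1
          refine lintegral_congr fun s => ?_
          rw [← ENNReal.ofReal_mul (abs_nonneg _), ← mul_assoc, abs_mul_abs_self]
          congr 1; ring
        · congr 1
          · refine lintegral_congr fun s => ?_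
            rw [← ENNReal.ofReal_pow (abs_nonneg _), sq_abs]
          · refine lintegral_congr fun s => ?_
            rw [← ENNReal.ofReal_pow (by positivity), ← ENNReal.ofReal_mul (sq_nonneg _),
              mul_pow, sq_abs, ← pow_mul]
    _ = (∫⁻ s, ENNReal.ofReal (f s ^ 2)) *
          ∫⁻ s, ENNReal.ofReal (f s ^ 2) * (∫⁻ ω, ENNReal.ofReal (σ s ω ^ 4) ∂P) := by
        rw [lintegral_const_mul _ hj.lintegral_prod_right',
          lintegral_lintegral_swap hj.aemeasurable]
        congr 1
        refine lintegral_congr fun s => ?_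
        have hs : Measurable (σ s) := hσ.measurable_at s
        exact lintegral_const_mul (ENNReal.ofReal (f s ^ 2)) (hs.pow_const 4).ennreal_ofReal
    _ ≤ (∫⁻ s, ENNReal.ofReal (f s ^ 2)) * ∫⁻ s, ENNReal.ofReal (f s ^ 2) * A := by
        gcongr with s; exact hA s
    _ = A * (∫⁻ s, ENNReal.ofReal (f s ^ 2)) ^ 2 := by
        rw [lintegral_mul_const _ hfm]; ring

/-- Dominated convergence in `L⁴(Ω; L²(ℝ))` for processes carried by a compact interval. -/
lemma tendsto_mixedNorm_four_zero [SFinite P] {H : ℕ → ℝ → Ω → ℝ} {G : ℝ → Ω → ℝ}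
    (hH : ∀ n, JointlyMeasurable (H n)) {R : ℝ}
    (hsupp : ∀ n s ω, s ∉ Set.Icc (-R) R → H n s ω = 0)
    (hbound : ∀ n s ω, |H n s ω| ≤ G s ω)
    (hG : ∫⁻ q, ENNReal.ofReal (G q.2 q.1 ^ 4)
      ∂(P.prod (volume.restrict (Set.Icc (-R) R))) ≠ ∞)
    (hlim : ∀ ω, ∀ᵐ s, Tendsto (fun n => H n s ω) atTop (𝓝 0)) :
    Tendsto (fun n => mixedNorm P 4 (H n)) atTop (𝓝 0) := by
  set ν := P.prod (volume.restrict (Set.Icc (-R) R)) with hν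
  have hm : ∀ n, Measurable (fun q : Ω × ℝ => ENNReal.ofReal (H n q.2 q.1 ^ 4)) := fun n =>
    (Measurable.pow_const (hH n) 4).ennreal_ofReal
  have h1 : ∀ n, mixedNorm P 4 (H n) ^ 4 ≤ volume (Set.Icc (-R) R) *
      ∫⁻ q, ENNReal.ofReal (H n q.2 q.1 ^ 4) ∂ν := by
    intro n
    rw [mixedNorm_four_pow, hν, lintegral_prod _ (hm n).aemeasurable,
      ← lintegral_const_mul _ (hm n).lintegral_prod_right']
    refine lintegral_mono fun ω => ?_
    have e : ∫⁻ s, ENNReal.ofReal (H n s ω ^ 2) =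
        ∫⁻ s in Set.Icc (-R) R, 1 * ENNReal.ofReal (H n s ω ^ 2) := by
      simp only [one_mul]
      refine (setLIntegral_eq_of_support_subset fun s hs => ?_).symm
      by_contra h
      exact hs (by simp [hsupp n s ω h])
    rw [e]
    -- Cauchy-Schwarz against the constant 1 on the window: its finite length reduces the mixed norm
    -- to an ordinary L⁴ norm on the product space.
    refine (lintegral_mul_sq_le aemeasurable_const
      (((hH n).slice ω).pow_const 2).ennreal_ofReal.aemeasurable).trans (le_of_eq ?_)
    congr 1
    · simp
    · refine lintegral_congr fun s => ?_
      rw [← ENNReal.ofReal_pow (sq_nonneg _), ← pow_mul]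
  have hae : ∀ᵐ q ∂ν, Tendsto (fun n => H n q.2 q.1) atTop (𝓝 0) := by
    have hset : MeasurableSet {q : Ω × ℝ | Tendsto (fun n => H n q.2 q.1) atTop (𝓝 0)} :=
      measurableSet_tendsto (𝓝 0) fun n => hH n
    rw [hν]
    refine (Measure.ae_prod_iff_ae_ae hset).2 (ae_of_all _ fun ω => ?_)
    exact ae_restrict_of_ae (hlim ω)
  have h2 : Tendsto (fun n => ∫⁻ q, ENNReal.ofReal (H n q.2 q.1 ^ 4) ∂ν) atTop (𝓝 0) := by
    have := tendsto_lintegral_of_dominated_convergence (μ := ν) (f := fun _ => 0)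
      (fun q => ENNReal.ofReal (G q.2 q.1 ^ 4)) hm
      (fun n => ae_of_all _ fun q => ENNReal.ofReal_le_ofReal (by
        rw [← (show Even 4 by decide).pow_abs]
        exact pow_le_pow_left₀ (abs_nonneg _) (hbound n q.2 q.1) 4)) hG
      (hae.mono fun q hq => by
        have := (ENNReal.tendsto_ofReal (hq.pow 4))
        simpa using this)
    simpa using this
  have h3 : Tendsto (fun n => mixedNorm P 4 (H n) ^ 4) atTop (𝓝 0) := by
    refine tendsto_of_tendsto_of_tendsto_of_le_of_le tendsto_const_nhds ?_ (fun _ => zero_le)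
      h1
    have := ENNReal.Tendsto.const_mul h2 (Or.inr
      (measure_Icc_lt_top (μ := volume) (a := -R) (b := R)).ne)
    simpa using this
  have h4 := (ENNReal.continuous_rpow_const (y := (1 / 4 : ℝ))).tendsto 0 |>.comp h3
  simp only [Function.comp_def, ← ENNReal.rpow_natCast, ← ENNReal.rpow_mul] at h4
  simpa using h4

/-- Sampling a bounded adapted process at the left endpoints of a grid of mesh `1 / (n + 1)`. -/
noncomputable def gridProcess (h : ℝ → Ω → ℝ) (hm : ∀ s, Measurable[F s] (h s)) {M : ℝ}
    (hM : ∀ s ω, |h s ω| ≤ M) (R n : ℕ) : ElementaryProcess F where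
  ι := Fin (2 * R * (n + 1))
  fintype := inferInstance
  left k := -R + k / (n + 1)
  right k := -R + (k + 1) / (n + 1)
  left_le_right k := by gcongr; linarith
  coef k := h (-R + k / (n + 1))
  measurable_coef _ := hm _
  bounded _ := ⟨M, hM _⟩

/-- The sampled time lies strictly before s, so the grid values converge at every s where the path
is left-continuous. -/
lemma gridProcess_toFun_of_mem {h : ℝ → Ω → ℝ} (hm : ∀ s, Measurable[F s] (h s)) {M : ℝ}
    (hM : ∀ s ω, |h s ω| ≤ M) (R n : ℕ) {s : ℝ} (hs : s ∈ Set.Ioc (-R : ℝ) R) :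
    ∃ t, s - 1 / (n + 1) ≤ t ∧ t < s ∧ ∀ ω, (gridProcess h hm hM R n).toFun s ω = h t ω := by
  have hn : (0 : ℝ) < n + 1 := by positivity
  have hpos : 0 < (s + R) * (n + 1) := mul_pos (by linarith [hs.1]) hn
  -- The cells are open on the left, so the cell of s is numbered by the ceiling minus one.
  obtain ⟨k, hk⟩ : ∃ k : ℕ, ⌈(s + R) * ((n : ℝ) + 1)⌉₊ = k + 1 :=
    Nat.exists_eq_add_one.2 (Nat.ceil_pos.2 hpos)
  have hk1 : (s + R) * (n + 1) ≤ k + 1 := by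
    have := Nat.le_ceil ((s + R) * ((n : ℝ) + 1))
    rw [hk] at this; exact_mod_cast this
  have hk2 : (k : ℝ) < (s + R) * (n + 1) := by
    have := Nat.ceil_lt_add_one hpos.le
    rw [hk] at this; push_cast at this; linarith
  have hlt : k < 2 * R * (n + 1) := by
    have : (k : ℝ) < 2 * R * (n + 1) := hk2.trans_le (by nlinarith [hs.2])
    exact_mod_cast this
  have e1 : (k : ℝ) / (n + 1) < s + R := by rwa [div_lt_iff₀ hn]
  have e2 : s + R ≤ (k + 1 : ℝ) / (n + 1) := by rwa [le_div_iff₀ hn]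
  refine ⟨-R + k / (n + 1), ?_, by linarith, fun ω => ?_⟩
  · rw [add_div] at e2; linarith
  · refine (Finset.sum_eq_single (⟨k, hlt⟩ : Fin (2 * R * (n + 1))) ?_
      (fun h => absurd (Finset.mem_univ _) h)).trans ?_
    · intro j _ hj
      refine Set.indicator_of_notMem (fun hmem => hj ?_) _
      have m1 : -(R : ℝ) + (j : ℕ) / (n + 1) < s := hmem.1
      have m2 : s ≤ -(R : ℝ) + ((j : ℕ) + 1) / (n + 1) := hmem.2
      have a1 : ((j : ℕ) : ℝ) < k + 1 := by
        have : ((j : ℕ) : ℝ) / (n + 1) < (k + 1 : ℝ) / (n + 1) := by linarith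
        exact (div_lt_div_iff_of_pos_right hn).1 this
      have a2 : (k : ℝ) < (j : ℕ) + 1 := by
        have : (k : ℝ) / (n + 1) < ((j : ℕ) + 1 : ℝ) / (n + 1) := by linarith
        exact (div_lt_div_iff_of_pos_right hn).1 this
      have b1 : (j : ℕ) < k + 1 := by exact_mod_cast a1
      have b2 : k < (j : ℕ) + 1 := by exact_mod_cast a2
      exact Fin.ext (by simp only; omega)
    · refine Set.indicator_of_mem (s := Set.Ioc (-(R : ℝ) + k / (n + 1))
        (-(R : ℝ) + (k + 1) / (n + 1))) ?_ _
      exact ⟨by linarith, by linarith⟩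

lemma gridProcess_toFun_of_notMem {h : ℝ → Ω → ℝ} (hm : ∀ s, Measurable[F s] (h s)) {M : ℝ}
    (hM : ∀ s ω, |h s ω| ≤ M) (R n : ℕ) {s : ℝ} (hs : s ∉ Set.Ioc (-R : ℝ) R) (ω : Ω) :
    (gridProcess h hm hM R n).toFun s ω = 0 := by
  have hn : (0 : ℝ) < n + 1 := by positivity
  refine Finset.sum_eq_zero fun (j : Fin (2 * R * (n + 1))) _ =>
    Set.indicator_of_notMem (fun hmem => hs ?_) _
  have m1 : -(R : ℝ) + (j : ℕ) / (n + 1) < s := hmem.1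
  have m2 : s ≤ -(R : ℝ) + ((j : ℕ) + 1) / (n + 1) := hmem.2
  have j1 : ((j : ℕ) + 1 : ℝ) ≤ 2 * R * (n + 1) := by exact_mod_cast j.2
  have j2 : ((j : ℕ) + 1 : ℝ) / (n + 1) ≤ 2 * R := by rwa [div_le_iff₀ hn]
  have j3 : 0 ≤ ((j : ℕ) : ℝ) / (n + 1) := by positivity
  exact ⟨by linarith, by linarith⟩

/-- The grid approximations of a bounded process with compact support in time. -/
lemma tendsto_gridProcess [IsProbabilityMeasure P] {h : ℝ → Ω → ℝ}
    (hm : ∀ s, Measurable[F s] (h s)) (hj : JointlyMeasurable h) {M : ℝ}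
    (hM : ∀ s ω, |h s ω| ≤ M) {R : ℕ} (hR : ∀ s ω, s ∉ Set.Ioc (-R : ℝ) R → h s ω = 0)
    (hleft : ∀ ω, ∀ᵐ s, Tendsto (fun t => h t ω) (𝓝[<] s) (𝓝 (h s ω))) :
    Tendsto (fun n => mixedNorm P 4
      (fun s ω => (gridProcess h hm hM R n).toFun s ω - h s ω)) atTop (𝓝 0) := by
  refine tendsto_mixedNorm_four_zero (R := R) (G := fun _ _ => M + M)
    (fun n => JointlyMeasurable.sub (ElementaryProcess.measurable_toFun _) hj) ?_ ?_ ?_ ?_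
  · intro n s ω hs
    have hs' : s ∉ Set.Ioc (-R : ℝ) R := fun h => hs (Set.Ioc_subset_Icc_self h)
    rw [gridProcess_toFun_of_notMem hm hM R n hs', hR s ω hs', sub_zero]
  · intro n s ω
    refine (abs_sub _ _).trans (add_le_add ?_ (hM s ω))
    by_cases hs : s ∈ Set.Ioc (-R : ℝ) R
    · obtain ⟨t, -, -, ht⟩ := gridProcess_toFun_of_mem hm hM R n hs
      rw [ht]; exact hM t ω
    · rw [gridProcess_toFun_of_notMem hm hM R n hs, abs_zero]
      exact (abs_nonneg _).trans (hM s ω)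
  · simp [ENNReal.mul_eq_top]
  · intro ω
    filter_upwards [hleft ω] with s hs
    by_cases hmem : s ∈ Set.Ioc (-R : ℝ) R
    · choose t ht1 ht2 ht3 using fun n => gridProcess_toFun_of_mem hm hM R n hmem
      simp_rw [ht3]
      have : Tendsto t atTop (𝓝[<] s) := by
        refine tendsto_nhdsWithin_iff.2 ⟨?_, Eventually.of_forall ht2⟩
        refine tendsto_of_tendsto_of_tendsto_of_le_of_le
          (g := fun n : ℕ => s - 1 / ((n : ℝ) + 1)) ?_ tendsto_const_nhds ht1
          (fun n => (ht2 n).le)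
        simpa using tendsto_const_nhds.sub (tendsto_one_div_add_atTop_nhds_zero_nat (𝕜 := ℝ))
      simpa using (hs.comp this).sub_const (h s ω)
    · simp [gridProcess_toFun_of_notMem hm hM R _ hmem, hR s ω hmem]

end Approximation

section Approximation

variable {Ω : Type*} {mΩ : MeasurableSpace Ω} {F : Filtration ℝ mΩ} {P : Measure Ω}

/-- The σ-algebra generated by all the values of a process. -/
abbrev pathSigma (σ : ℝ → Ω → ℝ) : MeasurableSpace Ω :=
  MeasurableSpace.comap (fun ω t => σ t ω) inferInstance

lemma measurable_pathSigma (σ : ℝ → Ω → ℝ) (t : ℝ) : Measurable[pathSigma σ] (σ t) :=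
  (measurable_pi_apply t).comp (comap_measurable (fun ω t => σ t ω))

/-- Processes `f σ` with `f ∈ L²` are limits in `L⁴(Ω; L²(ℝ))` of elementary processes whose
coefficients are functions of `σ`. -/
lemma exists_elementaryProcess_mixedNorm_le [IsProbabilityMeasure P] {σ : ℝ → Ω → ℝ}
    (hpos : ∀ t ω, 0 < σ t ω) (hcad : ∀ ω, IsCadlagPath (fun t => σ t ω)) (had : Adapted F σ)
    {A : ℝ≥0∞} (hAtop : A ≠ ∞) (hA : ∀ s, ∫⁻ ω, ENNReal.ofReal (σ s ω ^ 4) ∂P ≤ A)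
    {f : ℝ → ℝ} (hf : Measurable f) (hf2 : MemLp f 2 volume) {ε : ℝ≥0∞} (hε : ε ≠ 0) :
    ∃ S : ElementaryProcess F, (∀ k, Measurable[pathSigma σ] (S.coef k)) ∧
      mixedNorm P 4 (fun s ω => S.toFun s ω - f s * σ s ω) ≤ ε := by
  have hσ : JointlyMeasurable σ :=
    jointlyMeasurable_of_rightContinuous (fun t => had.measurable) fun ω t => (hcad ω t).1
  have hε3 : ε / 3 ≠ 0 := (ENNReal.div_pos hε (by norm_num)).ne'
  -- Chosen so that A δ⁴ ≤ (ε / 3)⁴, because A ≤ A + 1 ≤ (A + 1)⁴.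
  set δ : ℝ≥0∞ := ε / 3 / (A + 1) with hδ
  have hA1 : A + 1 ≠ ∞ := ENNReal.add_ne_top.2 ⟨hAtop, by norm_num⟩
  have hδ0 : δ ≠ 0 := (ENNReal.div_pos hε3 hA1).ne'
  obtain ⟨φ, hφs, hφd, hφc, hφm⟩ := hf2.exists_hasCompactSupport_eLpNorm_sub_le (by norm_num) hδ0
  have hφ : Measurable φ := hφc.measurable
  -- replacing `f` by `φ`
  have h_truncate : mixedNorm P 4 (fun s ω => φ s * σ s ω - f s * σ s ω) ≤ ε / 3 := by
    rw [mixedNorm_sub_comm]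
    have h := mixedNorm_four_mul_pow_le (hf.sub hφ) hσ hA
    have h' : mixedNorm P 4 (fun s ω => (f - φ) s * σ s ω) ^ 4 ≤ (ε / 3) ^ 4 := by
      refine h.trans ?_
      calc A * eLpNorm (f - φ) 2 volume ^ 4 ≤ (A + 1) ^ 4 * δ ^ 4 := by
            gcongr
            calc A ≤ A + 1 := le_self_add
              _ ≤ (A + 1) ^ 4 := le_self_pow₀ le_add_self (by norm_num)
        _ = (ε / 3) ^ 4 := by
            rw [← mul_pow, hδ, ENNReal.mul_div_cancel (by simp) hA1]
    have h'' := (ENNReal.pow_right_strictMono four_ne_zero).le_iff_le.1 h'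
    simpa [sub_mul] using h''
  obtain ⟨B, hB⟩ := hφs.exists_bound_of_continuous hφc
  simp only [Real.norm_eq_abs] at hB
  have hB0 : 0 ≤ B := (abs_nonneg _).trans (hB 0)
  obtain ⟨R₀, hR₀⟩ := hφs.isCompact.isBounded.subset_closedBall 0
  obtain ⟨R, hR⟩ := exists_nat_gt R₀
  have hφR : ∀ s, s ∉ Set.Ioc (-R : ℝ) R → φ s = 0 := by
    intro s hs
    by_contra hne
    have := hR₀ (subset_tsupport φ hne)
    rw [Real.closedBall_eq_Icc] at this
    exact hs ⟨by linarith [this.1], by linarith [this.2]⟩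
  -- truncation of `σ`
  have hjM : ∀ M : ℕ, JointlyMeasurable (fun s ω => φ s * min (σ s ω) M) := fun M =>
    (hφ.comp measurable_snd).mul (Measurable.min hσ measurable_const)
  have hjσ : JointlyMeasurable (fun s ω => φ s * σ s ω) := (hφ.comp measurable_snd).mul hσ
  -- Elementary coefficients have to be bounded. As σ is positive, the truncation error is dominated
  -- by |φ| σ, which is in L⁴ over the compact window.
  have h_clip : Tendsto (fun M : ℕ => mixedNorm P 4
      (fun s ω => φ s * min (σ s ω) M - φ s * σ s ω)) atTop (𝓝 0) := by
    refine tendsto_mixedNorm_four_zero (R := R) (G := fun s ω => |φ s| * σ s ω)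
      (fun M => (hjM M).sub hjσ) ?_ ?_ ?_ ?_
    · intro M s ω hs
      simp [hφR s fun h => hs (Set.Ioc_subset_Icc_self h)]
    · intro M s ω
      rw [← mul_sub, abs_mul]
      refine mul_le_mul_of_nonneg_left ?_ (abs_nonneg _)
      rw [abs_le]
      have h1 : 0 ≤ min (σ s ω) M := le_min (hpos s ω).le (Nat.cast_nonneg M)
      have h2 : min (σ s ω) M ≤ σ s ω := min_le_left _ _
      constructor <;> linarith [hpos s ω]
    · have hm : Measurable (fun q : Ω × ℝ => ENNReal.ofReal ((|φ q.2| * σ q.2 q.1) ^ 4)) :=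
        (((hφ.comp measurable_snd).abs.mul hσ).pow_const 4).ennreal_ofReal
      rw [lintegral_prod_symm _ hm.aemeasurable]
      refine ne_top_of_le_ne_top (b := ∫⁻ s in Set.Icc (-R : ℝ) R, ENNReal.ofReal (B ^ 4) * A) ?_
        (lintegral_mono fun s => ?_)
      · rw [setLIntegral_const]
        exact ENNReal.mul_ne_top (ENNReal.mul_ne_top ENNReal.ofReal_ne_top hAtop)
          measure_Icc_lt_top.ne
      · calc ∫⁻ ω, ENNReal.ofReal ((|φ s| * σ s ω) ^ 4) ∂P
            ≤ ∫⁻ ω, ENNReal.ofReal (B ^ 4) * ENNReal.ofReal (σ s ω ^ 4) ∂P := by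
              refine lintegral_mono fun ω => ?_
              rw [← ENNReal.ofReal_mul (by positivity), mul_pow]
              have := hB s
              have := hpos s ω
              gcongr
          _ ≤ ENNReal.ofReal (B ^ 4) * A := by
              rw [lintegral_const_mul' _ _ ENNReal.ofReal_ne_top]
              gcongr
              exact hA s
    · intro ω
      refine ae_of_all _ fun s => tendsto_const_nhds.congr' ?_
      obtain ⟨M₀, hM₀⟩ := exists_nat_gt (σ s ω)
      filter_upwards [eventually_ge_atTop M₀] with M hM
      rw [min_eq_left (hM₀.le.trans (by exact_mod_cast hM)), sub_self]
  obtain ⟨M, hM⟩ := (h_clip.eventually_le_const (pos_iff_ne_zero.2 hε3)).exists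
  -- discretization
  have hadM : ∀ s, Measurable[F s] (fun ω => φ s * min (σ s ω) M) := fun s =>
    ((had s).min measurable_const).const_mul (φ s)
  have hbd : ∀ s ω, |φ s * min (σ s ω) M| ≤ B * M := by
    intro s ω
    rw [abs_mul]
    have h1 : 0 ≤ min (σ s ω) M := le_min (hpos s ω).le (Nat.cast_nonneg M)
    rw [abs_of_nonneg h1]
    exact mul_le_mul (hB s) (min_le_right _ _) h1 hB0
  -- A càdlàg path has countably many jumps, so it is left-continuous at almost every time, and φ is
  -- continuous.
  have h_grid := tendsto_gridProcess (P := P) hadM (hjM M) hbd (R := R)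
    (fun s ω hs => by simp [hφR s hs]) (fun ω => (hcad ω).ae_tendsto_left.mono fun s hs =>
      ((hφc.tendsto s).mono_left nhdsWithin_le_nhds).mul (hs.min tendsto_const_nhds))
  obtain ⟨n, hn⟩ := (h_grid.eventually_le_const (pos_iff_ne_zero.2 hε3)).exists
  refine ⟨gridProcess _ hadM hbd R n, fun k => ?_, ?_⟩
  · exact ((measurable_pathSigma σ _).min measurable_const).const_mul _
  · have hjf : JointlyMeasurable (fun s ω => f s * σ s ω) := (hf.comp measurable_snd).mul hσ
    have hjS : JointlyMeasurable (gridProcess _ hadM hbd R n).toFun :=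
      ElementaryProcess.measurable_toFun _
    calc _ ≤ mixedNorm P 4 (fun s ω => (gridProcess _ hadM hbd R n).toFun s ω -
              φ s * min (σ s ω) M) +
            mixedNorm P 4 (fun s ω => φ s * min (σ s ω) M - f s * σ s ω) :=
          mixedNorm_sub_le_add (by norm_num) hjS (hjM M) hjf
      _ ≤ ε / 3 + (ε / 3 + ε / 3) := by
          gcongr
          exact (mixedNorm_sub_le_add (by norm_num) (hjM M) hjσ hjf).trans (add_le_add hM h_truncate)
      _ = ε := by rw [← add_assoc, ENNReal.add_thirds]

end Approximation

/-! ### Isometry and fourth moment for Itô integrals of f σ -/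

/-- Fatou's lemma for norms: a bound on the `L⁴` norms passes to a limit in `L²`. -/
lemma eLpNorm_four_le_of_tendsto {α : Type*} {mα : MeasurableSpace α} {μ : Measure α}
    {Z : ℕ → α → ℝ} {X : α → ℝ} (hZ : ∀ m, AEStronglyMeasurable (Z m) μ)
    (hX : AEStronglyMeasurable X μ)
    (hlim : Tendsto (fun m => eLpNorm (Z m - X) 2 μ) atTop (𝓝 0)) {B : ℕ → ℝ≥0∞} {b : ℝ≥0∞}
    (hB : ∀ m, eLpNorm (Z m) 4 μ ≤ B m) (hb : Tendsto B atTop (𝓝 b)) : eLpNorm X 4 μ ≤ b := by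
  obtain ⟨ns, hns, hae⟩ :=
    (tendstoInMeasure_of_tendsto_eLpNorm (by norm_num) hZ hX hlim).exists_seq_tendsto_ae
  -- Convergence in L² gives almost sure convergence along a subsequence, which suffices because the
  -- bounds `B` converge along the whole sequence.
  refine (Lp.eLpNorm_lim_le_liminf_eLpNorm (fun m => hZ (ns m)) X hae).trans ?_
  calc liminf (fun m => eLpNorm (Z (ns m)) 4 μ) atTop
      ≤ liminf (fun m => B (ns m)) atTop :=
        liminf_le_liminf (Eventually.of_forall fun m => hB (ns m))
    _ = b := (hb.comp hns.tendsto_atTop).liminf_eq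

section ItoIntegral

variable {Ω : Type*} {mΩ : MeasurableSpace Ω} {F : Filtration ℝ mΩ} {P : Measure Ω}
  {σ W : ℝ → Ω → ℝ}

/-- `X` is the limit in `L²` of elementary integrals of elementary processes which converge to
`f σ` in `L⁴(Ω; L²(ℝ))` and whose coefficients are functions of `σ`. -/
structure IsVolatilityIntegral (F : Filtration ℝ mΩ) (P : Measure Ω) (σ W : ℝ → Ω → ℝ)
    (f : ℝ → ℝ) (X : Ω → ℝ) : Prop where
  measurable_kernel : Measurable f
  memLp_kernel : MemLp f 2 volume
  memLp_two : MemLp X 2 P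
  approx : ∃ S : ℕ → ElementaryProcess F,
    (∀ m k, Measurable[pathSigma σ] ((S m).coef k)) ∧
    Tendsto (fun m => mixedNorm P 4 (fun s ω => (S m).toFun s ω - f s * σ s ω)) atTop (𝓝 0) ∧
    Tendsto (fun m => eLpNorm ((S m).integral W - X) 2 P) atTop (𝓝 0)

lemma ElementaryProcess.eLpNorm_two_integral_sub [IsProbabilityMeasure P]
    (hW : IsTwoSidedBrownianMotion F P W) (S T : ElementaryProcess F) :
    eLpNorm (S.integral W - T.integral W) 2 P =
      mixedNorm P 2 (fun s ω => S.toFun s ω - T.toFun s ω) := by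
  have h := (S.addSMul (-1) T).eLpNorm_two_integral hW
  have e1 : (S.addSMul (-1) T).integral W = S.integral W - T.integral W := by
    ext ω; rw [ElementaryProcess.addSMul_integral, Pi.sub_apply]; ring
  have e2 : (S.addSMul (-1) T).toFun = fun s ω => S.toFun s ω - T.toFun s ω := by
    ext s ω; rw [ElementaryProcess.addSMul_toFun]; ring
  rwa [e1, e2] at h

lemma ElementaryProcess.measurable_coef_addSMul {m : MeasurableSpace Ω}
    {S T : ElementaryProcess F} (hS : ∀ k, Measurable[m] (S.coef k))
    (hT : ∀ k, Measurable[m] (T.coef k)) (c : ℝ) (k : (S.addSMul c T).ι) :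
    Measurable[m] ((S.addSMul c T).coef k) := by
  rcases k with k | k
  exacts [hS k, (hT k).const_mul c]

lemma ElementaryProcess.indepFun_coef {S : ElementaryProcess F}
    (hS : ∀ k, Measurable[pathSigma σ] (S.coef k))
    (hind : IndepFun (fun ω t => σ t ω) (fun ω t => W t ω) P) :
    IndepFun (fun ω k => S.coef k ω) (fun ω t => W t ω) P := by
  rw [IndepFun_iff_Indep] at hind ⊢
  refine indep_of_indep_of_le_left hind ?_
  exact (@measurable_pi_lambda _ _ _ (pathSigma σ) _ _ hS).comap_le

lemma ElementaryProcess.eLpNorm_four_integral_sub [IsProbabilityMeasure P]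
    (hW : IsTwoSidedBrownianMotion F P W)
    (hind : IndepFun (fun ω t => σ t ω) (fun ω t => W t ω) P) {S T : ElementaryProcess F}
    (hS : ∀ k, Measurable[pathSigma σ] (S.coef k))
    (hT : ∀ k, Measurable[pathSigma σ] (T.coef k)) :
    eLpNorm (S.integral W - T.integral W) 4 P =
      3 ^ (1 / 4 : ℝ) * mixedNorm P 4 (fun s ω => S.toFun s ω - T.toFun s ω) := by
  have h := (S.addSMul (-1) T).eLpNorm_four_integral hW
    (ElementaryProcess.indepFun_coef (ElementaryProcess.measurable_coef_addSMul hS hT (-1)) hind)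
  have e1 : (S.addSMul (-1) T).integral W = S.integral W - T.integral W := by
    ext ω; rw [ElementaryProcess.addSMul_integral, Pi.sub_apply]; ring
  have e2 : (S.addSMul (-1) T).toFun = fun s ω => S.toFun s ω - T.toFun s ω := by
    ext s ω; rw [ElementaryProcess.addSMul_toFun]; ring
  rwa [e1, e2] at h

/-- An Itô integral of `f σ` can be computed from coefficients which are functions of `σ`. -/
lemma IsItoIntegral.isVolatilityIntegral [IsProbabilityMeasure P]
    (hW : IsTwoSidedBrownianMotion F P W)
    (hpos : ∀ t ω, 0 < σ t ω) (hcad : ∀ ω, IsCadlagPath (fun t => σ t ω)) (had : Adapted F σ)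
    {A : ℝ≥0∞} (hAtop : A ≠ ∞) (hA : ∀ s, ∫⁻ ω, ENNReal.ofReal (σ s ω ^ 4) ∂P ≤ A)
    {f : ℝ → ℝ} (hf : Measurable f) (hf2 : MemLp f 2 volume) {X : Ω → ℝ}
    (hX : IsItoIntegral F P W (fun s ω => f s * σ s ω) X) :
    IsVolatilityIntegral F P σ W f X := by
  obtain ⟨hX2, S, hS1, hS2⟩ := hX
  refine ⟨hf, hf2, hX2, ?_⟩
  have hσ : JointlyMeasurable σ :=
    jointlyMeasurable_of_rightContinuous (fun t => had.measurable) fun ω t => (hcad ω t).1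
  have hjf : JointlyMeasurable (fun s ω => f s * σ s ω) := (hf.comp measurable_snd).mul hσ
  have hε : ∀ m : ℕ, ((m : ℝ≥0∞) + 1)⁻¹ ≠ 0 := fun m =>
    ENNReal.inv_ne_zero.2 (ENNReal.add_ne_top.2 ⟨ENNReal.natCast_ne_top m, by norm_num⟩)
  choose T hT1 hT2 using fun m => exists_elementaryProcess_mixedNorm_le hpos hcad had hAtop hA
    hf hf2 (hε m)
  have hlim : Tendsto (fun m : ℕ => ((m : ℝ≥0∞) + 1)⁻¹) atTop (𝓝 0) := by
    have := (tendsto_add_atTop_iff_nat 1).2 ENNReal.tendsto_inv_nat_nhds_zero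
    simpa using this
  have hT3 : Tendsto (fun m => mixedNorm P 4 (fun s ω => (T m).toFun s ω - f s * σ s ω))
      atTop (𝓝 0) :=
    tendsto_of_tendsto_of_tendsto_of_le_of_le tendsto_const_nhds hlim (fun _ => zero_le) hT2
  refine ⟨T, hT1, hT3, ?_⟩
  have hS3 : Tendsto (fun m => mixedNorm P 2
      (fun s ω => f s * σ s ω - (ElementaryProcess.ofSimple (S m)).toFun s ω)) atTop (𝓝 0) := by
    have h4 := (ENNReal.continuous_rpow_const (y := (1 / 2 : ℝ))).tendsto 0 |>.comp hS1
    refine (h4.congr fun m => ?_).trans (by simp)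
    rw [mixedNorm_sub_comm, ElementaryProcess.ofSimple_toFun, Function.comp_apply,
      ← mixedNorm_two_sq, ← ENNReal.rpow_natCast, ← ENNReal.rpow_mul]
    norm_num
  have hWm := hW.measurable
  -- The isometry compares the integrals of `T m` and of the given simple process: both integrands
  -- approximate f σ in L²(Ω × ℝ), and the L⁴ error of `T m` dominates its L² error on a probability
  -- space.
  have hbound : ∀ m, eLpNorm ((T m).integral W - X) 2 P ≤
      (mixedNorm P 4 (fun s ω => (T m).toFun s ω - f s * σ s ω) + mixedNorm P 2
        (fun s ω => f s * σ s ω - (ElementaryProcess.ofSimple (S m)).toFun s ω)) +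
      eLpNorm (fun ω => (S m).integral W ω - X ω) 2 P := by
    intro m
    have hm1 := ((T m).measurable_integral hWm).aestronglyMeasurable (μ := P)
    have hm2 := ((ElementaryProcess.ofSimple (S m)).measurable_integral
      hWm).aestronglyMeasurable (μ := P)
    have h1 := eLpNorm_add_le (p := 2) (hm1.sub hm2) (hm2.sub hX2.1) (by norm_num)
    rw [sub_add_sub_cancel, ElementaryProcess.eLpNorm_two_integral_sub hW] at h1
    rw [ElementaryProcess.ofSimple_integral] at h1
    refine h1.trans (add_le_add ?_ le_rfl)
    refine (mixedNorm_sub_le_add (by norm_num) (T m).measurable_toFun hjf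
      (ElementaryProcess.ofSimple (S m)).measurable_toFun).trans (add_le_add ?_ le_rfl)
    exact mixedNorm_two_le_four (JointlyMeasurable.sub (T m).measurable_toFun hjf)
  refine tendsto_of_tendsto_of_tendsto_of_le_of_le tendsto_const_nhds ?_ (fun _ => zero_le) hbound
  simpa using (hT3.add hS3).add hS2

namespace IsVolatilityIntegral

variable {f f' : ℝ → ℝ} {X X' : Ω → ℝ}

/-- Sums and differences are all that polarization needs; for c = ±1 the factor has norm one and
drops out of every estimate. -/
lemma add_mul [IsProbabilityMeasure P] (hσ : JointlyMeasurable σ)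
    (hWm : ∀ t, Measurable (W t)) (h : IsVolatilityIntegral F P σ W f X)
    (h' : IsVolatilityIntegral F P σ W f' X') {c : ℝ} (hc : c = 1 ∨ c = -1) :
    IsVolatilityIntegral F P σ W (fun s => f s + c * f' s) (fun ω => X ω + c * X' ω) := by
  obtain ⟨hf, hf2, hX, S, hS1, hS2, hS3⟩ := h
  obtain ⟨hf', hf2', hX', T, hT1, hT2, hT3⟩ := h'
  refine ⟨hf.add (hf'.const_mul c), hf2.add (hf2'.const_mul c), hX.add (hX'.const_mul c),
    fun m => (S m).addSMul c (T m),
    fun m => ElementaryProcess.measurable_coef_addSMul (hS1 m) (hT1 m) c, ?_, ?_⟩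
  · have hj : JointlyMeasurable (fun s ω => f s * σ s ω) := (hf.comp measurable_snd).mul hσ
    have hj' : JointlyMeasurable (fun s ω => f' s * σ s ω) := (hf'.comp measurable_snd).mul hσ
    refine tendsto_of_tendsto_of_tendsto_of_le_of_le tendsto_const_nhds
      (by simpa using hS2.add hT2) (fun _ => zero_le) fun m => ?_
    have j1 := JointlyMeasurable.sub (S m).measurable_toFun hj
    have j2 := JointlyMeasurable.sub (T m).measurable_toFun hj'
    have j3 : JointlyMeasurable (fun s ω => c * ((T m).toFun s ω - f' s * σ s ω)) :=
      Measurable.const_mul j2 c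
    have e : mixedNorm P 4 (fun s ω => c * ((T m).toFun s ω - f' s * σ s ω)) =
        mixedNorm P 4 (fun s ω => (T m).toFun s ω - f' s * σ s ω) := by
      rcases hc with rfl | rfl
      · simp only [one_mul]
      · simp only [neg_mul, one_mul]; exact mixedNorm_neg _ _
    have := mixedNorm_add_le (P := P) (p := 4) (by norm_num) j1 j3
    rw [e] at this
    refine le_trans (le_of_eq ?_) this
    congr 1
    ext s ω
    rw [ElementaryProcess.addSMul_toFun]; ring
  · refine tendsto_of_tendsto_of_tendsto_of_le_of_le tendsto_const_nhds
      (by simpa using hS3.add hT3) (fun _ => zero_le) fun m => ?_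
    have m1 := ((S m).measurable_integral hWm).aestronglyMeasurable (μ := P) |>.sub hX.1
    have m2 := ((T m).measurable_integral hWm).aestronglyMeasurable (μ := P) |>.sub hX'.1
    have := eLpNorm_add_le (p := 2) m1 (m2.const_smul c) (by norm_num)
    rw [eLpNorm_const_smul] at this
    have hc' : ‖c‖ₑ = 1 := by rcases hc with rfl | rfl <;> simp
    rw [hc', one_mul] at this
    refine le_trans (le_of_eq ?_) this
    congr 1
    ext ω
    simp only [Pi.sub_apply, Pi.add_apply, Pi.smul_apply, smul_eq_mul,
      ElementaryProcess.addSMul_integral]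
    ring

lemma add [IsProbabilityMeasure P] (hσ : JointlyMeasurable σ)
    (hWm : ∀ t, Measurable (W t)) (h : IsVolatilityIntegral F P σ W f X)
    (h' : IsVolatilityIntegral F P σ W f' X') :
    IsVolatilityIntegral F P σ W (fun s => f s + f' s) (fun ω => X ω + X' ω) := by
  simpa using h.add_mul hσ hWm h' (Or.inl rfl)

lemma sub [IsProbabilityMeasure P] (hσ : JointlyMeasurable σ)
    (hWm : ∀ t, Measurable (W t)) (h : IsVolatilityIntegral F P σ W f X)
    (h' : IsVolatilityIntegral F P σ W f' X') :
    IsVolatilityIntegral F P σ W (fun s => f s - f' s) (fun ω => X ω - X' ω) := by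
  simpa [sub_eq_add_neg] using h.add_mul hσ hWm h' (Or.inr rfl)

/-- The Itô isometry. -/
lemma eLpNorm_two [IsProbabilityMeasure P] (hσ : JointlyMeasurable σ)
    (hW : IsTwoSidedBrownianMotion F P W) (h : IsVolatilityIntegral F P σ W f X) :
    eLpNorm X 2 P = mixedNorm P 2 (fun s ω => f s * σ s ω) := by
  obtain ⟨hf, hf2, hX, S, hS1, hS2, hS3⟩ := h
  have hj : JointlyMeasurable (fun s ω => f s * σ s ω) := (hf.comp measurable_snd).mul hσ
  have hS2' : ∀ m, mixedNorm P 2 (fun s ω => (S m).toFun s ω - f s * σ s ω) ≤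
      mixedNorm P 4 (fun s ω => (S m).toFun s ω - f s * σ s ω) := fun m =>
    mixedNorm_two_le_four (JointlyMeasurable.sub (S m).measurable_toFun hj)
  have m1 : ∀ m, AEStronglyMeasurable ((S m).integral W) P := fun m =>
    ((S m).measurable_integral hW.measurable).aestronglyMeasurable
  apply le_antisymm
  · have hl := (tendsto_const_nhds (f := atTop) (x := mixedNorm P 2 (fun s ω => f s * σ s ω))).add
      (hS2.add hS3)
    simp only [add_zero] at hl
    refine ge_of_tendsto' hl fun m => ?_
    have h1 := eLpNorm_sub_le (p := 2) (m1 m) ((m1 m).sub hX.1) (by norm_num)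
    rw [sub_sub_cancel, (S m).eLpNorm_two_integral hW] at h1
    have h2 := mixedNorm_add_le (P := P) (p := 2) (by norm_num) hj
      (JointlyMeasurable.sub (S m).measurable_toFun hj)
    simp only [add_sub_cancel] at h2
    rw [← add_assoc]
    exact h1.trans (add_le_add (h2.trans (add_le_add le_rfl (hS2' m))) le_rfl)
  · have hl := (tendsto_const_nhds (f := atTop) (x := eLpNorm X 2 P)).add
      (hS3.add hS2)
    simp only [add_zero] at hl
    refine ge_of_tendsto' hl fun m => ?_
    have h1 := eLpNorm_add_le (p := 2) hX.1 ((m1 m).sub hX.1) (by norm_num)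
    rw [add_sub_cancel, (S m).eLpNorm_two_integral hW] at h1
    have h2 := mixedNorm_sub_le_add (P := P) (p := 2) (K := fun _ _ => 0) (by norm_num) hj
      (S m).measurable_toFun measurable_const
    simp only [sub_zero] at h2
    rw [mixedNorm_sub_comm] at h2
    rw [← add_assoc, add_comm]
    exact h2.trans (add_le_add (hS2' m) h1)

/-- The approximants are known to converge to X only in L². Fatou, applied to their differences with
a fixed elementary integral, yields control in L⁴. -/
lemma eLpNorm_four_sub_le [IsProbabilityMeasure P] (hσ : JointlyMeasurable σ)
    (hW : IsTwoSidedBrownianMotion F P W)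
    (hind : IndepFun (fun ω t => σ t ω) (fun ω t => W t ω) P)
    (h : IsVolatilityIntegral F P σ W f X) {T : ElementaryProcess F}
    (hT : ∀ k, Measurable[pathSigma σ] (T.coef k)) :
    eLpNorm (X - T.integral W) 4 P ≤
      3 ^ (1 / 4 : ℝ) * mixedNorm P 4 (fun s ω => f s * σ s ω - T.toFun s ω) := by
  obtain ⟨hf, hf2, hX, S, hS1, hS2, hS3⟩ := h
  have hj : JointlyMeasurable (fun s ω => f s * σ s ω) := (hf.comp measurable_snd).mul hσ
  have m1 : ∀ T : ElementaryProcess F, AEStronglyMeasurable (T.integral W) P := fun T =>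
    (T.measurable_integral hW.measurable).aestronglyMeasurable
  refine eLpNorm_four_le_of_tendsto (Z := fun m => (S m).integral W - T.integral W)
    (fun m => (m1 _).sub (m1 _)) (hX.1.sub (m1 _)) (by simpa using hS3)
    (fun m => ((ElementaryProcess.eLpNorm_four_integral_sub hW hind (hS1 m) hT).le.trans
      (mul_le_mul_right (mixedNorm_sub_le_add (by norm_num) (S m).measurable_toFun hj
        T.measurable_toFun) _))) ?_
  refine ENNReal.Tendsto.const_mul ?_ (Or.inr (by simp))
  simpa using hS2.add (tendsto_const_nhds
    (x := mixedNorm P 4 (fun s ω => f s * σ s ω - T.toFun s ω)))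

/-- By `eLpNorm_four_sub_le` the elementary integrals converge to X in L⁴ as well, so the identity
for them passes to the limit; each inequality is a triangle inequality on both sides with vanishing
errors. -/
lemma eLpNorm_four [IsProbabilityMeasure P] (hσ : JointlyMeasurable σ)
    (hW : IsTwoSidedBrownianMotion F P W)
    (hind : IndepFun (fun ω t => σ t ω) (fun ω t => W t ω) P)
    (h : IsVolatilityIntegral F P σ W f X) :
    eLpNorm X 4 P = 3 ^ (1 / 4 : ℝ) * mixedNorm P 4 (fun s ω => f s * σ s ω) := by
  obtain ⟨S, hS1, hS2, -⟩ := h.approx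
  have hj : JointlyMeasurable (fun s ω => f s * σ s ω) :=
    (h.measurable_kernel.comp measurable_snd).mul hσ
  have m1 : ∀ m, AEStronglyMeasurable ((S m).integral W) P := fun m =>
    ((S m).measurable_integral hW.measurable).aestronglyMeasurable
  have hX := h.memLp_two.1
  set C : ℝ≥0∞ := 3 ^ (1 / 4 : ℝ) with hC
  have hCtop : C ≠ ∞ := by simp [hC]
  have hd : ∀ m, eLpNorm (X - (S m).integral W) 4 P ≤
      C * mixedNorm P 4 (fun s ω => (S m).toFun s ω - f s * σ s ω) := fun m => by
    rw [mixedNorm_sub_comm]; exact h.eLpNorm_four_sub_le hσ hW hind (hS1 m)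
  have hn : ∀ m, eLpNorm ((S m).integral W) 4 P = C * mixedNorm P 4 (S m).toFun := fun m =>
    (S m).eLpNorm_four_integral hW (ElementaryProcess.indepFun_coef (hS1 m) hind)
  have hlim : Tendsto (fun m => C *
      mixedNorm P 4 (fun s ω => (S m).toFun s ω - f s * σ s ω)) atTop (𝓝 0) := by
    simpa using ENNReal.Tendsto.const_mul hS2 (Or.inr hCtop)
  apply le_antisymm
  · have hl := (tendsto_const_nhds (f := atTop) (x := C * mixedNorm P 4 (fun s ω => f s * σ s ω))).add
      (hlim.add hlim)
    simp only [add_zero] at hl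
    refine ge_of_tendsto' hl fun m => ?_
    have h1 := eLpNorm_add_le (p := 4) (m1 m) (hX.sub (m1 m)) (by norm_num)
    rw [add_sub_cancel, hn] at h1
    have h2 := mixedNorm_add_le (P := P) (p := 4) (by norm_num) hj
      (JointlyMeasurable.sub (S m).measurable_toFun hj)
    simp only [add_sub_cancel] at h2
    rw [← add_assoc, ← mul_add]
    exact h1.trans (add_le_add (mul_le_mul_right h2 C) (hd m))
  · have hl := (tendsto_const_nhds (f := atTop) (x := eLpNorm X 4 P)).add
      (hlim.add hlim)
    simp only [add_zero] at hl
    refine ge_of_tendsto' hl fun m => ?_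
    have h1 := eLpNorm_sub_le (p := 4) hX (hX.sub (m1 m)) (by norm_num)
    rw [sub_sub_cancel, hn] at h1
    have h2 := mixedNorm_sub_le_add (P := P) (p := 4) (K := fun _ _ => 0) (by norm_num) hj
      (S m).measurable_toFun measurable_const
    simp only [sub_zero] at h2
    rw [mixedNorm_sub_comm] at h2
    refine (mul_le_mul_right h2 C).trans ?_
    rw [mul_add, ← add_assoc, add_comm]
    exact add_le_add (h1.trans (add_le_add le_rfl (hd m))) le_rfl

lemma lintegral_sq [IsProbabilityMeasure P] (hσ : JointlyMeasurable σ)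
    (hW : IsTwoSidedBrownianMotion F P W) (h : IsVolatilityIntegral F P σ W f X) :
    ∫⁻ ω, ENNReal.ofReal (X ω ^ 2) ∂P =
      ∫⁻ ω, (∫⁻ s, ENNReal.ofReal ((f s * σ s ω) ^ 2)) ∂P := by
  rw [← eLpNorm_two_sq, h.eLpNorm_two hσ hW, mixedNorm_two_sq]

/-- The fourth moment of a stochastic integral whose integrand is independent of `W`. -/
lemma lintegral_pow_four [IsProbabilityMeasure P] (hσ : JointlyMeasurable σ)
    (hW : IsTwoSidedBrownianMotion F P W)
    (hind : IndepFun (fun ω t => σ t ω) (fun ω t => W t ω) P)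
    (h : IsVolatilityIntegral F P σ W f X) :
    ∫⁻ ω, ENNReal.ofReal (X ω ^ 4) ∂P =
      3 * ∫⁻ ω, (∫⁻ s, ENNReal.ofReal ((f s * σ s ω) ^ 2)) ^ 2 ∂P := by
  rw [← eLpNorm_four_pow, h.eLpNorm_four hσ hW hind, ← mixedNorm_four_pow, mul_pow,
    ← ENNReal.rpow_natCast (3 ^ _), ← ENNReal.rpow_mul]
  norm_num

end IsVolatilityIntegral

end ItoIntegral

/-! ### Moments of stochastic integrals in terms of energies -/

section Moments

variable {Ω : Type*} {mΩ : MeasurableSpace Ω} {F : Filtration ℝ mΩ} {P : Measure Ω}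
  {σ W : ℝ → Ω → ℝ} {f f' : ℝ → ℝ} {X X' : Ω → ℝ}

/-- The integral of `f f' σ²` over time. -/
noncomputable def weightedEnergy (σ : ℝ → Ω → ℝ) (f f' : ℝ → ℝ) (ω : Ω) : ℝ :=
  ∫ s, f s * f' s * σ s ω ^ 2

lemma measurable_weightedEnergy (hσ : JointlyMeasurable σ) (hf : Measurable f)
    (hf' : Measurable f') : Measurable (weightedEnergy σ f f') := by
  have hm : Measurable (fun q : Ω × ℝ => f q.2 * f' q.2 * σ q.2 q.1 ^ 2) :=
    ((hf.comp measurable_snd).mul (hf'.comp measurable_snd)).mul (Measurable.pow_const hσ 2)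
  exact hm.stronglyMeasurable.integral_prod_right.measurable

lemma mixedNorm_four_mul_ne_top [SFinite P] (hσ : JointlyMeasurable σ)
    {A : ℝ≥0∞} (hAtop : A ≠ ∞) (hA : ∀ s, ∫⁻ ω, ENNReal.ofReal (σ s ω ^ 4) ∂P ≤ A)
    (hf : Measurable f) (hf2 : MemLp f 2 volume) :
    mixedNorm P 4 (fun s ω => f s * σ s ω) ^ 4 ≠ ∞ :=
  ne_top_of_le_ne_top (ENNReal.mul_ne_top hAtop (ENNReal.pow_ne_top hf2.2.ne))
    (mixedNorm_four_mul_pow_le hf hσ hA)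

lemma ae_memLp_mul [SFinite P] (hσ : JointlyMeasurable σ)
    {A : ℝ≥0∞} (hAtop : A ≠ ∞) (hA : ∀ s, ∫⁻ ω, ENNReal.ofReal (σ s ω ^ 4) ∂P ≤ A)
    (hf : Measurable f) (hf2 : MemLp f 2 volume) :
    ∀ᵐ ω ∂P, MemLp (fun s => f s * σ s ω) 2 volume := by
  have hj : JointlyMeasurable (fun s ω => f s * σ s ω) := (hf.comp measurable_snd).mul hσ
  have h := mixedNorm_four_mul_ne_top (P := P) hσ hAtop hA hf hf2
  rw [mixedNorm_four_pow] at h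
  simp_rw [← eLpNorm_two_sq] at h
  have := ae_lt_top ((hj.measurable_eLpNorm.pow_const 2).pow_const 2) h
  filter_upwards [this] with ω hω
  refine ⟨(hj.slice ω).aestronglyMeasurable, ?_⟩
  by_contra hc
  rw [not_lt, top_le_iff] at hc
  rw [hc] at hω
  simp at hω

lemma ofReal_weightedEnergy_self {ω : Ω} (h : MemLp (fun s => f s * σ s ω) 2 volume) :
    ENNReal.ofReal (weightedEnergy σ f f ω) = ∫⁻ s, ENNReal.ofReal ((f s * σ s ω) ^ 2) := by
  rw [← ofReal_integral_eq_lintegral_ofReal h.integrable_sq (ae_of_all _ fun _ => sq_nonneg _)]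
  unfold weightedEnergy
  congr 2
  ext s; ring

lemma weightedEnergy_self_nonneg (f : ℝ → ℝ) (ω : Ω) : 0 ≤ weightedEnergy σ f f ω :=
  integral_nonneg fun _ => mul_nonneg (mul_self_nonneg _) (sq_nonneg _)

lemma weightedEnergy_integrable {ω : Ω} (h : MemLp (fun s => f s * σ s ω) 2 volume)
    (h' : MemLp (fun s => f' s * σ s ω) 2 volume) :
    Integrable (fun s => f s * f' s * σ s ω ^ 2) := by
  have : Integrable (fun s => (f s * σ s ω) * (f' s * σ s ω)) := h.integrable_mul h'
  refine this.congr (ae_of_all _ fun s => ?_)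
  simp only; ring

lemma weightedEnergy_add {ω : Ω} (h : MemLp (fun s => f s * σ s ω) 2 volume)
    (h' : MemLp (fun s => f' s * σ s ω) 2 volume) :
    weightedEnergy σ (fun s => f s + f' s) (fun s => f s + f' s) ω =
      weightedEnergy σ f f ω + 2 * weightedEnergy σ f f' ω + weightedEnergy σ f' f' ω := by
  have h1 := weightedEnergy_integrable h h
  have h2 := weightedEnergy_integrable h h'
  have h3 := weightedEnergy_integrable h' h'
  unfold weightedEnergy
  rw [← integral_const_mul, ← integral_add h1 (h2.const_mul 2),
    ← integral_add (h1.fun_add (h2.const_mul 2)) h3]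
  congr 1; ext s; ring

lemma weightedEnergy_sub {ω : Ω} (h : MemLp (fun s => f s * σ s ω) 2 volume)
    (h' : MemLp (fun s => f' s * σ s ω) 2 volume) :
    weightedEnergy σ (fun s => f s - f' s) (fun s => f s - f' s) ω =
      weightedEnergy σ f f ω - 2 * weightedEnergy σ f f' ω + weightedEnergy σ f' f' ω := by
  have h1 := weightedEnergy_integrable h h
  have h2 := weightedEnergy_integrable h h'
  have h3 := weightedEnergy_integrable h' h'
  unfold weightedEnergy
  rw [← integral_const_mul, ← integral_sub h1 (h2.const_mul 2),
    ← integral_add (f := fun s => f s * f s * σ s ω ^ 2 - 2 * (f s * f' s * σ s ω ^ 2))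
      (h1.sub (h2.const_mul 2)) h3]
  congr 1; ext s; ring

lemma lintegral_weightedEnergy_sq [SFinite P] (hσ : JointlyMeasurable σ)
    {A : ℝ≥0∞} (hAtop : A ≠ ∞) (hA : ∀ s, ∫⁻ ω, ENNReal.ofReal (σ s ω ^ 4) ∂P ≤ A)
    (hf : Measurable f) (hf2 : MemLp f 2 volume) :
    ∫⁻ ω, ENNReal.ofReal (weightedEnergy σ f f ω ^ 2) ∂P =
      mixedNorm P 4 (fun s ω => f s * σ s ω) ^ 4 := by
  rw [mixedNorm_four_pow]
  refine lintegral_congr_ae ?_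
  filter_upwards [ae_memLp_mul hσ hAtop hA hf hf2] with ω hω
  rw [ENNReal.ofReal_pow (weightedEnergy_self_nonneg f ω), ofReal_weightedEnergy_self hω]

lemma memLp_weightedEnergy_self [SFinite P] (hσ : JointlyMeasurable σ)
    {A : ℝ≥0∞} (hAtop : A ≠ ∞) (hA : ∀ s, ∫⁻ ω, ENNReal.ofReal (σ s ω ^ 4) ∂P ≤ A)
    (hf : Measurable f) (hf2 : MemLp f 2 volume) : MemLp (weightedEnergy σ f f) 2 P := by
  refine ⟨(measurable_weightedEnergy hσ hf hf).aestronglyMeasurable, ?_⟩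
  have h := mixedNorm_four_mul_ne_top (P := P) hσ hAtop hA hf hf2
  rw [← lintegral_weightedEnergy_sq hσ hAtop hA hf hf2, ← eLpNorm_two_sq] at h
  exact lt_top_iff_ne_top.2 fun hc => h (by rw [hc]; simp)

/-- The energies of f + f' and f - f' are non-negative, so twice the absolute cross energy is at
most the sum of the two energies. -/
lemma memLp_weightedEnergy [SFinite P] (hσ : JointlyMeasurable σ)
    {A : ℝ≥0∞} (hAtop : A ≠ ∞) (hA : ∀ s, ∫⁻ ω, ENNReal.ofReal (σ s ω ^ 4) ∂P ≤ A)
    (hf : Measurable f) (hf2 : MemLp f 2 volume) (hf' : Measurable f')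
    (hf2' : MemLp f' 2 volume) : MemLp (weightedEnergy σ f f') 2 P := by
  refine MemLp.of_le (g := fun ω => weightedEnergy σ f f ω + weightedEnergy σ f' f' ω)
    ((memLp_weightedEnergy_self hσ hAtop hA hf hf2).add
      (memLp_weightedEnergy_self hσ hAtop hA hf' hf2'))
    (measurable_weightedEnergy hσ hf hf').aestronglyMeasurable ?_
  filter_upwards [ae_memLp_mul hσ hAtop hA hf hf2, ae_memLp_mul hσ hAtop hA hf' hf2'] with ω h h'
  have e1 := weightedEnergy_add h h'
  have e2 := weightedEnergy_sub h h'
  have n1 := weightedEnergy_self_nonneg (σ := σ) (fun s => f s + f' s) ω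
  have n2 := weightedEnergy_self_nonneg (σ := σ) (fun s => f s - f' s) ω
  have n3 := weightedEnergy_self_nonneg (σ := σ) f ω
  have n4 := weightedEnergy_self_nonneg (σ := σ) f' ω
  rw [Real.norm_eq_abs, Real.norm_of_nonneg (add_nonneg n3 n4), abs_le]
  constructor <;> linarith

namespace IsVolatilityIntegral

lemma memLp_four [IsProbabilityMeasure P] (hσ : JointlyMeasurable σ)
    (hW : IsTwoSidedBrownianMotion F P W)
    (hind : IndepFun (fun ω t => σ t ω) (fun ω t => W t ω) P)
    {A : ℝ≥0∞} (hAtop : A ≠ ∞) (hA : ∀ s, ∫⁻ ω, ENNReal.ofReal (σ s ω ^ 4) ∂P ≤ A)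
    (h : IsVolatilityIntegral F P σ W f X) : MemLp X 4 P := by
  refine ⟨h.memLp_two.1, ?_⟩
  have h4 := mixedNorm_four_mul_ne_top (P := P) hσ hAtop hA h.measurable_kernel h.memLp_kernel
  rw [h.eLpNorm_four hσ hW hind]
  refine ENNReal.mul_lt_top (ENNReal.rpow_lt_top_of_nonneg (by norm_num) (by norm_num)) (lt_top_iff_ne_top.2 fun hc => h4 ?_)
  rw [hc]; simp

lemma integrable_pow_four [IsProbabilityMeasure P] (hσ : JointlyMeasurable σ)
    (hW : IsTwoSidedBrownianMotion F P W)
    (hind : IndepFun (fun ω t => σ t ω) (fun ω t => W t ω) P)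
    {A : ℝ≥0∞} (hAtop : A ≠ ∞) (hA : ∀ s, ∫⁻ ω, ENNReal.ofReal (σ s ω ^ 4) ∂P ≤ A)
    (h : IsVolatilityIntegral F P σ W f X) : Integrable (fun ω => X ω ^ 4) P := by
  have := (h.memLp_four hσ hW hind hAtop hA).integrable_norm_pow (p := 4) (by norm_num)
  refine this.congr (ae_of_all _ fun ω => ?_)
  simp only [Real.norm_eq_abs]
  exact (show Even 4 by decide).pow_abs _

lemma integral_pow_four [IsProbabilityMeasure P] (hσ : JointlyMeasurable σ)
    (hW : IsTwoSidedBrownianMotion F P W)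
    (hind : IndepFun (fun ω t => σ t ω) (fun ω t => W t ω) P)
    {A : ℝ≥0∞} (hAtop : A ≠ ∞) (hA : ∀ s, ∫⁻ ω, ENNReal.ofReal (σ s ω ^ 4) ∂P ≤ A)
    (h : IsVolatilityIntegral F P σ W f X) :
    ∫ ω, X ω ^ 4 ∂P = 3 * ∫ ω, weightedEnergy σ f f ω ^ 2 ∂P := by
  have hX := h.memLp_two.1
  rw [integral_eq_lintegral_of_nonneg_ae (f := fun ω => X ω ^ 4)
    (ae_of_all _ fun ω => by positivity) (hX.pow 4),
    integral_eq_lintegral_of_nonneg_ae (ae_of_all _ fun ω => sq_nonneg _)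
      ((measurable_weightedEnergy hσ h.measurable_kernel h.measurable_kernel).pow_const
        2).aestronglyMeasurable,
    h.lintegral_pow_four hσ hW hind,
    lintegral_weightedEnergy_sq hσ hAtop hA h.measurable_kernel h.memLp_kernel,
    mixedNorm_four_pow, ENNReal.toReal_mul]
  norm_num

lemma integral_sq [IsProbabilityMeasure P] (hσ : JointlyMeasurable σ)
    (hW : IsTwoSidedBrownianMotion F P W)
    {A : ℝ≥0∞} (hAtop : A ≠ ∞) (hA : ∀ s, ∫⁻ ω, ENNReal.ofReal (σ s ω ^ 4) ∂P ≤ A)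
    (h : IsVolatilityIntegral F P σ W f X) :
    ∫ ω, X ω ^ 2 ∂P = ∫ ω, weightedEnergy σ f f ω ∂P := by
  have hX := h.memLp_two.1
  rw [integral_eq_lintegral_of_nonneg_ae (f := fun ω => X ω ^ 2)
    (ae_of_all _ fun ω => by positivity) (hX.pow 2),
    integral_eq_lintegral_of_nonneg_ae (ae_of_all _ fun ω => weightedEnergy_self_nonneg _ _)
      (measurable_weightedEnergy hσ h.measurable_kernel h.measurable_kernel).aestronglyMeasurable,
    h.lintegral_sq hσ hW]
  congr 1
  refine lintegral_congr_ae ?_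
  filter_upwards [ae_memLp_mul hσ hAtop hA h.measurable_kernel h.memLp_kernel] with ω hω
  rw [ofReal_weightedEnergy_self hω]

/-- The joint fourth moment of two stochastic integrals, by polarization. -/
lemma integral_sq_mul_sq [IsProbabilityMeasure P] (hσ : JointlyMeasurable σ)
    (hW : IsTwoSidedBrownianMotion F P W)
    (hind : IndepFun (fun ω t => σ t ω) (fun ω t => W t ω) P)
    {A : ℝ≥0∞} (hAtop : A ≠ ∞) (hA : ∀ s, ∫⁻ ω, ENNReal.ofReal (σ s ω ^ 4) ∂P ≤ A)
    (h : IsVolatilityIntegral F P σ W f X) (h' : IsVolatilityIntegral F P σ W f' X') :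
    ∫ ω, X ω ^ 2 * X' ω ^ 2 ∂P =
      ∫ ω, weightedEnergy σ f f ω * weightedEnergy σ f' f' ω ∂P +
        2 * ∫ ω, weightedEnergy σ f f' ω ^ 2 ∂P := by
  have ha := h.add hσ hW.measurable h'
  have hs := h.sub hσ hW.measurable h'
  have i1 := h.integrable_pow_four hσ hW hind hAtop hA
  have i2 := h'.integrable_pow_four hσ hW hind hAtop hA
  have i3 := ha.integrable_pow_four hσ hW hind hAtop hA
  have i4 := hs.integrable_pow_four hσ hW hind hAtop hA
  have q1 := memLp_weightedEnergy_self (P := P) hσ hAtop hA h.measurable_kernel h.memLp_kernel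
  have q2 := memLp_weightedEnergy_self (P := P) hσ hAtop hA h'.measurable_kernel h'.memLp_kernel
  have q3 := memLp_weightedEnergy (P := P) hσ hAtop hA h.measurable_kernel h.memLp_kernel
    h'.measurable_kernel h'.memLp_kernel
  have q4 := memLp_weightedEnergy_self (P := P) hσ hAtop hA ha.measurable_kernel ha.memLp_kernel
  have q5 := memLp_weightedEnergy_self (P := P) hσ hAtop hA hs.measurable_kernel hs.memLp_kernel
  -- This is 12 x² y² = (x + y)⁴ + (x - y)⁴ - 2 x⁴ - 2 y⁴.
  have e1 : ∫ ω, X ω ^ 2 * X' ω ^ 2 ∂P = (1 / 12) * (∫ ω, (X ω + X' ω) ^ 4 ∂P +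
      ∫ ω, (X ω - X' ω) ^ 4 ∂P - (2 * ∫ ω, X ω ^ 4 ∂P + 2 * ∫ ω, X' ω ^ 4 ∂P)) := by
    rw [← integral_const_mul 2, ← integral_const_mul 2,
      ← integral_add (i1.const_mul 2) (i2.const_mul 2), ← integral_add i3 i4,
      ← integral_sub (i3.fun_add i4) ((i1.const_mul 2).fun_add (i2.const_mul 2)), ← integral_const_mul]
    congr 1; ext ω; ring
  -- With energies a, c and cross energy b, the energies of the sum and difference are a ± 2b + c,
  -- and 4 (a c + 2 b²) = (a + 2b + c)² + (a - 2b + c)² - 2a² - 2c². The Gaussian factor 3 turns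
  -- 1/12 into 1/4.
  have e2 : ∫ ω, weightedEnergy σ f f ω * weightedEnergy σ f' f' ω ∂P +
      2 * ∫ ω, weightedEnergy σ f f' ω ^ 2 ∂P =
      (1 / 4) * (∫ ω, weightedEnergy σ (fun s => f s + f' s) (fun s => f s + f' s) ω ^ 2 ∂P +
        ∫ ω, weightedEnergy σ (fun s => f s - f' s) (fun s => f s - f' s) ω ^ 2 ∂P -
        (2 * ∫ ω, weightedEnergy σ f f ω ^ 2 ∂P + 2 * ∫ ω, weightedEnergy σ f' f' ω ^ 2 ∂P)) := by
    have j12 : Integrable (fun ω => weightedEnergy σ f f ω * weightedEnergy σ f' f' ω) P :=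
      q1.integrable_mul q2
    rw [← integral_const_mul 2, ← integral_const_mul 2, ← integral_const_mul 2,
      ← integral_add (q1.integrable_sq.const_mul 2) (q2.integrable_sq.const_mul 2),
      ← integral_add q4.integrable_sq q5.integrable_sq,
      ← integral_sub (q4.integrable_sq.fun_add q5.integrable_sq)
        ((q1.integrable_sq.const_mul 2).fun_add (q2.integrable_sq.const_mul 2)),
      ← integral_const_mul, ← integral_add j12 (q3.integrable_sq.const_mul 2)]
    refine integral_congr_ae ?_
    filter_upwards [ae_memLp_mul hσ hAtop hA h.measurable_kernel h.memLp_kernel,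
      ae_memLp_mul hσ hAtop hA h'.measurable_kernel h'.memLp_kernel] with ω hω hω'
    rw [weightedEnergy_add hω hω', weightedEnergy_sub hω hω']
    ring
  rw [e1, e2, ha.integral_pow_four hσ hW hind hAtop hA, hs.integral_pow_four hσ hW hind hAtop hA,
    h.integral_pow_four hσ hW hind hAtop hA, h'.integral_pow_four hσ hW hind hAtop hA]
  ring

end IsVolatilityIntegral

end Moments

/-! ### Covariance of the squares of two stochastic integrals -/

section CovarianceBound

variable {Ω : Type*} {mΩ : MeasurableSpace Ω} {F : Filtration ℝ mΩ} {P : Measure Ω}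
  {σ W : ℝ → Ω → ℝ} {f f' : ℝ → ℝ} {X X' : Ω → ℝ} {A : ℝ}

lemma memLp_sq_of_lintegral_pow_four_le (hσ : JointlyMeasurable σ)
    (hA : ∀ s, ∫⁻ ω, ENNReal.ofReal (σ s ω ^ 4) ∂P ≤ ENNReal.ofReal A) (s : ℝ) :
    MemLp (fun ω => σ s ω ^ 2) 2 P := by
  refine ⟨((hσ.measurable_at s).pow_const 2).aestronglyMeasurable, ?_⟩
  have h : eLpNorm (fun ω => σ s ω ^ 2) 2 P ^ 2 ≤ ENNReal.ofReal A := by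
    rw [eLpNorm_two_sq]
    simpa only [← pow_mul] using hA s
  refine lt_top_iff_ne_top.2 fun hc => ?_
  rw [hc] at h
  simp at h

lemma integral_sq_mul_sq_le (hσ : JointlyMeasurable σ) (hA0 : 0 ≤ A)
    (hA : ∀ s, ∫⁻ ω, ENNReal.ofReal (σ s ω ^ 4) ∂P ≤ ENNReal.ofReal A) (s r : ℝ) :
    ∫ ω, σ s ω ^ 2 * σ r ω ^ 2 ∂P ≤ A := by
  have hs := memLp_sq_of_lintegral_pow_four_le hσ hA s
  have hr := memLp_sq_of_lintegral_pow_four_le hσ hA r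
  have h4 : ∀ s, ∫ ω, (σ s ω ^ 2) ^ 2 ∂P ≤ A := by
    intro s
    rw [integral_eq_lintegral_of_nonneg_ae (ae_of_all _ fun ω => by positivity)
      (((hσ.measurable_at s).pow_const 2).pow_const 2).aestronglyMeasurable]
    refine ENNReal.toReal_le_of_le_ofReal hA0 ?_
    simpa only [← pow_mul] using hA s
  have hi : Integrable (fun ω => σ s ω ^ 2 * σ r ω ^ 2) P := hs.integrable_mul hr
  have hle : ∫ ω, σ s ω ^ 2 * σ r ω ^ 2 ∂P ≤
      ∫ ω, (1 / 2) * ((σ s ω ^ 2) ^ 2 + (σ r ω ^ 2) ^ 2) ∂P := by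
    refine integral_mono hi ((hs.integrable_sq.add hr.integrable_sq).const_mul (1 / 2))
      fun ω => ?_
    simp only
    nlinarith [sq_nonneg (σ s ω ^ 2 - σ r ω ^ 2)]
  rw [integral_const_mul, integral_add hs.integrable_sq hr.integrable_sq] at hle
  linarith [h4 s, h4 r]

lemma integral_weightedEnergy_self [IsProbabilityMeasure P] (hσ : JointlyMeasurable σ)
    (hA0 : 0 ≤ A)
    (hA : ∀ s, ∫⁻ ω, ENNReal.ofReal (σ s ω ^ 4) ∂P ≤ ENNReal.ofReal A)
    (hf : Measurable f) (hf2 : MemLp f 2 volume) :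
    ∫ ω, weightedEnergy σ f f ω ∂P = ∫ s, f s ^ 2 * ∫ ω, σ s ω ^ 2 ∂P := by
  have hm : Measurable (fun q : Ω × ℝ => f q.2 * f q.2 * σ q.2 q.1 ^ 2) :=
    ((hf.comp measurable_snd).mul (hf.comp measurable_snd)).mul (Measurable.pow_const hσ 2)
  have hσi : ∀ s, Integrable (fun ω => σ s ω ^ 2) P := fun s =>
    (memLp_sq_of_lintegral_pow_four_le hσ hA s).integrable (by norm_num)
  -- From σ² ≤ σ⁴ + 1. Any bound uniform in s serves here, since it is used only for integrability.
  have hbd : ∀ s, ∫ ω, σ s ω ^ 2 ∂P ≤ A + 1 := by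
    intro s
    have h1 := integral_sq_mul_sq_le hσ hA0 hA s s
    have hi : Integrable (fun ω => σ s ω ^ 2 * σ s ω ^ 2) P :=
      (memLp_sq_of_lintegral_pow_four_le hσ hA s).integrable_mul
        (memLp_sq_of_lintegral_pow_four_le hσ hA s)
    have h2 : ∫ ω, σ s ω ^ 2 ∂P ≤ ∫ ω, (σ s ω ^ 2 * σ s ω ^ 2 + 1) ∂P :=
      integral_mono (hσi s) (hi.add (integrable_const 1)) fun ω => by
        simp only; nlinarith [sq_nonneg (σ s ω ^ 2 - 1), sq_nonneg (σ s ω)]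
    rw [integral_add hi (integrable_const 1)] at h2
    simp at h2
    linarith
  have hint : Integrable (Function.uncurry fun ω s => f s * f s * σ s ω ^ 2)
      (P.prod volume) := by
    refine (integrable_prod_iff' hm.aestronglyMeasurable).2 ⟨ae_of_all _ fun s => ?_, ?_⟩
    · exact (hσi s).const_mul (f s * f s)
    · refine Integrable.mono' (g := fun s => f s ^ 2 * (A + 1)) (hf2.integrable_sq.mul_const _)
        (hm.stronglyMeasurable.norm.integral_prod_left).aestronglyMeasurable
        (ae_of_all _ fun s => ?_)
      rw [Real.norm_of_nonneg (integral_nonneg fun _ => norm_nonneg _)]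
      have : ∀ ω, ‖Function.uncurry (fun ω s => f s * f s * σ s ω ^ 2) (ω, s)‖ =
          f s ^ 2 * σ s ω ^ 2 := fun ω => by
        simp only [Function.uncurry]
        rw [Real.norm_of_nonneg (mul_nonneg (mul_self_nonneg _) (sq_nonneg _)), pow_two (f s)]
      refine (integral_congr_ae (ae_of_all _ this)).le.trans ?_
      rw [integral_const_mul]
      exact mul_le_mul_of_nonneg_left (hbd s) (sq_nonneg _)
  unfold weightedEnergy
  rw [integral_integral_swap hint]
  refine integral_congr_ae (ae_of_all _ fun s => ?_)
  simp only
  rw [integral_const_mul, pow_two]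

lemma integral_weightedEnergy_mul [IsProbabilityMeasure P] (hσ : JointlyMeasurable σ)
    (hA0 : 0 ≤ A)
    (hA : ∀ s, ∫⁻ ω, ENNReal.ofReal (σ s ω ^ 4) ∂P ≤ ENNReal.ofReal A)
    (hf : Measurable f) (hf2 : MemLp f 2 volume) (hf' : Measurable f')
    (hf2' : MemLp f' 2 volume) :
    ∫ ω, weightedEnergy σ f f ω * weightedEnergy σ f' f' ω ∂P =
      ∫ p : ℝ × ℝ, f p.1 ^ 2 * f' p.2 ^ 2 * ∫ ω, σ p.1 ω ^ 2 * σ p.2 ω ^ 2 ∂P ∧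
    Integrable (fun p : ℝ × ℝ => f p.1 ^ 2 * f' p.2 ^ 2 *
      ∫ ω, σ p.1 ω ^ 2 * σ p.2 ω ^ 2 ∂P) := by
  have hm1 : Measurable (fun q : Ω × ℝ × ℝ => σ q.2.1 q.1 ^ 2) := by
    have h : Measurable (fun q : Ω × ℝ × ℝ => (q.1, q.2.1)) := by fun_prop
    exact (Measurable.comp hσ h).pow_const 2
  have hm2 : Measurable (fun q : Ω × ℝ × ℝ => σ q.2.2 q.1 ^ 2) := by
    have h : Measurable (fun q : Ω × ℝ × ℝ => (q.1, q.2.2)) := by fun_prop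
    exact (Measurable.comp hσ h).pow_const 2
  have hm : Measurable (Function.uncurry fun (ω : Ω) (p : ℝ × ℝ) =>
      f p.1 ^ 2 * f' p.2 ^ 2 * (σ p.1 ω ^ 2 * σ p.2 ω ^ 2)) := by
    have h : Measurable (fun q : Ω × ℝ × ℝ => f q.2.1 ^ 2 * f' q.2.2 ^ 2) := by fun_prop
    exact h.mul (hm1.mul hm2)
  have hi : ∀ s r, Integrable (fun ω => σ s ω ^ 2 * σ r ω ^ 2) P := fun s r =>
    (memLp_sq_of_lintegral_pow_four_le hσ hA s).integrable_mul
      (memLp_sq_of_lintegral_pow_four_le hσ hA r)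
  have hff : Integrable (fun p : ℝ × ℝ => f p.1 ^ 2 * f' p.2 ^ 2) :=
    hf2.integrable_sq.mul_prod hf2'.integrable_sq
  have hnorm : ∀ p : ℝ × ℝ, ∫ ω, ‖Function.uncurry (fun (ω : Ω) (p : ℝ × ℝ) =>
      f p.1 ^ 2 * f' p.2 ^ 2 * (σ p.1 ω ^ 2 * σ p.2 ω ^ 2)) (ω, p)‖ ∂P =
      f p.1 ^ 2 * f' p.2 ^ 2 * ∫ ω, σ p.1 ω ^ 2 * σ p.2 ω ^ 2 ∂P := by
    intro p
    rw [← integral_const_mul]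
    congr 1; ext ω
    simp only [Function.uncurry]
    exact Real.norm_of_nonneg (by positivity)
  have hI : Integrable (fun p : ℝ × ℝ => f p.1 ^ 2 * f' p.2 ^ 2 *
      ∫ ω, σ p.1 ω ^ 2 * σ p.2 ω ^ 2 ∂P) := by
    simp_rw [← hnorm]
    refine Integrable.mono' (g := fun p : ℝ × ℝ => f p.1 ^ 2 * f' p.2 ^ 2 * A)
      (hff.mul_const A) (hm.stronglyMeasurable.norm.integral_prod_left).aestronglyMeasurable
      (ae_of_all _ fun p => ?_)
    rw [hnorm, Real.norm_of_nonneg (mul_nonneg (by positivity)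
      (integral_nonneg fun _ => by positivity))]
    exact mul_le_mul_of_nonneg_left (integral_sq_mul_sq_le hσ hA0 hA _ _) (by positivity)
  refine ⟨?_, hI⟩
  have hint : Integrable (Function.uncurry fun (ω : Ω) (p : ℝ × ℝ) =>
      f p.1 ^ 2 * f' p.2 ^ 2 * (σ p.1 ω ^ 2 * σ p.2 ω ^ 2)) (P.prod volume) := by
    refine (integrable_prod_iff' hm.aestronglyMeasurable).2 ⟨ae_of_all _ fun p => ?_, ?_⟩
    · exact (hi p.1 p.2).const_mul (f p.1 ^ 2 * f' p.2 ^ 2)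
    · simp_rw [hnorm]; exact hI
  have e : ∀ ω, weightedEnergy σ f f ω * weightedEnergy σ f' f' ω =
      ∫ p : ℝ × ℝ, f p.1 ^ 2 * f' p.2 ^ 2 * (σ p.1 ω ^ 2 * σ p.2 ω ^ 2) := by
    intro ω
    unfold weightedEnergy
    rw [← integral_prod_mul]
    congr 1; ext p; ring
  simp_rw [e]
  rw [integral_integral_swap hint]
  simp_rw [integral_const_mul]

/-- The cross energy is dominated by the energy of φ = √|f f'|, to which the L⁴(Ω; L²(ℝ)) bound
applies; the squared norm of φ is ∫ |f f'|. -/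
lemma integral_weightedEnergy_cross_sq_le [IsProbabilityMeasure P] (hσ : JointlyMeasurable σ)
    (hA0 : 0 ≤ A)
    (hA : ∀ s, ∫⁻ ω, ENNReal.ofReal (σ s ω ^ 4) ∂P ≤ ENNReal.ofReal A)
    (hf : Measurable f) (hf2 : MemLp f 2 volume) (hf' : Measurable f')
    (hf2' : MemLp f' 2 volume) :
    ∫ ω, weightedEnergy σ f f' ω ^ 2 ∂P ≤ A * (∫ s, |f s * f' s|) ^ 2 := by
  set φ : ℝ → ℝ := fun s => √|f s * f' s| with hφ
  have hφm : Measurable φ := by fun_prop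
  have hφφ : ∀ s, φ s ^ 2 = |f s * f' s| := fun s => Real.sq_sqrt (abs_nonneg _)
  have hff : Integrable (fun s => f s * f' s) := hf2.integrable_mul hf2'
  have hφ2 : MemLp φ 2 volume := by
    rw [memLp_two_iff_integrable_sq hφm.aestronglyMeasurable]
    simp_rw [hφφ]; exact hff.abs
  have hle : ∀ ω, weightedEnergy σ f f' ω ^ 2 ≤ weightedEnergy σ φ φ ω ^ 2 := by
    intro ω
    rw [← sq_abs]
    refine pow_le_pow_left₀ (abs_nonneg _) ?_ 2
    refine (abs_integral_le_integral_abs).trans (le_of_eq ?_)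
    unfold weightedEnergy
    congr 1; ext s
    rw [← pow_two (φ s), hφφ, abs_mul, abs_of_nonneg (sq_nonneg (σ s ω))]
  have i1 := (memLp_weightedEnergy (P := P) hσ ENNReal.ofReal_ne_top hA hf hf2 hf' hf2')
  have i2 := (memLp_weightedEnergy_self (P := P) hσ ENNReal.ofReal_ne_top hA hφm hφ2)
  refine (integral_mono i1.integrable_sq i2.integrable_sq hle).trans ?_
  rw [integral_eq_lintegral_of_nonneg_ae (ae_of_all _ fun ω => sq_nonneg _)
      ((measurable_weightedEnergy hσ hφm hφm).pow_const 2).aestronglyMeasurable,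
    lintegral_weightedEnergy_sq hσ ENNReal.ofReal_ne_top hA hφm hφ2]
  refine ENNReal.toReal_le_of_le_ofReal (by positivity) ?_
  refine (mixedNorm_four_mul_pow_le hφm hσ hA).trans (le_of_eq ?_)
  rw [ENNReal.ofReal_mul hA0, show (4 : ℕ) = 2 * 2 from rfl, pow_mul, eLpNorm_two_sq]
  simp_rw [hφφ]
  rw [← ofReal_integral_eq_lintegral_ofReal hff.abs (ae_of_all _ fun s => abs_nonneg _),
    ENNReal.ofReal_pow (integral_nonneg fun s => abs_nonneg _)]

/-- Bound for the covariance of the squares of two stochastic integrals. -/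
lemma IsVolatilityIntegral.covariance_sq_le [IsProbabilityMeasure P] (hσ : JointlyMeasurable σ)
    (hW : IsTwoSidedBrownianMotion F P W)
    (hind : IndepFun (fun ω t => σ t ω) (fun ω t => W t ω) P) (hA0 : 0 ≤ A)
    (hA : ∀ s, ∫⁻ ω, ENNReal.ofReal (σ s ω ^ 4) ∂P ≤ ENNReal.ofReal A)
    {κ : ℝ → ℝ → ℝ} (hκ : ∀ s r, cov[fun ω => σ s ω ^ 2, fun ω => σ r ω ^ 2; P] ≤ κ s r)
    (h : IsVolatilityIntegral F P σ W f X) (h' : IsVolatilityIntegral F P σ W f' X')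
    (hint : Integrable (fun p : ℝ × ℝ => f p.1 ^ 2 * f' p.2 ^ 2 * κ p.1 p.2)) :
    cov[fun ω => X ω ^ 2, fun ω => X' ω ^ 2; P] ≤
      (∫ p : ℝ × ℝ, f p.1 ^ 2 * f' p.2 ^ 2 * κ p.1 p.2) + 2 * (A * (∫ s, |f s * f' s|) ^ 2) := by
  have hf := h.measurable_kernel
  have hf2 := h.memLp_kernel
  have hf' := h'.measurable_kernel
  have hf2' := h'.memLp_kernel
  have hsq : ∀ {f X}, IsVolatilityIntegral F P σ W f X → MemLp (fun ω => X ω ^ 2) 2 P := by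
    intro f X h
    refine (memLp_two_iff_integrable_sq (f := fun ω => X ω ^ 2) (h.memLp_two.1.pow 2)).2 ?_
    simpa only [← pow_mul] using h.integrable_pow_four hσ hW hind ENNReal.ofReal_ne_top hA
  have hσ2 := memLp_sq_of_lintegral_pow_four_le hσ hA
  rw [covariance_eq_sub (hsq h) (hsq h')]
  simp only [Pi.mul_apply]
  rw [h.integral_sq_mul_sq hσ hW hind ENNReal.ofReal_ne_top hA h',
    h.integral_sq hσ hW ENNReal.ofReal_ne_top hA, h'.integral_sq hσ hW ENNReal.ofReal_ne_top hA,
    integral_weightedEnergy_self hσ hA0 hA hf hf2, integral_weightedEnergy_self hσ hA0 hA hf' hf2',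
    ← integral_prod_mul, ← Measure.volume_eq_prod]
  obtain ⟨e, hI⟩ := integral_weightedEnergy_mul (P := P) hσ hA0 hA hf hf2 hf' hf2'
  rw [e]
  have hc := integral_weightedEnergy_cross_sq_le (P := P) hσ hA0 hA hf hf2 hf' hf2'
  -- After Fubini, subtracting the product of the means leaves the covariance kernel of σ², and f²
  -- f'² ≥ 0 lets its upper bound κ replace it under the integral.
  have hmean : ∀ p : ℝ × ℝ, (f p.1 ^ 2 * ∫ ω, σ p.1 ω ^ 2 ∂P) * (f' p.2 ^ 2 *
      ∫ ω, σ p.2 ω ^ 2 ∂P) = f p.1 ^ 2 * f' p.2 ^ 2 * (∫ ω, σ p.1 ω ^ 2 * σ p.2 ω ^ 2 ∂P) -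
      f p.1 ^ 2 * f' p.2 ^ 2 * cov[fun ω => σ p.1 ω ^ 2, fun ω => σ p.2 ω ^ 2; P] := by
    intro p
    rw [covariance_eq_sub (hσ2 _) (hσ2 _)]
    simp only [Pi.mul_apply]
    ring
  have hle : (∫ p : ℝ × ℝ, f p.1 ^ 2 * f' p.2 ^ 2 * ∫ ω, σ p.1 ω ^ 2 * σ p.2 ω ^ 2 ∂P) ≤
      (∫ p : ℝ × ℝ, (f p.1 ^ 2 * ∫ ω, σ p.1 ω ^ 2 ∂P) * (f' p.2 ^ 2 * ∫ ω, σ p.2 ω ^ 2 ∂P)) +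
        ∫ p : ℝ × ℝ, f p.1 ^ 2 * f' p.2 ^ 2 * κ p.1 p.2 := by
    have hM : Integrable (fun p : ℝ × ℝ =>
        (f p.1 ^ 2 * ∫ ω, σ p.1 ω ^ 2 ∂P) * (f' p.2 ^ 2 * ∫ ω, σ p.2 ω ^ 2 ∂P)) := by
      have hσi : ∀ {f : ℝ → ℝ}, Measurable f → MemLp f 2 volume →
          Integrable (fun s => f s ^ 2 * ∫ ω, σ s ω ^ 2 ∂P) := by
        intro f hf hf2
        have hm : Measurable (fun q : Ω × ℝ => σ q.2 q.1 ^ 2) := Measurable.pow_const hσ 2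
        refine hf2.integrable_sq.mul_bdd (c := A + 1)
          hm.stronglyMeasurable.integral_prod_left.aestronglyMeasurable (ae_of_all _ fun s => ?_)
        have h1 := integral_sq_mul_sq_le hσ hA0 hA s s
        have h2 := variance_nonneg (fun ω => σ s ω ^ 2) P
        rw [variance_eq_sub (hσ2 s)] at h2
        simp only [Pi.pow_apply, ← pow_two] at h1 h2
        rw [Real.norm_of_nonneg (integral_nonneg fun _ => sq_nonneg _)]
        nlinarith
      exact (hσi hf hf2).mul_prod (hσi hf' hf2')
    rw [← integral_add hM hint]
    refine integral_mono hI (hM.add hint) fun p => ?_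
    simp only
    rw [hmean]
    have := mul_le_mul_of_nonneg_left (hκ p.1 p.2)
      (show 0 ≤ f p.1 ^ 2 * f' p.2 ^ 2 by positivity)
    linarith
  linarith

end CovarianceBound

/-! ### Increment kernels with exponential tails -/

lemma sq_integral_abs_mul_le {f g : ℝ → ℝ} (hf : MemLp f 2 volume) (hg : MemLp g 2 volume) :
    (∫ s, |f s * g s|) ^ 2 ≤ (∫ s, f s ^ 2) * ∫ s, g s ^ 2 := by
  have h := integral_mul_le_Lp_mul_Lq_of_nonneg (μ := (volume : Measure ℝ))
    (f := fun s => |f s|) (g := fun s => |g s|) Real.HolderConjugate.two_two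
    (ae_of_all _ fun s => abs_nonneg _) (ae_of_all _ fun s => abs_nonneg _)
    (by rw [ENNReal.ofReal_ofNat]; exact hf.abs)
    (by rw [ENNReal.ofReal_ofNat]; exact hg.abs)
  simp only [Real.rpow_two, sq_abs, ← abs_mul, ← Real.sqrt_eq_rpow] at h
  refine (pow_le_pow_left₀ (integral_nonneg fun _ => abs_nonneg _) h 2).trans (le_of_eq ?_)
  rw [mul_pow, Real.sq_sqrt (integral_nonneg fun _ => sq_nonneg _),
    Real.sq_sqrt (integral_nonneg fun _ => sq_nonneg _)]

/-- A non-negative square integrable kernel on `(0, ∞)` with squared norm at most `M`, bounded by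
`α * exp (-β * x)` for `x > K`. -/
structure HasExponentialTail (k : ℝ → ℝ) (M K α β : ℝ) : Prop where
  measurable : Measurable k
  nonneg : ∀ x, 0 ≤ k x
  zero : ∀ x ≤ 0, k x = 0
  memLp : MemLp k 2 volume
  integral_sq_le : ∫ x, k x ^ 2 ≤ M
  tail : ∀ x, K < x → k x ≤ α * Real.exp (-β * x)

namespace HasExponentialTail

variable {k : ℝ → ℝ} {M K α β μ ν : ℝ}

lemma bound_nonneg (hk : HasExponentialTail k M K α β) : 0 ≤ M :=
  (integral_nonneg fun _ => sq_nonneg _).trans hk.integral_sq_le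

lemma sq_le (hk : HasExponentialTail k M K α β) {x : ℝ} (hx : K < x) :
    k x ^ 2 ≤ α ^ 2 * Real.exp (-(2 * β) * x) := by
  refine (pow_le_pow_left₀ (hk.nonneg x) (hk.tail x hx) 2).trans (le_of_eq ?_)
  rw [mul_pow, ← Real.exp_nat_mul]
  congr 2; push_cast; ring

/-- The squared kernel has an exponential moment. -/
lemma integral_sq_mul_exp_le (hk : HasExponentialTail k M K α β) (hK : 0 ≤ K) (hμ0 : 0 < μ)
    (hμ2 : μ ≤ 2) (hμν : μ ≤ ν) (hνβ : ν < 2 * β) :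
    Integrable (fun v => k v ^ 2 * Real.exp (μ * v)) ∧
      ∫ v, k v ^ 2 * Real.exp (μ * v) ≤ α ^ 2 / (2 * β - ν) + Real.exp (2 * K) * M := by
  have hneg : μ - 2 * β < 0 := by linarith
  -- Up to K the weight is at most exp(μ K) and the L² norm of the kernel is used; beyond K the tail
  -- bound is integrable against the weight because μ < 2β.
  have hle : ∀ v, k v ^ 2 * Real.exp (μ * v) ≤ Real.exp (μ * K) * k v ^ 2 +
      (Set.Ioi K).indicator (fun v => α ^ 2 * Real.exp ((μ - 2 * β) * v)) v := by
    intro v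
    by_cases hv : K < v
    · rw [Set.indicator_of_mem (Set.mem_Ioi.2 hv)]
      have h1 := mul_le_mul_of_nonneg_right (hk.sq_le hv) (Real.exp_nonneg (μ * v))
      rw [mul_assoc, ← Real.exp_add, show -(2 * β) * v + μ * v = (μ - 2 * β) * v by ring] at h1
      have : 0 ≤ Real.exp (μ * K) * k v ^ 2 := by positivity
      linarith
    · rw [Set.indicator_of_notMem (by simpa using hv), add_zero, mul_comm]
      refine mul_le_mul_of_nonneg_right (Real.exp_le_exp.2 ?_) (sq_nonneg _)
      exact mul_le_mul_of_nonneg_left (not_lt.1 hv) hμ0.le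
  have i1 : Integrable (fun v => Real.exp (μ * K) * k v ^ 2) := hk.memLp.integrable_sq.const_mul _
  have i2 : Integrable ((Set.Ioi K).indicator fun v => α ^ 2 * Real.exp ((μ - 2 * β) * v)) :=
    IntegrableOn.integrable_indicator ((integrableOn_exp_mul_Ioi hneg K).const_mul _)
      measurableSet_Ioi
  have hI : Integrable (fun v => k v ^ 2 * Real.exp (μ * v)) := by
    have hm := hk.measurable
    refine (i1.add i2).mono' (by fun_prop) (ae_of_all _ fun v => ?_)
    rw [Real.norm_of_nonneg (by positivity)]
    exact hle v
  refine ⟨hI, (integral_mono hI (i1.add i2) hle).trans ?_⟩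
  simp only [Pi.add_apply]
  rw [integral_add i1 i2, integral_const_mul, integral_indicator measurableSet_Ioi,
    integral_const_mul, integral_exp_mul_Ioi hneg]
  have h1 : Real.exp (μ * K) * ∫ v, k v ^ 2 ≤ Real.exp (2 * K) * M :=
    mul_le_mul (Real.exp_le_exp.2 (mul_le_mul_of_nonneg_right hμ2 hK)) hk.integral_sq_le
      (integral_nonneg fun _ => sq_nonneg _) (Real.exp_nonneg _)
  have h2 : α ^ 2 * (-Real.exp ((μ - 2 * β) * K) / (μ - 2 * β)) ≤ α ^ 2 / (2 * β - ν) := by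
    rw [div_eq_mul_one_div (α ^ 2)]
    refine mul_le_mul_of_nonneg_left ?_ (sq_nonneg _)
    rw [neg_div, ← div_neg, neg_sub]
    exact div_le_div₀ zero_le_one (Real.exp_le_one_iff.2 (mul_nonpos_of_nonpos_of_nonneg hneg.le hK))
      (by linarith) (by linarith)
  linarith

/-- The tail of the squared kernel decays exponentially. -/
lemma setIntegral_sq_le (hk : HasExponentialTail k M K α β) (hK : 0 ≤ K) (hμ0 : 0 < μ)
    (hμ2 : μ ≤ 2) (hμβ : μ < 2 * β) (x : ℝ) :
    ∫ v in Set.Ioi x, k v ^ 2 ≤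
      Real.exp (-(μ * x)) * (α ^ 2 / (2 * β) + Real.exp (2 * K) * M) := by
  have hβ : 0 < 2 * β := hμ0.trans hμβ
  have hM := hk.bound_nonneg
  have hI : Integrable (fun v => k v ^ 2) := hk.memLp.integrable_sq
  rcases le_or_gt x K with hx | hx
  · have h1 : ∫ v in Set.Ioi x, k v ^ 2 ≤ M :=
      (setIntegral_le_integral hI (ae_of_all _ fun _ => sq_nonneg _)).trans hk.integral_sq_le
    -- For x ≤ K there is no decay yet; the factor exp(2K) compensates, as μ ≤ 2 and K ≥ 0.
    have h2 : 1 ≤ Real.exp (-(μ * x)) * Real.exp (2 * K) := by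
      rw [← Real.exp_add]
      refine Real.one_le_exp ?_
      nlinarith [mul_le_mul_of_nonneg_left hx hμ0.le]
    have h3 := mul_le_mul_of_nonneg_right h2 hM
    have h4 : 0 ≤ Real.exp (-(μ * x)) * (α ^ 2 / (2 * β)) := by positivity
    linarith
  · have hneg : -(2 * β) < 0 := by linarith
    have h1 : ∫ v in Set.Ioi x, k v ^ 2 ≤
        ∫ v in Set.Ioi x, α ^ 2 * Real.exp (-(2 * β) * v) :=
      setIntegral_mono_on hI.integrableOn ((integrableOn_exp_mul_Ioi hneg x).const_mul _)
        measurableSet_Ioi fun v hv => hk.sq_le (hx.trans hv)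
    rw [integral_const_mul, integral_exp_mul_Ioi hneg, neg_div_neg_eq] at h1
    have h2 : Real.exp (-(2 * β) * x) ≤ Real.exp (-(μ * x)) :=
      Real.exp_le_exp.2 (by nlinarith [hK.trans_lt hx])
    have h3 : α ^ 2 * (Real.exp (-(2 * β) * x) / (2 * β)) ≤
        Real.exp (-(μ * x)) * (α ^ 2 / (2 * β)) := by
      rw [mul_div_assoc', mul_div_assoc', mul_comm]
      exact div_le_div_of_nonneg_right (mul_le_mul_of_nonneg_right h2 (sq_nonneg _)) hβ.le
    have h4 : 0 ≤ Real.exp (-(μ * x)) * (Real.exp (2 * K) * M) := by positivity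
    linarith

end HasExponentialTail

/-- The kernel of the increment over `[t - h, t]`. -/
def incrementKernel (k : ℝ → ℝ) (h t s : ℝ) : ℝ := k (t - s) - k (t - h - s)

lemma memLp_comp_sub_left {k : ℝ → ℝ} (hk : MemLp k 2 volume) (t : ℝ) :
    MemLp (fun s => k (t - s)) 2 volume :=
  hk.comp_measurePreserving (Measure.measurePreserving_sub_left volume t)

namespace HasExponentialTail

variable {k : ℝ → ℝ} {M K α β μ ν h t : ℝ}

lemma memLp_incrementKernel (hk : HasExponentialTail k M K α β) (h t : ℝ) :
    MemLp (incrementKernel k h t) 2 volume :=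
  (memLp_comp_sub_left hk.memLp t).sub (memLp_comp_sub_left hk.memLp (t - h))

lemma incrementKernel_eq_zero (hk : HasExponentialTail k M K α β) (hh : 0 ≤ h) {s : ℝ}
    (hs : t ≤ s) : incrementKernel k h t s = 0 := by
  rw [incrementKernel, hk.zero _ (by linarith), hk.zero _ (by linarith), sub_zero]

/-- The kernel is non-negative, so the cross term only lowers the square and no factor 2 is lost. -/
lemma sq_incrementKernel_le (hk : HasExponentialTail k M K α β) (h t s : ℝ) :
    incrementKernel k h t s ^ 2 ≤ k (t - s) ^ 2 + k (t - h - s) ^ 2 := by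
  unfold incrementKernel
  nlinarith [mul_nonneg (hk.nonneg (t - s)) (hk.nonneg (t - h - s))]

lemma integral_sq_incrementKernel_le (hk : HasExponentialTail k M K α β) (h t : ℝ) :
    ∫ s, incrementKernel k h t s ^ 2 ≤ 2 * M := by
  have hi : ∀ t, Integrable (fun s => k (t - s) ^ 2) := fun t =>
    (memLp_comp_sub_left hk.memLp t).integrable_sq
  refine (integral_mono (hk.memLp_incrementKernel h t).integrable_sq ((hi t).add (hi (t - h)))
    (hk.sq_incrementKernel_le h t)).trans ?_
  simp only [Pi.add_apply]
  rw [integral_add (hi t) (hi (t - h)),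
    integral_sub_left_eq_self (fun s => k s ^ 2) volume t,
    integral_sub_left_eq_self (fun s => k s ^ 2) volume (t - h)]
  linarith [hk.integral_sq_le]

lemma integral_sq_incrementKernel_mul_exp_le (hk : HasExponentialTail k M K α β) (hK : 0 ≤ K)
    (hμ0 : 0 < μ) (hμ2 : μ ≤ 2) (hμν : μ ≤ ν) (hνβ : ν < 2 * β) (hh : 0 ≤ h) (t : ℝ) :
    Integrable (fun s => incrementKernel k h t s ^ 2 * Real.exp (μ * (t - s))) ∧
      ∫ s, incrementKernel k h t s ^ 2 * Real.exp (μ * (t - s)) ≤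
        2 * Real.exp (2 * h) * (α ^ 2 / (2 * β - ν) + Real.exp (2 * K) * M) := by
  obtain ⟨hI, hB⟩ := hk.integral_sq_mul_exp_le hK hμ0 hμ2 hμν hνβ
  have hi : ∀ t, Integrable (fun s => k (t - s) ^ 2 * Real.exp (μ * (t - s))) := fun t =>
    hI.comp_sub_left t
  have hle : ∀ s, incrementKernel k h t s ^ 2 * Real.exp (μ * (t - s)) ≤
      k (t - s) ^ 2 * Real.exp (μ * (t - s)) +
        Real.exp (μ * h) * (k (t - h - s) ^ 2 * Real.exp (μ * (t - h - s))) := by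
    intro s
    have h1 := mul_le_mul_of_nonneg_right (hk.sq_incrementKernel_le h t s)
      (Real.exp_nonneg (μ * (t - s)))
    have h2 : Real.exp (μ * (t - s)) = Real.exp (μ * h) * Real.exp (μ * (t - h - s)) := by
      rw [← Real.exp_add]; ring_nf
    refine h1.trans (le_of_eq ?_)
    rw [add_mul]
    nth_rewrite 2 [h2]
    ring
  have hm : Measurable (incrementKernel k h t) := by
    have := hk.measurable
    unfold incrementKernel
    fun_prop
  have hsum := (hi t).add ((hi (t - h)).const_mul (Real.exp (μ * h)))
  have hJ : Integrable (fun s => incrementKernel k h t s ^ 2 * Real.exp (μ * (t - s))) := by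
    refine hsum.mono' (by fun_prop) (ae_of_all _ fun s => ?_)
    rw [Real.norm_of_nonneg (by positivity)]
    exact hle s
  refine ⟨hJ, (integral_mono hJ hsum hle).trans ?_⟩
  simp only [Pi.add_apply]
  rw [integral_add (hi t) ((hi (t - h)).const_mul _), integral_const_mul,
    integral_sub_left_eq_self (fun s => k s ^ 2 * Real.exp (μ * s)) volume t,
    integral_sub_left_eq_self (fun s => k s ^ 2 * Real.exp (μ * s)) volume (t - h)]
  have h0 : 0 ≤ ∫ s, k s ^ 2 * Real.exp (μ * s) := integral_nonneg fun _ => by positivity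
  -- The kernel shifted by h loses a factor exp(μ h); this is where exp(2h) in `constC` comes from.
  have h1 : 1 + Real.exp (μ * h) ≤ 2 * Real.exp (2 * h) := by
    have := Real.one_le_exp (show 0 ≤ 2 * h by linarith)
    have := Real.exp_le_exp.2 (mul_le_mul_of_nonneg_right hμ2 hh)
    linarith
  have := mul_le_mul h1 hB h0 (by positivity)
  linarith

lemma setIntegral_sq_incrementKernel_le (hk : HasExponentialTail k M K α β) (hK : 0 ≤ K)
    (hμ0 : 0 < μ) (hμ2 : μ ≤ 2) (hμβ : μ < 2 * β) (hh : 0 ≤ h) (t u : ℝ) :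
    ∫ s in Set.Iio u, incrementKernel k h t s ^ 2 ≤ 2 * Real.exp (2 * h) *
      (α ^ 2 / (2 * β) + Real.exp (2 * K) * M) * Real.exp (-(μ * (t - u))) := by
  have hi : ∀ t, Integrable (fun s => k (t - s) ^ 2) := fun t =>
    (memLp_comp_sub_left hk.memLp t).integrable_sq
  have htail : ∀ t, ∫ s in Set.Iio u, k (t - s) ^ 2 = ∫ v in Set.Ioi (t - u), k v ^ 2 := by
    intro t
    rw [← integral_indicator measurableSet_Iio, ← integral_indicator measurableSet_Ioi,
      ← integral_sub_left_eq_self ((Set.Ioi (t - u)).indicator fun v => k v ^ 2) volume t]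
    congr 1; ext s
    simp [Set.indicator_apply]
  have hB : 0 ≤ α ^ 2 / (2 * β) + Real.exp (2 * K) * M := by
    have := hk.bound_nonneg
    have : 0 < 2 * β := hμ0.trans hμβ
    positivity
  have h1 : ∫ s in Set.Iio u, incrementKernel k h t s ^ 2 ≤
      ∫ s in Set.Iio u, (k (t - s) ^ 2 + k (t - h - s) ^ 2) :=
    integral_mono (hk.memLp_incrementKernel h t).integrable_sq.integrableOn
      ((hi t).add (hi (t - h))).integrableOn (hk.sq_incrementKernel_le h t)
  rw [integral_add (hi t).integrableOn (hi (t - h)).integrableOn, htail, htail] at h1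
  have h2 := hk.setIntegral_sq_le hK hμ0 hμ2 hμβ (t - u)
  have h3 := hk.setIntegral_sq_le hK hμ0 hμ2 hμβ (t - h - u)
  rw [show -(μ * (t - h - u)) = μ * h + -(μ * (t - u)) by ring, Real.exp_add] at h3
  have h4 : 1 + Real.exp (μ * h) ≤ 2 * Real.exp (2 * h) := by
    have := Real.one_le_exp (show 0 ≤ 2 * h by linarith)
    have := Real.exp_le_exp.2 (mul_le_mul_of_nonneg_right hμ2 hh)
    linarith
  have := mul_le_mul_of_nonneg_right h4 (mul_nonneg hB (Real.exp_nonneg (-(μ * (t - u)))))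
  linarith

lemma integral_sq_mul_sq_mul_exp_le (hk : HasExponentialTail k M K α β) (hK : 0 ≤ K)
    (hμ0 : 0 < μ) (hμ2 : μ ≤ 2) (hμν : μ ≤ ν) (hνβ : ν < 2 * β) (hh : 0 ≤ h) (u t : ℝ) {A : ℝ}
    (hA : 0 ≤ A) :
    Integrable (fun p : ℝ × ℝ => incrementKernel k h u p.1 ^ 2 * incrementKernel k h t p.2 ^ 2 *
      (A * Real.exp (-(μ * |p.1 - p.2|)))) ∧
    ∫ p : ℝ × ℝ, incrementKernel k h u p.1 ^ 2 * incrementKernel k h t p.2 ^ 2 *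
      (A * Real.exp (-(μ * |p.1 - p.2|))) ≤ 4 * M * Real.exp (2 * h) *
        (A * (α ^ 2 / (2 * β - ν) + Real.exp (2 * K) * M)) * Real.exp (-(μ * (t - u))) := by
  obtain ⟨hI, hB⟩ := hk.integral_sq_incrementKernel_mul_exp_le hK hμ0 hμ2 hμν hνβ hh t
  have hsq : ∀ t, Integrable (fun s => incrementKernel k h t s ^ 2) := fun t =>
    (hk.memLp_incrementKernel h t).integrable_sq
  have hJ : Integrable (fun p : ℝ × ℝ => incrementKernel k h u p.1 ^ 2 *
      incrementKernel k h t p.2 ^ 2 * (A * Real.exp (-(μ * |p.1 - p.2|)))) := by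
    refine ((hsq u).mul_prod (hsq t)).mul_bdd (c := A) (by fun_prop) (ae_of_all _ fun p => ?_)
    rw [Real.norm_of_nonneg (by positivity)]
    exact mul_le_of_le_one_right hA (Real.exp_le_one_iff.2 (by
      have := mul_nonneg hμ0.le (abs_nonneg (p.1 - p.2)); linarith))
  have hR := ((hsq u).mul_prod hI).const_mul (A * Real.exp (-(μ * (t - u))))
  refine ⟨hJ, (integral_mono hJ hR fun p => ?_).trans ?_⟩
  · simp only
    rcases le_or_gt u p.1 with hp | hp
    · rw [hk.incrementKernel_eq_zero hh hp]; simp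
    -- For p.1 < u one has |p.1 - p.2| ≥ p.2 - u = (t - u) - (t - p.2). So exp(-μ (t - u)) factors
    -- out, at the price of an exponential moment of the kernel at t.
    · have h1 : Real.exp (-(μ * |p.1 - p.2|)) ≤
          Real.exp (-(μ * (t - u))) * Real.exp (μ * (t - p.2)) := by
        rw [← Real.exp_add]
        refine Real.exp_le_exp.2 ?_
        have := mul_le_mul_of_nonneg_left
          ((neg_abs_le (p.1 - p.2)).trans (sub_le_sub_right hp.le p.2)) hμ0.le
        linarith
      have h2 := mul_le_mul_of_nonneg_left h1 (show 0 ≤ incrementKernel k h u p.1 ^ 2 *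
        incrementKernel k h t p.2 ^ 2 * A by positivity)
      linarith
  · rw [integral_const_mul, Measure.volume_eq_prod,
      integral_prod_mul (fun s => incrementKernel k h u s ^ 2)
        (fun s => incrementKernel k h t s ^ 2 * Real.exp (μ * (t - s)))]
    have h1 := mul_le_mul (hk.integral_sq_incrementKernel_le h u) hB
      (integral_nonneg fun _ => by positivity) (mul_nonneg zero_le_two hk.bound_nonneg)
    have h2 := mul_le_mul_of_nonneg_left h1
      (show 0 ≤ A * Real.exp (-(μ * (t - u))) by positivity)
    linarith

lemma sq_integral_abs_incrementKernel_mul_le (hk : HasExponentialTail k M K α β) (hK : 0 ≤ K)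
    (hμ0 : 0 < μ) (hμ2 : μ ≤ 2) (hμβ : μ < 2 * β) (hh : 0 ≤ h) (u t : ℝ) :
    (∫ s, |incrementKernel k h u s * incrementKernel k h t s|) ^ 2 ≤
      4 * M * Real.exp (2 * h) * (α ^ 2 / (2 * β) + Real.exp (2 * K) * M) *
        Real.exp (-(μ * (t - u))) := by
  -- The kernel at u vanishes from u on, so only the part of the kernel at t before u counts, and
  -- its squared norm is exponentially small in t - u.
  have e : ∀ s, |incrementKernel k h u s * incrementKernel k h t s| =
      |incrementKernel k h u s * (Set.Iio u).indicator (incrementKernel k h t) s| := by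
    intro s
    rcases le_or_gt u s with hs | hs
    · rw [hk.incrementKernel_eq_zero hh hs]; simp
    · rw [Set.indicator_of_mem (Set.mem_Iio.2 hs)]
  simp_rw [e]
  refine (sq_integral_abs_mul_le (hk.memLp_incrementKernel h u)
    ((hk.memLp_incrementKernel h t).indicator measurableSet_Iio)).trans ?_
  have e2 : ∫ s, (Set.Iio u).indicator (incrementKernel k h t) s ^ 2 =
      ∫ s in Set.Iio u, incrementKernel k h t s ^ 2 := by
    rw [← integral_indicator measurableSet_Iio]
    congr 1; ext s
    by_cases hs : s < u <;> simp [hs]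
  rw [e2]
  have := mul_le_mul (hk.integral_sq_incrementKernel_le h u)
    (hk.setIntegral_sq_incrementKernel_le hK hμ0 hμ2 hμβ hh t u)
    (integral_nonneg fun _ => sq_nonneg _) (mul_nonneg zero_le_two hk.bound_nonneg)
  linarith

/-- Exponential decay of the covariances of squared increments. -/
lemma covariance_sq_le {Ω : Type*} {mΩ : MeasurableSpace Ω} {F : Filtration ℝ mΩ}
    {P : Measure Ω} [IsProbabilityMeasure P] {σ W : ℝ → Ω → ℝ} {X X' : Ω → ℝ} {A B u : ℝ}
    (hk : HasExponentialTail k M K α β) (hK : 0 ≤ K)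
    (hμ0 : 0 < μ) (hμ2 : μ ≤ 2) (hμν : μ ≤ ν) (hνβ : ν < 2 * β) (hh : 0 ≤ h)
    (hσ : JointlyMeasurable σ) (hW : IsTwoSidedBrownianMotion F P W)
    (hind : IndepFun (fun ω t => σ t ω) (fun ω t => W t ω) P) (hA0 : 0 ≤ A) (hB0 : 0 ≤ B)
    (hA : ∀ s, ∫⁻ ω, ENNReal.ofReal (σ s ω ^ 4) ∂P ≤ ENNReal.ofReal A)
    (hcov : ∀ s r, cov[fun ω => σ s ω ^ 2, fun ω => σ r ω ^ 2; P] ≤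
      B * Real.exp (-(μ * |s - r|)))
    (hX : IsVolatilityIntegral F P σ W (incrementKernel k h u) X)
    (hX' : IsVolatilityIntegral F P σ W (incrementKernel k h t) X') :
    cov[fun ω => X ω ^ 2, fun ω => X' ω ^ 2; P] ≤
      2 * constC A B ν α β M K h * Real.exp (-(μ * (t - u))) := by
  obtain ⟨hI, hT⟩ := hk.integral_sq_mul_sq_mul_exp_le hK hμ0 hμ2 hμν hνβ hh u t hB0
  refine (IsVolatilityIntegral.covariance_sq_le hσ hW hind hA0 hA hcov hX hX' hI).trans ?_
  have h2 := mul_le_mul_of_nonneg_left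
    (hk.sq_integral_abs_incrementKernel_mul_le hK hμ0 hμ2 (hμν.trans_lt hνβ) hh u t) hA0
  -- The cross term enters the covariance twice and this one once; its non-negativity allows
  -- doubling it, so that the sum is at most twice `constC`.
  have h3 : 0 ≤ 4 * M * Real.exp (2 * h) *
      (B * (α ^ 2 / (2 * β - ν) + Real.exp (2 * K) * M)) * Real.exp (-(μ * (t - u))) := by
    have := hk.bound_nonneg
    have : 0 < 2 * β - ν := by linarith
    positivity
  unfold constC
  linarith

end HasExponentialTail

/-! ### Weak law of large numbers -/

/-- In truncated subtraction the exponent is |i - j|. Splitting the sum at i leaves two pieces, each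
bounded by a full geometric series. -/
lemma sum_Icc_pow_dist_le {q : ℝ} (hq0 : 0 ≤ q) (hq1 : q < 1) (i N : ℕ) :
    ∑ j ∈ Finset.Icc 1 N, q ^ ((i - j) + (j - i)) ≤ 2 / (1 - q) := by
  have hgeo : ∀ M : ℕ, ∑ k ∈ Finset.range M, q ^ k ≤ 1 / (1 - q) := fun M => by
    rw [one_div, ← tsum_geometric_of_lt_one hq0 hq1]
    exact (summable_geometric_of_lt_one hq0 hq1).sum_le_tsum _ fun k _ => pow_nonneg hq0 k
  have hsub : Finset.Icc 1 N ⊆ Finset.range (i + (N + 1)) := fun j hj => by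
    simp only [Finset.mem_Icc, Finset.mem_range] at hj ⊢; lia
  refine (Finset.sum_le_sum_of_subset_of_nonneg hsub fun _ _ _ => pow_nonneg hq0 _).trans ?_
  rw [Finset.sum_range_add, ← Finset.sum_range_reflect]
  have h1 : ∑ j ∈ Finset.range i, q ^ ((i - (i - 1 - j)) + ((i - 1 - j) - i)) ≤
      ∑ j ∈ Finset.range i, q ^ j :=
    Finset.sum_le_sum fun j hj => by
      rw [Finset.mem_range] at hj
      exact pow_le_pow_of_le_one hq0 hq1.le (by lia)
  have h2 : ∑ k ∈ Finset.range (N + 1), q ^ ((i - (i + k)) + (i + k - i)) =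
      ∑ k ∈ Finset.range (N + 1), q ^ k := Finset.sum_congr rfl fun k _ => by congr 1; lia
  rw [h2]
  have := hgeo i
  have := hgeo (N + 1)
  have e : 2 / (1 - q) = 1 / (1 - q) + 1 / (1 - q) := by ring
  linarith

section WeakLaw

variable {Ω : Type*} {mΩ : MeasurableSpace Ω} {P : Measure Ω}
  {Z : ℕ → Ω → ℝ} {m B q : ℝ}

/-- Quantitative `L²` law of large numbers under exponentially decaying covariances. -/
lemma integral_sq_average_sub_le [IsProbabilityMeasure P] (hZ : ∀ i, 1 ≤ i → MemLp (Z i) 2 P)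
    (hm : ∀ i, 1 ≤ i → ∫ ω, Z i ω ∂P = m) (hB : 0 ≤ B) (hq0 : 0 ≤ q) (hq1 : q < 1)
    (hcov : ∀ i j, 1 ≤ i → i ≤ j → cov[Z i, Z j; P] ≤ B * q ^ (j - i)) {N : ℕ} (hN : 1 ≤ N) :
    MemLp (fun ω => (1 / (N : ℝ)) * ∑ i ∈ Finset.Icc 1 N, Z i ω - m) 2 P ∧
    ∫ ω, ((1 / (N : ℝ)) * ∑ i ∈ Finset.Icc 1 N, Z i ω - m) ^ 2 ∂P ≤
      2 * B / (1 - q) / N := by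
  have hN0 : (0 : ℝ) < N := by exact_mod_cast hN
  have hZ' : ∀ i ∈ Finset.Icc 1 N, MemLp (Z i) 2 P := fun i hi => hZ i (Finset.mem_Icc.1 hi).1
  have hsum : MemLp (fun ω => ∑ i ∈ Finset.Icc 1 N, Z i ω) 2 P := memLp_finsetSum _ hZ'
  have havg : MemLp (fun ω => (1 / (N : ℝ)) * ∑ i ∈ Finset.Icc 1 N, Z i ω) 2 P :=
    hsum.const_mul _
  refine ⟨havg.sub (memLp_const m), ?_⟩
  have hmean : ∫ ω, (1 / (N : ℝ)) * ∑ i ∈ Finset.Icc 1 N, Z i ω ∂P = m := by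
    rw [integral_const_mul, integral_finsetSum _ fun i hi => (hZ' i hi).integrable one_le_two,
      Finset.sum_congr rfl fun i hi => hm i (Finset.mem_Icc.1 hi).1]
    simp
    field_simp
  have hv := variance_eq_integral havg.aestronglyMeasurable.aemeasurable
  rw [hmean] at hv
  rw [← hv, variance_const_mul]
  have hs : (fun ω => ∑ i ∈ Finset.Icc 1 N, Z i ω) = ∑ i ∈ Finset.Icc 1 N, Z i := by
    ext ω; simp
  rw [hs, variance_sum' hZ']
  have hij : ∀ i ∈ Finset.Icc 1 N, ∑ j ∈ Finset.Icc 1 N, cov[Z i, Z j; P] ≤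
      B * (2 / (1 - q)) := by
    intro i hi
    refine le_trans ?_ (mul_le_mul_of_nonneg_left (sum_Icc_pow_dist_le hq0 hq1 i N) hB)
    rw [Finset.mul_sum]
    refine Finset.sum_le_sum fun j hj => ?_
    rw [Finset.mem_Icc] at hi hj
    rcases le_total i j with h | h
    · rw [Nat.sub_eq_zero_of_le h, zero_add]
      exact hcov i j hi.1 h
    · rw [Nat.sub_eq_zero_of_le h, add_zero, covariance_comm]
      exact hcov j i hj.1 h
  have h := Finset.sum_le_sum hij
  rw [Finset.sum_const, Nat.card_Icc, add_tsub_cancel_right, nsmul_eq_mul] at h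
  refine (mul_le_mul_of_nonneg_left h (by positivity)).trans (le_of_eq ?_)
  field_simp

lemma integral_abs_le_sqrt [IsProbabilityMeasure P] {V : Ω → ℝ} (hV : MemLp V 2 P) :
    ∫ ω, |V ω| ∂P ≤ √(∫ ω, V ω ^ 2 ∂P) := by
  refine Real.le_sqrt_of_sq_le ?_
  have hV' : MemLp (fun ω => |V ω|) 2 P := hV.abs
  have h := variance_nonneg (fun ω => |V ω|) P
  rw [variance_eq_sub hV'] at h
  simp only [Pi.pow_apply, sq_abs] at h
  linarith

lemma sq_sqrt_sub_sqrt_le {x y : ℝ} (hx : 0 ≤ x) (hy : 0 ≤ y) : (√x - √y) ^ 2 ≤ |x - y| := by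
  have e : x - y = (√x - √y) * (√x + √y) := by
    have := Real.sq_sqrt hx; have := Real.sq_sqrt hy; linarith
  rw [e, abs_mul, ← sq_abs, pow_two]
  refine mul_le_mul_of_nonneg_left ?_ (abs_nonneg _)
  rw [abs_of_nonneg (add_nonneg (Real.sqrt_nonneg x) (Real.sqrt_nonneg y)), abs_le]
  constructor <;> linarith [Real.sqrt_nonneg x, Real.sqrt_nonneg y]

/-- If the roots differ by at least ε, the numbers themselves differ by at least ε², so convergence
in measure survives the square root even though the root is not Lipschitz at 0. -/
lemma tendstoInMeasure_sqrt {X : ℕ → Ω → ℝ} {m : ℝ} (hX : ∀ N ω, 0 ≤ X N ω) (hm : 0 ≤ m)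
    (hXm : ∀ N, AEStronglyMeasurable (X N) P)
    (h : Tendsto (fun N => ∫⁻ ω, ENNReal.ofReal |X N ω - m| ∂P) atTop (𝓝 0)) :
    TendstoInMeasure P (fun N ω => √(X N ω)) atTop (fun _ => √m) := by
  have h1 : TendstoInMeasure P X atTop (fun _ => m) := by
    refine tendstoInMeasure_of_tendsto_eLpNorm one_ne_zero hXm aestronglyMeasurable_const ?_
    refine h.congr fun N => ?_
    rw [eLpNorm_one_eq_lintegral_enorm]
    simp only [Pi.sub_apply, Real.enorm_eq_ofReal_abs]
  rw [tendstoInMeasure_iff_norm] at h1 ⊢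
  intro ε hε
  refine tendsto_of_tendsto_of_tendsto_of_le_of_le tendsto_const_nhds (h1 (ε ^ 2) (by positivity))
    (fun _ => zero_le) fun N => measure_mono fun ω hω => ?_
  simp only [Set.mem_ofPred_eq, Real.norm_eq_abs] at hω ⊢
  refine le_trans ?_ (sq_sqrt_sub_sqrt_le (hX N ω) hm)
  rw [← sq_abs (√(X N ω) - √m)]
  exact pow_le_pow_left₀ hε.le hω 2

end WeakLaw

/-! ### Increments of the Brownian semistationary process -/

/-- The kernel g is only almost everywhere measurable. A measurable representative is clipped so
that sign, support and tail bound hold at every point; where it agrees with g the clipping changes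
nothing. -/
lemma exists_hasExponentialTail {g : ℝ → ℝ} {M K α β : ℝ} (hg0 : ∀ x, 0 ≤ g x)
    (hgz : ∀ x ≤ 0, g x = 0) (hg : MemLp g 2 volume) (hM : ∫ x, g x ^ 2 ≤ M)
    (ht : ∀ x, K < x → g x ≤ α * Real.exp (-β * x)) :
    ∃ k, HasExponentialTail k M K α β ∧ k =ᵐ[volume] g := by
  obtain ⟨k₀, hk₀, he⟩ := hg.1.aemeasurable
  set b : ℝ → ℝ := fun x => if K < x then min (max (k₀ x) 0) (α * Real.exp (-β * x))
    else max (k₀ x) 0 with hb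
  have hbm : Measurable b :=
    Measurable.ite measurableSet_Ioi ((hk₀.max measurable_const).min (by fun_prop))
      (hk₀.max measurable_const)
  have hkm : Measurable ((Set.Ioi (0 : ℝ)).indicator b) := hbm.indicator measurableSet_Ioi
  have hae : (Set.Ioi (0 : ℝ)).indicator b =ᵐ[volume] g := by
    filter_upwards [he] with x hx
    by_cases h0 : 0 < x
    · rw [Set.indicator_of_mem (Set.mem_Ioi.2 h0)]
      simp only [hb, ← hx, max_eq_left (hg0 x)]
      split_ifs with h
      · exact min_eq_left (ht x h)
      · rfl
    · rw [Set.indicator_of_notMem (by simpa using h0), hgz x (not_lt.1 h0)]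
  have hnn : ∀ x, K < x → 0 ≤ α * Real.exp (-β * x) := fun x hx => (hg0 x).trans (ht x hx)
  refine ⟨_, ⟨hkm, fun x => Set.indicator_nonneg (fun x _ => ?_) x,
    fun x hx => Set.indicator_of_notMem (by simpa using hx) _, hg.ae_eq hae.symm, ?_,
    fun x hx => ?_⟩, hae⟩
  · simp only [hb]
    split_ifs with h
    · exact le_min (le_max_right _ _) (hnn x h)
    · exact le_max_right _ _
  · exact (integral_congr_ae (hae.mono fun x hx => congrArg (· ^ 2) hx)).trans_le hM
  · refine Set.indicator_apply_le' (fun _ => ?_) fun _ => hnn x hx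
    simp only [hb, if_pos hx]
    exact min_le_right _ _

section BSS

variable {Ω : Type*} {mΩ : MeasurableSpace Ω} {P : Measure Ω} {F : Filtration ℝ mΩ}
  {g k : ℝ → ℝ} {σ W Y : ℝ → Ω → ℝ}

/-- Changing the kernel on a null set of times does not affect the L² distance to the approximants,
so the modified kernel has the same Itô integral. -/
lemma IsItoIntegral.congr_integrand {H H' : ℝ → Ω → ℝ} {X : Ω → ℝ}
    (hX : IsItoIntegral F P W H X) (h : ∀ ω, ∀ᵐ s, H s ω = H' s ω) :
    IsItoIntegral F P W H' X := by
  obtain ⟨h2, S, hS, hI⟩ := hX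
  refine ⟨h2, S, hS.congr fun m => lintegral_congr fun ω => lintegral_congr_ae ?_, hI⟩
  filter_upwards [h ω] with s hs
  rw [hs]

lemma IsBSSProcess.jointlyMeasurable (hY : IsBSSProcess F P g σ W Y) : JointlyMeasurable σ :=
  jointlyMeasurable_of_rightContinuous (fun t => (hY.vol_adapted t).mono (F.le t) le_rfl)
    fun ω t => (hY.vol_cadlag ω t).1

lemma IsBSSProcess.isVolatilityIntegral [IsProbabilityMeasure P]
    (hY : IsBSSProcess F P g σ W Y) (hk : Measurable k) (hkg : k =ᵐ[volume] g) {A : ℝ}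
    (hA : ∀ s, ∫⁻ ω, ENNReal.ofReal (σ s ω ^ 4) ∂P ≤ ENNReal.ofReal A) {t : ℝ} (ht : 0 ≤ t) :
    IsVolatilityIntegral F P σ W (fun s => k (t - s)) (Y t) := by
  refine IsItoIntegral.isVolatilityIntegral hY.brownian hY.vol_pos hY.vol_cadlag hY.vol_adapted
    ENNReal.ofReal_ne_top hA (f := fun s => k (t - s)) (by fun_prop)
    (memLp_comp_sub_left (hY.kernel_memLp.ae_eq hkg.symm) t)
    ((hY.ito t ht).congr_integrand fun ω => ?_)
  have := (Measure.measurePreserving_sub_left volume t).quasiMeasurePreserving.ae hkg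
  filter_upwards [this] with s hs
  rw [hs]

lemma IsBSSProcess.isVolatilityIntegral_increment [IsProbabilityMeasure P]
    (hY : IsBSSProcess F P g σ W Y) (hk : Measurable k) (hkg : k =ᵐ[volume] g) {A : ℝ}
    (hA : ∀ s, ∫⁻ ω, ENNReal.ofReal (σ s ω ^ 4) ∂P ≤ ENNReal.ofReal A) {h : ℝ} (hh : 0 ≤ h)
    {i : ℕ} (hi : 1 ≤ i) :
    IsVolatilityIntegral F P σ W (incrementKernel k h (i * h)) (increment Y h i) := by
  have hi' : (0 : ℝ) ≤ i - 1 := by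
    have : (1 : ℝ) ≤ i := by exact_mod_cast hi
    linarith
  have h1 := (hY.isVolatilityIntegral hk hkg hA (mul_nonneg (Nat.cast_nonneg i) hh)).sub
    hY.jointlyMeasurable hY.brownian.measurable
    (hY.isVolatilityIntegral hk hkg hA (mul_nonneg hi' hh))
  have e : incrementKernel k h (i * h) =
      fun s => k (i * h - s) - k ((i - 1) * h - s) := by
    ext s
    rw [incrementKernel, show (i * h - h - s : ℝ) = (i - 1) * h - s by ring]
  rw [e]
  exact h1

/-- The `L²` error of the empirical second moment of the increments. -/
lemma IsBSSProcess.integral_sq_average_sub_le [IsProbabilityMeasure P]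
    (hY : IsBSSProcess F P g σ W Y) {A₁ A₃ A₄ A₅ A₆ A₇ K μ h : ℝ}
    (hindep : IndepFun (fun ω t => σ t ω) (fun ω t => W t ω) P)
    (hA0 : 0 ≤ A₁) (hA : ∀ s, ∫⁻ ω, ENNReal.ofReal (σ s ω ^ 4) ∂P ≤ ENNReal.ofReal A₁)
    (hconst : ∀ s, ∫ ω, σ s ω ^ 2 ∂P = ∫ ω, σ 0 ω ^ 2 ∂P) (hA₃ : 0 ≤ A₃)
    (hcov : ∀ s r, cov[fun ω => σ s ω ^ 2, fun ω => σ r ω ^ 2; P] ≤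
      A₃ * Real.exp (-(μ * |s - r|)))
    (hK : 0 ≤ K) (hg : ∀ x, K < x → g x ≤ A₅ * Real.exp (-A₆ * x)) (hA₇ : ∫ x, g x ^ 2 ≤ A₇)
    (hμ0 : 0 < μ) (hμ2 : μ ≤ 2) (hμA : μ ≤ A₄) (hA₄ : A₄ < 2 * A₆) (hh : 0 < h)
    {N : ℕ} (hN : 1 ≤ N) :
    MemLp (fun ω => (1 / (N : ℝ)) * ∑ i ∈ Finset.Icc 1 N, increment Y h i ω ^ 2 -
      ∫ ω, increment Y h 1 ω ^ 2 ∂P) 2 P ∧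
    ∫ ω, ((1 / (N : ℝ)) * ∑ i ∈ Finset.Icc 1 N, increment Y h i ω ^ 2 -
      ∫ ω, increment Y h 1 ω ^ 2 ∂P) ^ 2 ∂P ≤
      4 * constC A₁ A₃ A₄ A₅ A₆ A₇ K h / (1 - Real.exp (-(μ * h))) / N := by
  obtain ⟨k, hk, hkg⟩ := exists_hasExponentialTail hY.kernel_nonneg hY.kernel_zero
    hY.kernel_memLp hA₇ hg
  have hσ := hY.jointlyMeasurable
  have hX : ∀ i : ℕ, 1 ≤ i →
      IsVolatilityIntegral F P σ W (incrementKernel k h (i * h)) (increment Y h i) :=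
    fun i hi => hY.isVolatilityIntegral_increment hk.measurable hkg hA hh.le hi
  have hZ : ∀ i : ℕ, 1 ≤ i → MemLp (fun ω => increment Y h i ω ^ 2) 2 P := by
    intro i hi
    refine (memLp_two_iff_integrable_sq (f := fun ω => increment Y h i ω ^ 2)
      ((hX i hi).memLp_two.1.pow 2)).2 ?_
    simpa only [← pow_mul] using
      (hX i hi).integrable_pow_four hσ hY.brownian hindep ENNReal.ofReal_ne_top hA
  -- E[σ_s²] does not depend on s, so translating the kernel removes the index i: the squared
  -- increments have a common mean.
  have hmean : ∀ i : ℕ, 1 ≤ i → ∫ ω, increment Y h i ω ^ 2 ∂P =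
      (∫ u, (k u - k (u - h)) ^ 2) * ∫ ω, σ 0 ω ^ 2 ∂P := by
    intro i hi
    rw [(hX i hi).integral_sq hσ hY.brownian ENNReal.ofReal_ne_top hA,
      integral_weightedEnergy_self hσ hA0 hA (hX i hi).measurable_kernel (hX i hi).memLp_kernel]
    simp_rw [hconst]
    rw [integral_mul_const,
      ← integral_sub_left_eq_self (fun u => (k u - k (u - h)) ^ 2) volume (i * h)]
    congr 2; ext s
    rw [incrementKernel, show (i * h - h - s : ℝ) = i * h - s - h by ring]
  have hC : 0 ≤ constC A₁ A₃ A₄ A₅ A₆ A₇ K h := by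
    have := hk.bound_nonneg
    have : 0 < 2 * A₆ := by linarith
    have : 0 < 2 * A₆ - A₄ := by linarith
    unfold constC
    positivity
  have key := _root_.integral_sq_average_sub_le (P := P)
    (Z := fun i ω => increment Y h i ω ^ 2)
    (B := 2 * constC A₁ A₃ A₄ A₅ A₆ A₇ K h) (q := Real.exp (-(μ * h))) hZ
    (fun i hi => (hmean i hi).trans (hmean 1 le_rfl).symm) (by positivity) (Real.exp_nonneg _)
    (Real.exp_lt_one_iff.2 (by have := mul_pos hμ0 hh; linarith)) (fun i j hi hij => ?_) hN
  · refine ⟨key.1, key.2.trans (le_of_eq ?_)⟩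
    ring
  · refine (hk.covariance_sq_le hK hμ0 hμ2 hμA hA₄ hh.le hσ hY.brownian hindep hA0 hA₃ hA hcov
      (hX i hi) (hX j (hi.trans hij))).trans (le_of_eq ?_)
    rw [← Real.exp_nat_mul, Nat.cast_sub hij]
    congr 2; ring

end BSS

/-! ### Constants and the main theorem -/

lemma constC_pos {A₁ A₃ A₄ A₅ A₆ A₇ K h : ℝ} (hA₁ : 0 < A₁) (hA₃ : 0 ≤ A₃) (hA₄ : 0 < A₄)
    (hA₆ : A₄ < 2 * A₆) (hA₇ : 0 < A₇) : 0 < constC A₁ A₃ A₄ A₅ A₆ A₇ K h := by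
  have : 0 < 2 * A₆ := hA₄.trans hA₆
  have : 0 < 2 * A₆ - A₄ := sub_pos.2 hA₆
  unfold constC
  positivity

lemma constC_lt_constC {A₁ A₃ A₄ A₅ A₆ A₇ K h h' : ℝ} (hA₁ : 0 < A₁) (hA₃ : 0 ≤ A₃)
    (hA₄ : 0 < A₄) (hA₆ : A₄ < 2 * A₆) (hA₇ : 0 < A₇) (hh : h < h') :
    constC A₁ A₃ A₄ A₅ A₆ A₇ K h < constC A₁ A₃ A₄ A₅ A₆ A₇ K h' := by
  have : 0 < 2 * A₆ := hA₄.trans hA₆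
  have : 0 < 2 * A₆ - A₄ := sub_pos.2 hA₆
  unfold constC
  gcongr

lemma rateD_pos {A₄ c h : ℝ} (hA₄ : 0 < A₄) (hc : 1 < c) (hh : 0 < h) : 0 < rateD A₄ c h :=
  mul_pos (lt_min two_pos (mul_pos hA₄ (lt_min one_pos (Real.log_pos hc)))) hh

/-- The rate is cut down for the kernel estimates: it must not exceed 2, for the factors exp(2h) and
exp(2K), nor A₄ < 2 A₆, for the exponential moment of g². Lowering it only weakens the covariance
bound. -/
lemma rpow_le_exp_min_mul {A₄ c x : ℝ} (hA₄ : 0 < A₄) (hc : 1 < c) (hx : 0 ≤ x) :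
    c ^ (-A₄ * x) ≤ Real.exp (-(min 2 (A₄ * min 1 (Real.log c)) * x)) := by
  rw [Real.rpow_def_of_pos (one_pos.trans hc)]
  refine Real.exp_le_exp.2 ?_
  have h1 : min 2 (A₄ * min 1 (Real.log c)) ≤ A₄ * Real.log c :=
    (min_le_right _ _).trans (mul_le_mul_of_nonneg_left (min_le_right _ _) hA₄.le)
  have := mul_le_mul_of_nonneg_right h1 hx
  linarith

theorem mainTheorem3 {Ω : Type*} {mΩ : MeasurableSpace Ω} (P : Measure Ω)
    [IsProbabilityMeasure P] (F : Filtration ℝ mΩ) (g : ℝ → ℝ) (σ W Y : ℝ → Ω → ℝ)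
    (hY : IsBSSProcess F P g σ W Y)
    (Δ : ℕ → ℝ) (hΔpos : ∀ n, 0 < Δ n) (hΔlim : Tendsto Δ atTop (𝓝 0))
    (A₁ A₂ A₃ A₄ A₅ A₆ A₇ K c : ℝ) (a : ℕ → ℝ)
    (hindep : IndepFun (fun ω t => σ t ω) (fun ω t => W t ω) P)
    (hA₁ : (⨆ s, ∫⁻ ω, ENNReal.ofReal (σ s ω ^ 4) ∂P) < ENNReal.ofReal A₁)
    (hconst : ∀ s, ∫ ω, σ s ω ^ 2 ∂P = ∫ ω, σ 0 ω ^ 2 ∂P)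
    (hA₂ : ∫ ω, σ 0 ω ^ 2 ∂P < A₂)
    (hc : 1 < c) (hA₄ : 0 < A₄)
    (hcov : ∀ s r, cov[fun ω => σ s ω ^ 2, fun ω => σ r ω ^ 2; P] ≤ A₃ * c ^ (-A₄ * |s - r|))
    (hK : 0 ≤ K) (hg : ∀ x, K < x → g x < A₅ * Real.exp (-A₆ * x))
    (hA₆ : (1 / 2) * A₄ < A₆)
    (hA₇ : ∫ x, g x ^ 2 < A₇)
    (hapos : ∀ n, 0 < a n) (ha : ∀ n, a n ≤ ∫ ω, increment Y (Δ n) 1 ω ^ 2 ∂P) :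
    -- consistency for every fixed mesh
    (∀ n, TendstoInMeasure P (fun (N : ℕ) ω => empiricalScaleFactor Y (Δ n) N ω) atTop
      (fun _ => scaleFactor P Y (Δ n))) ∧
    -- the bound of order `E_n / √N`
    (∀ n N : ℕ, 1 ≤ N →
      ∫ ω, min |(empiricalScaleFactor Y (Δ n) N ω / scaleFactor P Y (Δ n)) ^ 2 - 1| 1 ∂P ≤
        constE A₁ A₃ A₄ A₅ A₆ A₇ K c (Δ n) (a n) / √(N : ℝ)) ∧
    -- the accuracy reached for `N ≥ E_n² n^(1 + 2δ)`
    (∀ δ : ℝ, 0 < δ → ∀ n N : ℕ, 1 ≤ n →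
      constE A₁ A₃ A₄ A₅ A₆ A₇ K c (Δ n) (a n) ^ 2 * (n : ℝ) ^ (1 + 2 * δ) ≤ (N : ℝ) →
      ∫ ω, min |(empiricalScaleFactor Y (Δ n) N ω / scaleFactor P Y (Δ n)) ^ 2 - 1| 1 ∂P ≤
        (n : ℝ) ^ (-(1 / 2 + δ))) ∧
    -- the size of `E_n`, with an explicit numerator that does not depend on `n`
    (∀ n, constE A₁ A₃ A₄ A₅ A₆ A₇ K c (Δ n) (a n) <
      3 * √(constC A₁ A₃ A₄ A₅ A₆ A₇ K (1 + ⨆ k, Δ k)) /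
        (a n * (1 - Real.exp (-rateD A₄ c (Δ n))))) := by

  have hA : ∀ s, ∫⁻ ω, ENNReal.ofReal (σ s ω ^ 4) ∂P ≤ ENNReal.ofReal A₁ := fun s =>
    (le_iSup (fun s => ∫⁻ ω, ENNReal.ofReal (σ s ω ^ 4) ∂P) s).trans hA₁.le
  have hA₁0 : 0 < A₁ := ENNReal.ofReal_pos.1 (zero_le.trans_lt hA₁)
  -- On the diagonal the covariance is a variance.
  have hA₃ : 0 ≤ A₃ := by
    have h := hcov 0 0
    rw [covariance_self ((hY.jointlyMeasurable.measurable_at 0).pow_const 2).aemeasurable] at h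
    simpa using (variance_nonneg _ _).trans h
  have hA₇0 : 0 < A₇ := (integral_nonneg fun _ => sq_nonneg _).trans_lt hA₇
  have hA₆' : A₄ < 2 * A₆ := by linarith
  have hμA : min 2 (A₄ * min 1 (Real.log c)) ≤ A₄ :=
    (min_le_right _ _).trans (mul_le_of_le_one_right hA₄.le (min_le_left _ _))
  have hμ0 : 0 < min 2 (A₄ * min 1 (Real.log c)) :=
    lt_min two_pos (mul_pos hA₄ (lt_min one_pos (Real.log_pos hc)))
  have hC : ∀ h, 0 < constC A₁ A₃ A₄ A₅ A₆ A₇ K h := fun h => constC_pos hA₁0 hA₃ hA₄ hA₆' hA₇0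
  have hq : ∀ n, 0 < 1 - Real.exp (-rateD A₄ c (Δ n)) := fun n => by
    have := Real.exp_lt_one_iff.2 (neg_neg_of_pos (rateD_pos hA₄ hc (hΔpos n)))
    linarith
  have hE : ∀ n, 0 < constE A₁ A₃ A₄ A₅ A₆ A₇ K c (Δ n) (a n) := fun n =>
    div_pos (mul_pos three_pos (Real.sqrt_pos.2 (hC _))) (mul_pos (hapos n) (hq n))
  have key : ∀ (n : ℕ) {N : ℕ}, 1 ≤ N → _ := fun n N hN =>
    hY.integral_sq_average_sub_le hindep hA₁0.le hA hconst hA₃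
      (fun s r => (hcov s r).trans (mul_le_mul_of_nonneg_left
        (rpow_le_exp_min_mul hA₄ hc (abs_nonneg _)) hA₃)) hK (fun x hx => (hg x hx).le) hA₇.le
      hμ0 (min_le_left _ _) hμA hA₆' (hΔpos n) hN
  have hm : ∀ n, 0 < ∫ ω, increment Y (Δ n) 1 ω ^ 2 ∂P := fun n => (hapos n).trans_le (ha n)
  have habs : ∀ n N : ℕ, 1 ≤ N →
      ∫ ω, |(1 / (N : ℝ)) * ∑ i ∈ Finset.Icc 1 N, increment Y (Δ n) i ω ^ 2 -
        ∫ ω, increment Y (Δ n) 1 ω ^ 2 ∂P| ∂P ≤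
      a n * constE A₁ A₃ A₄ A₅ A₆ A₇ K c (Δ n) (a n) / √(N : ℝ) := by
    intro n N hN
    obtain ⟨k1, k2⟩ := key n hN
    refine (integral_abs_le_sqrt k1).trans ?_
    have e : a n * constE A₁ A₃ A₄ A₅ A₆ A₇ K c (Δ n) (a n) / √(N : ℝ) =
        3 * √(constC A₁ A₃ A₄ A₅ A₆ A₇ K (Δ n)) /
          (1 - Real.exp (-rateD A₄ c (Δ n))) / √(N : ℝ) := by
      have := (hapos n).ne'
      have := (hq n).ne'
      unfold constE
      field_simp
    rw [e]
    have hq1 : 1 - Real.exp (-rateD A₄ c (Δ n)) ≤ 1 := by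
      linarith [Real.exp_pos (-rateD A₄ c (Δ n))]
    have hq0 := hq n
    have hC0 := (hC (Δ n)).le
    -- With q' = 1 - exp(-D_n) in (0, 1], it remains to see that 4 C / q' ≤ 9 C / q'². The factor 3
    -- in `constE` exceeds the needed √4, and q'² ≤ q' replaces the root of q' by q' itself.
    refine Real.sqrt_le_iff.2 ⟨by positivity, k2.trans ?_⟩
    rw [div_pow, div_pow, mul_pow, Real.sq_sqrt hC0, Real.sq_sqrt (Nat.cast_nonneg N)]
    refine div_le_div_of_nonneg_right ?_ (Nat.cast_nonneg N)
    refine div_le_div₀ (by positivity) (by linarith) (by positivity) ?_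
    exact pow_le_of_le_one hq0.le hq1 two_ne_zero
  have hmin : ∀ n N : ℕ, 1 ≤ N →
      ∫ ω, min |(empiricalScaleFactor Y (Δ n) N ω / scaleFactor P Y (Δ n)) ^ 2 - 1| 1 ∂P ≤
        constE A₁ A₃ A₄ A₅ A₆ A₇ K c (Δ n) (a n) / √(N : ℝ) := by
    intro n N hN
    have hle : ∀ ω, min |(empiricalScaleFactor Y (Δ n) N ω / scaleFactor P Y (Δ n)) ^ 2 - 1| 1 ≤
        (1 / a n) * |(1 / (N : ℝ)) * ∑ i ∈ Finset.Icc 1 N, increment Y (Δ n) i ω ^ 2 -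
          ∫ ω, increment Y (Δ n) 1 ω ^ 2 ∂P| := by
      intro ω
      refine (min_le_left _ _).trans ?_
      rw [empiricalScaleFactor, scaleFactor, div_pow, Real.sq_sqrt (by positivity),
        Real.sq_sqrt (hm n).le, div_sub_one (hm n).ne', abs_div, abs_of_pos (hm n),
        div_eq_inv_mul, ← one_div]
      exact mul_le_mul_of_nonneg_right (one_div_le_one_div_of_le (hapos n) (ha n)) (abs_nonneg _)
    refine (integral_mono_of_nonneg (ae_of_all _ fun ω => le_min (abs_nonneg _) zero_le_one)
      (((key n hN).1.integrable one_le_two).abs.const_mul _) (ae_of_all _ hle)).trans ?_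
    rw [integral_const_mul]
    refine (mul_le_mul_of_nonneg_left (habs n N hN) (one_div_nonneg.2 (hapos n).le)).trans
      (le_of_eq ?_)
    have := (hapos n).ne'
    field_simp
  refine ⟨fun n => ?_, hmin, fun δ hδ n N hn hN => ?_, fun n => ?_⟩
  · have hmem : ∀ N : ℕ, MemLp (fun ω => (1 / (N : ℝ)) *
        ∑ i ∈ Finset.Icc 1 N, increment Y (Δ n) i ω ^ 2 -
          ∫ ω, increment Y (Δ n) 1 ω ^ 2 ∂P) 2 P := by
      intro N
      -- For N = 0 the empirical mean is 0; this index has no influence on the limit but still needs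
      -- measurability.
      rcases Nat.eq_zero_or_pos N with rfl | hN
      · simp only [Finset.Icc_eq_empty_of_lt one_pos, Finset.sum_empty, mul_zero]
        exact memLp_const _
      · exact (key n hN).1
    refine tendstoInMeasure_sqrt (fun N ω => by positivity) (hm n).le (fun N => ?_) ?_
    · refine ((hmem N).1.add (aestronglyMeasurable_const
        (b := ∫ ω, increment Y (Δ n) 1 ω ^ 2 ∂P))).congr (ae_of_all _ fun ω => ?_)
      simp
    · have hlim : Tendsto (fun N : ℕ => ENNReal.ofReal
          (a n * constE A₁ A₃ A₄ A₅ A₆ A₇ K c (Δ n) (a n) / √(N : ℝ))) atTop (𝓝 0) := by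
        rw [← ENNReal.ofReal_zero]
        exact ENNReal.tendsto_ofReal (tendsto_const_nhds.div_atTop
          (Real.tendsto_sqrt_atTop.comp tendsto_natCast_atTop_atTop))
      refine tendsto_of_tendsto_of_tendsto_of_le_of_le' tendsto_const_nhds hlim
        (Eventually.of_forall fun _ => zero_le) ?_
      filter_upwards [eventually_ge_atTop 1] with N hN
      rw [← ofReal_integral_eq_lintegral_ofReal ((hmem N).integrable one_le_two).abs
        (ae_of_all _ fun _ => abs_nonneg _)]
      exact ENNReal.ofReal_le_ofReal (habs n N hN)
  · have hn0 : (0 : ℝ) < n := by exact_mod_cast hn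
    -- E_n > 0 and n ≥ 1 force N ≥ 1, so the bound with E_n / √N applies.
    have hN0 : (0 : ℝ) < N := (mul_pos (pow_pos (hE n) 2) (Real.rpow_pos_of_pos hn0 _)).trans_le hN
    refine (hmin n N (by exact_mod_cast hN0)).trans ?_
    rw [div_le_iff₀ (Real.sqrt_pos.2 hN0), Real.rpow_neg hn0.le, ← div_eq_inv_mul,
      le_div_iff₀ (Real.rpow_pos_of_pos hn0 _)]
    refine Real.le_sqrt_of_sq_le (le_of_eq_of_le ?_ hN)
    rw [mul_pow, ← Real.rpow_natCast ((n : ℝ) ^ (1 / 2 + δ)), ← Real.rpow_mul hn0.le]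
    congr 2; push_cast; ring
  -- A convergent sequence is bounded, so the supremum is genuine; the added 1 makes the inequality
  -- strict, and `constC` is strictly increasing in the mesh.
  · have hlt : Δ n < 1 + ⨆ k, Δ k := by
      have := le_ciSup hΔlim.bddAbove_range n
      linarith
    exact div_lt_div_of_pos_right (mul_lt_mul_of_pos_left (Real.sqrt_lt_sqrt (hC _).le
      (constC_lt_constC hA₁0 hA₃ hA₄ hA₆' hA₇0 hlt)) three_pos) (mul_pos (hapos n) (hq n))
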